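/- A cactus is a finite connected simple graph in which any two distinct cycles share at most one vertex. For a graph $G$, let $\mathbf{czf}(G)$ (the constrained zero forcing number) be the minimum size of a set $B$ of vertices such that, if initially exactly the vertices of $B$ are colored, all vertices can be colored by repeatedly applying the following rule: if a vertex $c\in B$ has exactly one uncolored neighbor $u$, then $u$ becomes colored. In constrained fast-mixed search, all vertices and edges are contaminated at first, and each action either places a new searcher on a contaminated vertex (one that has never been occupied), or slides a searcher that has not slid before from its vertex $u$ along an edge $uv$ to $v$, provided that $uv$ is the only contaminated edge incident with $u$. An edge is cleared as soon as both its endpoints are occupied or a searcher slides along it, and a vertex is cleared as soon as it is occupied. A strategy (a finite sequence of such actions) clears $G$ if in the end all edges and vertices are cleared; it is optimal if it uses the least possible number of searchers. **Theorem.** There is an algorithm that, given a cactus $G=(V,E)$ by adjacency lists, computes in time $O(|V|+|E|)$, on a random access machine with unit-cost operations on words of $\log|V|+O(1)$ bits, both the number $\mathbf{czf}(G)$ and an optimal constrained fast-mixed search strategy for $G$, which uses exactly $\mathbf{czf}(G)$ searchers; in this strategy all searchers are placed before the first slide. -/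

import Mathlib

/-! ## Constrained zero forcing, constrained fast-mixed search and cacti -/

namespace GraphSearch

variable {V : Type*}

/-- `ForcedFrom G B X`: starting with exactly the vertices of `B` colored, the set of colored
vertices can become `X` by successive forces, where a colored vertex `c` forces an uncolored
vertex `u` if `u` is the only uncolored neighbor of `c`, and where only the initially colored
vertices (those of `B`) may force. -/
inductive ForcedFrom (G : SimpleGraph V) (B : Set V) : Set V → Prop
  | start : ForcedFrom G B B
  | force {X : Set V} {c u : V} (hX : ForcedFrom G B X) (hc : c ∈ B) (hcu : G.Adj c u)
      (hu : u ∉ X) (huniq : ∀ w, G.Adj c w → w ∉ X → w = u) : ForcedFrom G B (insert u X)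

/-- The constrained zero forcing number: the least size of an initially colored set from which
all vertices eventually become colored. -/
noncomputable def czf (G : SimpleGraph V) : ℕ :=
  sInf {k | ∃ B : Finset V, B.card = k ∧ ForcedFrom G (B : Set V) Set.univ}

/-- A cactus: a connected graph in which any two (distinct) cycles share at most one vertex. -/
def IsCactus (G : SimpleGraph V) : Prop :=
  G.Connected ∧
    ∀ (u v : V) (p : G.Walk u u) (q : G.Walk v v), p.IsCycle → q.IsCycle →
      p.toSubgraph ≠ q.toSubgraph → {x | x ∈ p.support ∧ x ∈ q.support}.Subsingleton

/-- The two actions of fast-mixed search. -/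
inductive SearchAction (V : Type*)
  | place (v : V)
  | slide (u v : V)

/-- A configuration of the search. A vertex is contaminated as long as it has never been occupied
by a searcher (`v ∉ visited`), an edge as long as it is not in `cleared`; `fresh` is the set of
occupied vertices whose searcher has not slid yet. There is never more than one searcher on a
vertex. -/
structure SearchState (V : Type*) where
  visited : Set V
  occupied : Set V
  fresh : Set V
  cleared : Set (Sym2 V)

/-- No searchers; everything is contaminated. -/
def SearchState.init : SearchState V := ⟨∅, ∅, ∅, ∅⟩

/-- The edges of `G` both of whose endpoints are occupied. -/
def guardedEdges (G : SimpleGraph V) (occ : Set V) : Set (Sym2 V) :=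
  {e | e ∈ G.edgeSet ∧ ∀ v ∈ e, v ∈ occ}

/-- The rules of constrained fast-mixed search: a searcher may be placed on a contaminated vertex;
a searcher on `u` that has not slid before may slide along the edge `uv` if this is the only
contaminated edge incident with `u`. -/
def Allowed (G : SimpleGraph V) (σ : SearchState V) : SearchAction V → Prop
  | .place v => v ∉ σ.visited
  | .slide u v => u ∈ σ.fresh ∧ G.Adj u v ∧ s(u, v) ∉ σ.cleared ∧
      ∀ w, G.Adj u w → s(u, w) ∉ σ.cleared → w = v

/-- The effect of an action. An edge becomes cleared when both its endpoints are occupied, or when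
a searcher slides along it. -/
def next (G : SimpleGraph V) (σ : SearchState V) : SearchAction V → SearchState V
  | .place v =>
      { visited := insert v σ.visited
        occupied := insert v σ.occupied
        fresh := insert v σ.fresh
        cleared := σ.cleared ∪ guardedEdges G (insert v σ.occupied) }
  | .slide u v =>
      { visited := insert v σ.visited
        occupied := insert v (σ.occupied \ {u})
        fresh := σ.fresh \ {u}
        cleared := insert s(u, v) (σ.cleared ∪ guardedEdges G (insert v (σ.occupied \ {u}))) }

/-- A search strategy: a finite sequence of actions. Placing and sliding may be interleaved. -/
abbrev Strategy (V : Type*) := List (SearchAction V)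

/-- Every action of the strategy, performed from `σ` on, obeys the rules. -/
def LegalFrom (G : SimpleGraph V) : SearchState V → Strategy V → Prop
  | _, [] => True
  | σ, a :: S => Allowed G σ a ∧ LegalFrom G (next G σ a) S

/-- The final configuration of a strategy. -/
def finalState (G : SimpleGraph V) (S : Strategy V) : SearchState V :=
  S.foldl (next G) SearchState.init

/-- The strategy obeys the rules and clears the graph: in the end all edges are cleared and no
vertex is contaminated. (For a vertex that is not isolated the second condition follows from the
first; an isolated vertex needs a searcher of its own.) -/
def Clears (G : SimpleGraph V) (S : Strategy V) : Prop :=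
  LegalFrom G SearchState.init S ∧ G.edgeSet ⊆ (finalState G S).cleared ∧
    (finalState G S).visited = Set.univ

/-- The number of searchers used, that is, the number of placing actions. -/
def searcherCount : Strategy V → ℕ
  | [] => 0
  | .place _ :: S => searcherCount S + 1
  | .slide _ _ :: S => searcherCount S

/-- An optimal constrained fast-mixed search strategy. -/
def IsOptimal (G : SimpleGraph V) (S : Strategy V) : Prop :=
  Clears G S ∧ ∀ T : Strategy V, Clears G T → searcherCount S ≤ searcherCount T

/-- The normalized strategy that first places searchers on the listed vertices, and then performs
the listed slides. -/
def normalized (places : List V) (slides : List (V × V)) : Strategy V :=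
  places.map SearchAction.place ++ slides.map fun p => SearchAction.slide p.1 p.2

end GraphSearch

/-! ## Random access machine programs with a step count and a bounded word size -/

namespace RAM

/-- A memory content: registers `reg x`, and arrays `mem a` with cells `mem a i`. A program
mentions registers and arrays by fixed names, hence only finitely many of them; array cells are
addressed indirectly. -/
structure Store where
  reg : ℕ → ℕ
  mem : ℕ → ℕ → ℕ

/-- Expressions: constants, registers, array cells, addition, truncated subtraction and
comparisons. -/
inductive Expr
  | lit (c : ℕ)
  | reg (x : ℕ)
  | cell (a : ℕ) (i : Expr)
  | add (e f : Expr)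
  | sub (e f : Expr)
  | lt (e f : Expr)
  | eq (e f : Expr)

/-- The value of an expression; comparisons give `1` (true) or `0` (false). -/
def Expr.eval (s : Store) : Expr → ℕ
  | .lit c => c
  | .reg x => s.reg x
  | .cell a i => s.mem a (i.eval s)
  | .add e f => e.eval s + f.eval s
  | .sub e f => e.eval s - f.eval s
  | .lt e f => if e.eval s < f.eval s then 1 else 0
  | .eq e f => if e.eval s = f.eval s then 1 else 0

/-- One step for each constant, register access, array access, operation and comparison. -/
def Expr.cost : Expr → ℕ
  | .lit _ => 1
  | .reg _ => 1
  | .cell _ i => i.cost + 1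
  | .add e f => e.cost + f.cost + 1
  | .sub e f => e.cost + f.cost + 1
  | .lt e f => e.cost + f.cost + 1
  | .eq e f => e.cost + f.cost + 1

/-- No number that occurs in the evaluation of the expression (addresses included) exceeds the
largest machine word `W`. -/
def Expr.Fits (W : ℕ) (s : Store) : Expr → Prop
  | .lit c => c ≤ W
  | .reg x => s.reg x ≤ W
  | .cell a i => i.Fits W s ∧ s.mem a (i.eval s) ≤ W
  | .add e f => e.Fits W s ∧ f.Fits W s ∧ e.eval s + f.eval s ≤ W
  | .sub e f => e.Fits W s ∧ f.Fits W s
  | .lt e f => e.Fits W s ∧ f.Fits W s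
  | .eq e f => e.Fits W s ∧ f.Fits W s

/-- Programs: assignment to a register, assignment to an array cell, composition, branching and
loops; a condition is true if its value is not `0`. -/
inductive Program
  | skip
  | assign (x : ℕ) (e : Expr)
  | write (a : ℕ) (i e : Expr)
  | seq (p q : Program)
  | ite (e : Expr) (p q : Program)
  | loop (e : Expr) (p : Program)

/-- `Exec W p s t s'`: started in the store `s`, the program `p` halts after `t` steps in the store
`s'`, and no number that occurs in the computation exceeds `W`. -/
inductive Exec (W : ℕ) : Program → Store → ℕ → Store → Prop
  | skip (s : Store) : Exec W .skip s 1 s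
  | assign (s : Store) (x : ℕ) (e : Expr) (he : e.Fits W s) :
      Exec W (.assign x e) s (e.cost + 1) ⟨Function.update s.reg x (e.eval s), s.mem⟩
  | write (s : Store) (a : ℕ) (i e : Expr) (hi : i.Fits W s) (he : e.Fits W s) :
      Exec W (.write a i e) s (i.cost + e.cost + 1)
        ⟨s.reg, Function.update s.mem a (Function.update (s.mem a) (i.eval s) (e.eval s))⟩
  | seq {p q : Program} {s s₁ s₂ : Store} {t₁ t₂ : ℕ} (hp : Exec W p s t₁ s₁)
      (hq : Exec W q s₁ t₂ s₂) : Exec W (.seq p q) s (t₁ + t₂) s₂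
  | iteTrue {e : Expr} {p q : Program} {s s₁ : Store} {t : ℕ} (he : e.Fits W s)
      (hc : e.eval s ≠ 0) (hp : Exec W p s t s₁) : Exec W (.ite e p q) s (e.cost + 1 + t) s₁
  | iteFalse {e : Expr} {p q : Program} {s s₁ : Store} {t : ℕ} (he : e.Fits W s)
      (hc : e.eval s = 0) (hq : Exec W q s t s₁) : Exec W (.ite e p q) s (e.cost + 1 + t) s₁
  | loopDone {e : Expr} {p : Program} {s : Store} (he : e.Fits W s) (hc : e.eval s = 0) :
      Exec W (.loop e p) s (e.cost + 1) s
  | loopStep {e : Expr} {p : Program} {s s₁ s₂ : Store} {t₁ t₂ : ℕ} (he : e.Fits W s)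
      (hc : e.eval s ≠ 0) (hp : Exec W p s t₁ s₁) (hl : Exec W (.loop e p) s₁ t₂ s₂) :
      Exec W (.loop e p) s (e.cost + 1 + t₁ + t₂) s₂

/-- `adj` lists, for each vertex, its neighbors, each of them once and in an arbitrary order. -/
def IsAdjacencyList {n : ℕ} (G : SimpleGraph (Fin n)) (adj : Fin n → List (Fin n)) : Prop :=
  ∀ v, (adj v).Nodup ∧ ∀ w, w ∈ adj v ↔ G.Adj v w

/-- The adjacency lists one after the other in a single list. -/
def concatLists {n : ℕ} (adj : Fin n → List (Fin n)) : List (Fin n) :=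
  (List.ofFn adj).flatten

/-- The position in `concatLists adj` at which the list of vertex number `v` begins (for `v = n`:
the total length). -/
def listStart {n : ℕ} (adj : Fin n → List (Fin n)) (v : ℕ) : ℕ :=
  (((List.ofFn adj).take v).flatten).length

/-- The initial memory content: register `0` holds the number `n` of vertices, the cells `0, …, n`
of array `0` hold the positions at which the adjacency lists begin and end in array `1`, and
array `1` holds the adjacency lists. All other cells and registers hold `0`. -/
def inputStore {n : ℕ} (adj : Fin n → List (Fin n)) : Store where
  reg x := if x = 0 then n else 0
  mem a i :=
    if a = 0 then (if i ≤ n then listStart adj i else 0)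
    else if a = 1 then ((concatLists adj)[i]?.map Fin.val).getD 0
    else 0

/-- The memory holds the output: register `0` holds the number `k`; register `1` holds the length
of the list of placements, which is in array `0`; register `2` holds the length of the list of
slides, whose starting points are in array `1` and whose end points are in array `2`. -/
def HoldsOutput {n : ℕ} (s : Store) (k : ℕ) (places : List (Fin n))
    (slides : List (Fin n × Fin n)) : Prop :=
  s.reg 0 = k ∧
  s.reg 1 = places.length ∧
  (∀ i (hi : i < places.length), s.mem 0 i = (places[i] : ℕ)) ∧
  s.reg 2 = slides.length ∧
  ∀ i (hi : i < slides.length), s.mem 1 i = (slides[i].1 : ℕ) ∧ s.mem 2 i = (slides[i].2 : ℕ)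

end RAM

/-! For a cactus, czf(G) equals |V| minus the size of a maximum matching, and a maximum matching can
be found and scheduled in linear time.

Lower bound. A vertex of B forces at most once, since afterwards all its neighbors are colored, and
a searcher slides at most once. So the vertices outside B, or those on which no searcher was placed,
are matched with distinct vertices of B, or with distinct vertices of placement
(`ForcedFrom.exists_compl_isMatched`, `Clears.exists_isMatched`). This also covers strategies that
interleave placements and slides. Conversely, suppose that the edges of a matching are oriented from
source to target and listed so that no source is adjacent to a target listed later. Then the list is
a forcing sequence started from the non-targets, and also a clearing strategy with all placements
first (`IsPlan`). Hence a matching of maximum size with such an orientation and order suffices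
(`IsPlan.optimal`).

The matching. In a depth-first search tree of a cactus each tree edge is covered by at most one back
edge (`SearchTree.cov_unique`), so every cycle is a tree path from a bottom up to a top, closed by
one back edge. Going bottom-up, a vertex not matched from below is matched with its parent if the
parent is free. On a cycle, however, the decision is postponed for the run of vertices, starting at
the bottom, that are not matched from below. At the top the parity of the run is known: if it is odd
and the top is free, the bottom is matched with the top. A top-down pass then pairs the vertices of
each run from its upper end, which leaves over only the bottom of an odd run (`parity`).

Maximality is certified by an odd set cover. It consists of the vertices matched from below in the
first pass, every second vertex of each odd run, and, for each even run of 2k vertices, the odd set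
formed by the run and the top of its cycle, which contains at most k matching edges. Every edge
touches a chosen vertex or lies in such a set (`edge_cover`), and the total capacity is at most the
number of computed edges (`card_cover_le`), so no matching is larger (`card_matching_le`).

The orientation. Matched edges are used upwards, with one exception: if the lower vertex of a pair
is the bottom of a cycle whose top is itself a target, the upper vertex slides down. Upward slides
by decreasing target, followed by downward slides by increasing target, are a valid order
(`Slides.order_up`, `Slides.order_down`).

The machine. All loop bodies are free of loops, so a potential bounds the time (`total_loop`). Every
stored value exceeds the previous maximum by at most one, so a linear time bound also bounds the
words linearly (`Run.exec`). -/

namespace RAM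

/-! ### Word sizes -/

/-- `Run p s t s'`: like `Exec`, without a bound on the numbers. -/
inductive Run : Program → Store → ℕ → Store → Prop
  | skip (s : Store) : Run .skip s 1 s
  | assign (s : Store) (x : ℕ) (e : Expr) :
      Run (.assign x e) s (e.cost + 1) ⟨Function.update s.reg x (e.eval s), s.mem⟩
  | write (s : Store) (a : ℕ) (i e : Expr) :
      Run (.write a i e) s (i.cost + e.cost + 1)
        ⟨s.reg, Function.update s.mem a (Function.update (s.mem a) (i.eval s) (e.eval s))⟩
  | seq {p q : Program} {s s₁ s₂ : Store} {t₁ t₂ : ℕ} (hp : Run p s t₁ s₁)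
      (hq : Run q s₁ t₂ s₂) : Run (.seq p q) s (t₁ + t₂) s₂
  | iteTrue {e : Expr} {p q : Program} {s s₁ : Store} {t : ℕ}
      (hc : e.eval s ≠ 0) (hp : Run p s t s₁) : Run (.ite e p q) s (e.cost + 1 + t) s₁
  | iteFalse {e : Expr} {p q : Program} {s s₁ : Store} {t : ℕ}
      (hc : e.eval s = 0) (hq : Run q s t s₁) : Run (.ite e p q) s (e.cost + 1 + t) s₁
  | loopDone {e : Expr} {p : Program} {s : Store} (hc : e.eval s = 0) :
      Run (.loop e p) s (e.cost + 1) s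
  | loopStep {e : Expr} {p : Program} {s s₁ s₂ : Store} {t₁ t₂ : ℕ}
      (hc : e.eval s ≠ 0) (hp : Run p s t₁ s₁) (hl : Run (.loop e p) s₁ t₂ s₂) :
      Run (.loop e p) s (e.cost + 1 + t₁ + t₂) s₂

/-- All numbers in the store are at most `M`. -/
def Store.Bounded (s : Store) (M : ℕ) : Prop := (∀ x, s.reg x ≤ M) ∧ ∀ a i, s.mem a i ≤ M

/-- A coefficient `k` such that the value is at most `k * (M + 1)` if all stored numbers are at
most `M`. -/
def Expr.weight : Expr → ℕ
  | .lit c => c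
  | .reg _ => 1
  | .cell _ _ => 1
  | .add e f => e.weight + f.weight
  | .sub e _ => e.weight
  | .lt _ _ => 1
  | .eq _ _ => 1

/-- The largest weight of a subexpression. -/
def Expr.maxWeight : Expr → ℕ
  | .lit c => c
  | .reg _ => 1
  | .cell _ i => max 1 i.maxWeight
  | .add e f => max (max e.maxWeight f.maxWeight) (e.weight + f.weight)
  | .sub e f => max e.maxWeight f.maxWeight
  | .lt e f => max e.maxWeight f.maxWeight
  | .eq e f => max e.maxWeight f.maxWeight

/-- Expressions whose value exceeds the largest stored number by at most one. -/
def Expr.flat : Expr → Bool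
  | .lit c => c ≤ 1
  | .reg _ => true
  | .cell _ _ => true
  | .add (.reg _) (.lit c) => c ≤ 1
  | .add (.cell _ _) (.lit c) => c ≤ 1
  | .add _ _ => false
  | .sub e _ => e.flat
  | .lt _ _ => true
  | .eq _ _ => true

/-- All expressions of the program have weight at most `w`, and only flat ones are stored. -/
def Program.tame (w : ℕ) : Program → Bool
  | .skip => true
  | .assign _ e => e.maxWeight ≤ w && e.flat
  | .write _ i e => i.maxWeight ≤ w && e.maxWeight ≤ w && e.flat
  | .seq p q => p.tame w && q.tame w
  | .ite e p q => e.maxWeight ≤ w && p.tame w && q.tame w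
  | .loop e p => e.maxWeight ≤ w && p.tame w

theorem Expr.eval_le_weight {s : Store} {M : ℕ} (hs : s.Bounded M) (e : Expr) :
    e.eval s ≤ e.weight * (M + 1) := by
  induction e with
  | lit c => simp only [eval, weight]; nlinarith
  | reg x => simp only [eval, weight]; have := hs.1 x; omega
  | cell a i _ => simp only [eval, weight]; have := hs.2 a (i.eval s); omega
  | add e f he hf => simp only [eval, weight]; rw [add_mul]; omega
  | sub e f he _ => simp only [eval, weight]; omega
  | lt e f _ _ => simp only [eval, weight]; split <;> omega
  | eq e f _ _ => simp only [eval, weight]; split <;> omega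

theorem Expr.fits_of_bounded {s : Store} {M w W : ℕ} (hs : s.Bounded M) (hW : w * (M + 1) ≤ W)
    (hw : 1 ≤ w) (e : Expr) (he : e.maxWeight ≤ w) : e.Fits W s := by
  have hM : M ≤ W := by nlinarith
  induction e with
  | lit c => simp only [Fits, maxWeight] at *; nlinarith
  | reg x => exact (hs.1 x).trans hM
  | cell a i hi =>
    simp only [maxWeight, max_le_iff] at he
    exact ⟨hi he.2, (hs.2 _ _).trans hM⟩
  | add e f ihe ihf =>
    simp only [maxWeight, max_le_iff] at he
    refine ⟨ihe he.1.1, ihf he.1.2, ?_⟩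
    have h := Expr.eval_le_weight hs (.add e f)
    simp only [eval, weight] at h
    exact h.trans ((Nat.mul_le_mul_right _ he.2).trans hW)
  | sub e f ihe ihf =>
    simp only [maxWeight, max_le_iff] at he
    exact ⟨ihe he.1, ihf he.2⟩
  | lt e f ihe ihf =>
    simp only [maxWeight, max_le_iff] at he
    exact ⟨ihe he.1, ihf he.2⟩
  | eq e f ihe ihf =>
    simp only [maxWeight, max_le_iff] at he
    exact ⟨ihe he.1, ihf he.2⟩

/-- Storing arbitrary sums would permit repeated doubling. Flat values raise the maximum by at most
one per assignment, so the maximum grows no faster than the time. -/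
theorem Expr.eval_le_of_flat {s : Store} {M : ℕ} (hs : s.Bounded M) (e : Expr) (he : e.flat) :
    e.eval s ≤ M + 1 := by
  induction e with
  | lit c => simp only [flat, decide_eq_true_eq, eval] at *; omega
  | reg x => exact (hs.1 x).trans (by omega)
  | cell a i _ => exact (hs.2 _ _).trans (by omega)
  | add e f _ _ =>
    cases f with
    | lit c =>
      cases e with
      | reg x =>
        simp only [flat, decide_eq_true_eq, eval] at *
        have := hs.1 x; omega
      | cell a i =>
        simp only [flat, decide_eq_true_eq, eval] at *
        have := hs.2 a (i.eval s); omega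
      | _ => simp [flat] at he
    | _ => simp [flat] at he
  | sub e f ihe _ =>
    simp only [flat, eval] at *
    have := ihe he; omega
  | lt e f _ _ => simp only [eval]; split <;> omega
  | eq e f _ _ => simp only [eval]; split <;> omega

theorem Store.Bounded.mono {s : Store} {M N : ℕ} (hs : s.Bounded M) (h : M ≤ N) : s.Bounded N :=
  ⟨fun x => (hs.1 x).trans h, fun a i => (hs.2 a i).trans h⟩

/-- The numbers occurring in a run of a tame program grow at most linearly with time. -/
theorem Run.exec {w W : ℕ} (hw : 1 ≤ w) {p : Program} {s s' : Store} {t : ℕ} (h : Run p s t s') :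
    p.tame w → ∀ M, s.Bounded M → w * (M + t + 1) ≤ W → Exec W p s t s' ∧ s'.Bounded (M + t) := by
  induction h with
  | skip s => exact fun _ M hM _ => ⟨.skip s, hM.mono (by omega)⟩
  | assign s x e =>
    intro hp M hM hW
    simp only [Program.tame, Bool.and_eq_true, decide_eq_true_eq] at hp
    refine ⟨.assign s x e (e.fits_of_bounded hM (le_trans ?_ hW) hw hp.1), ?_, ?_⟩
    · exact Nat.mul_le_mul_left _ (by omega)
    · intro y
      have := e.eval_le_of_flat hM hp.2
      have := hM.1 y
      by_cases hy : y = x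
      · subst hy; simp only [Function.update_self]; omega
      · simp only [Function.update_of_ne hy]; omega
    · exact fun a i => (hM.2 a i).trans (by omega)
  | write s a i e =>
    intro hp M hM hW
    simp only [Program.tame, Bool.and_eq_true, decide_eq_true_eq] at hp
    have hW' : w * (M + 1) ≤ W := le_trans (Nat.mul_le_mul_left _ (by omega)) hW
    refine ⟨.write s a i e (i.fits_of_bounded hM hW' hw hp.1.1)
      (e.fits_of_bounded hM hW' hw hp.1.2), ?_, ?_⟩
    · exact fun x => (hM.1 x).trans (by omega)
    · intro b j
      have := e.eval_le_of_flat hM hp.2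
      have := hM.2 b j
      by_cases hb : b = a
      · subst hb
        simp only [Function.update_self, Function.update_apply]
        split <;> omega
      · simp only [Function.update_of_ne hb]; omega
  | @seq p q s s₁ s₂ t₁ t₂ _ _ ih₁ ih₂ =>
    intro hp M hM hW
    simp only [Program.tame, Bool.and_eq_true] at hp
    obtain ⟨h₁, hb₁⟩ := ih₁ hp.1 M hM (le_trans (Nat.mul_le_mul_left _ (by omega)) hW)
    obtain ⟨h₂, hb₂⟩ := ih₂ hp.2 _ hb₁ (le_trans (Nat.mul_le_mul_left _ (by omega)) hW)
    exact ⟨.seq h₁ h₂, hb₂.mono (by omega)⟩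
  | @iteTrue e p q s s₁ t hc _ ih =>
    intro hp M hM hW
    simp only [Program.tame, Bool.and_eq_true, decide_eq_true_eq] at hp
    obtain ⟨h₁, hb₁⟩ := ih hp.1.2 M hM (le_trans (Nat.mul_le_mul_left _ (by omega)) hW)
    exact ⟨.iteTrue (e.fits_of_bounded hM (le_trans (Nat.mul_le_mul_left _ (by omega)) hW) hw
      hp.1.1) hc h₁, hb₁.mono (by omega)⟩
  | @iteFalse e p q s s₁ t hc _ ih =>
    intro hp M hM hW
    simp only [Program.tame, Bool.and_eq_true, decide_eq_true_eq] at hp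
    obtain ⟨h₁, hb₁⟩ := ih hp.2 M hM (le_trans (Nat.mul_le_mul_left _ (by omega)) hW)
    exact ⟨.iteFalse (e.fits_of_bounded hM (le_trans (Nat.mul_le_mul_left _ (by omega)) hW) hw
      hp.1.1) hc h₁, hb₁.mono (by omega)⟩
  | @loopDone e p s hc =>
    intro hp M hM hW
    simp only [Program.tame, Bool.and_eq_true, decide_eq_true_eq] at hp
    exact ⟨.loopDone (e.fits_of_bounded hM (le_trans (Nat.mul_le_mul_left _ (by omega)) hW) hw
      hp.1) hc, hM.mono (by omega)⟩
  | @loopStep e p s s₁ s₂ t₁ t₂ hc _ _ ih₁ ih₂ =>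
    intro hp M hM hW
    have hp' := hp
    simp only [Program.tame, Bool.and_eq_true, decide_eq_true_eq] at hp
    obtain ⟨h₁, hb₁⟩ := ih₁ hp.2 M hM (le_trans (Nat.mul_le_mul_left _ (by omega)) hW)
    obtain ⟨h₂, hb₂⟩ := ih₂ hp' _ hb₁ (le_trans (Nat.mul_le_mul_left _ (by omega)) hW)
    exact ⟨.loopStep (e.fits_of_bounded hM (le_trans (Nat.mul_le_mul_left _ (by omega)) hW) hw
      hp.1) hc h₁ h₂, hb₂.mono (by omega)⟩

/-! ### Running times -/

/-- From `s`, the program halts within `T` steps in a store that satisfies `Q`. -/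
def Total (p : Program) (s : Store) (T : ℕ) (Q : Store → Prop) : Prop :=
  ∃ t s', t ≤ T ∧ Run p s t s' ∧ Q s'

theorem Total.seq {p q : Program} {s : Store} {T₁ T₂ : ℕ} {Q₁ Q₂ : Store → Prop}
    (h₁ : Total p s T₁ Q₁) (h₂ : ∀ s', Q₁ s' → Total q s' T₂ Q₂) :
    Total (.seq p q) s (T₁ + T₂) Q₂ := by
  obtain ⟨t₁, s₁, ht₁, hr₁, hq₁⟩ := h₁
  obtain ⟨t₂, s₂, ht₂, hr₂, hq₂⟩ := h₂ s₁ hq₁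
  exact ⟨t₁ + t₂, s₂, by omega, hr₁.seq hr₂, hq₂⟩

/-- The effect of a program without loops (loops are not executed). -/
def sem : Program → Store → Store
  | .skip, s => s
  | .assign x e, s => ⟨Function.update s.reg x (e.eval s), s.mem⟩
  | .write a i e, s =>
      ⟨s.reg, Function.update s.mem a (Function.update (s.mem a) (i.eval s) (e.eval s))⟩
  | .seq p q, s => sem q (sem p s)
  | .ite e p q, s => if e.eval s = 0 then sem q s else sem p s
  | .loop _ _, s => s

/-- Programs without loops. -/
def Program.loopFree : Program → Bool
  | .seq p q => p.loopFree && q.loopFree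
  | .ite _ p q => p.loopFree && q.loopFree
  | .loop _ _ => false
  | _ => true

/-- A bound for the number of steps of a program without loops. -/
def Program.cost : Program → ℕ
  | .skip => 1
  | .assign _ e => e.cost + 1
  | .write _ i e => i.cost + e.cost + 1
  | .seq p q => p.cost + q.cost
  | .ite e p q => e.cost + 1 + (p.cost + q.cost)
  | .loop _ _ => 1

/-- Without loops both the result and a time bound can be computed from the program text. Hence the
correctness of a loop reduces to a statement about `sem` of its body. -/
theorem run_sem (p : Program) (hp : p.loopFree) (s : Store) :
    ∃ t, t ≤ p.cost ∧ Run p s t (sem p s) := by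
  induction p generalizing s with
  | skip => exact ⟨1, le_rfl, .skip s⟩
  | assign x e => exact ⟨_, le_rfl, .assign s x e⟩
  | write a i e => exact ⟨_, le_rfl, .write s a i e⟩
  | seq p q ihp ihq =>
    simp only [Program.loopFree, Bool.and_eq_true] at hp
    obtain ⟨t₁, h₁, r₁⟩ := ihp hp.1 s
    obtain ⟨t₂, h₂, r₂⟩ := ihq hp.2 (sem p s)
    exact ⟨t₁ + t₂, by simp only [Program.cost]; omega, r₁.seq r₂⟩
  | ite e p q ihp ihq =>
    simp only [Program.loopFree, Bool.and_eq_true] at hp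
    by_cases hc : e.eval s = 0
    · obtain ⟨t, h, r⟩ := ihq hp.2 s
      refine ⟨e.cost + 1 + t, by simp only [Program.cost]; omega, ?_⟩
      simpa only [sem, if_pos hc] using r.iteFalse hc
    · obtain ⟨t, h, r⟩ := ihp hp.1 s
      refine ⟨e.cost + 1 + t, by simp only [Program.cost]; omega, ?_⟩
      simpa only [sem, if_neg hc] using r.iteTrue hc
  | loop e p _ => simp [Program.loopFree] at hp

/-- A loop with invariant `I` and potential `Φ`. -/
theorem total_loop {e : Expr} {p : Program} (hp : p.loopFree) (I : Store → Prop) (Φ : Store → ℕ)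
    (hstep : ∀ s, I s → e.eval s ≠ 0 → I (sem p s) ∧ Φ (sem p s) < Φ s) {s : Store} (hs : I s)
    {N : ℕ} (hN : Φ s ≤ N) :
    Total (.loop e p) s ((e.cost + 1 + p.cost) * (N + 1)) fun s' => I s' ∧ e.eval s' = 0 := by
  induction N generalizing s with
  | zero =>
    have hc : e.eval s = 0 := by
      by_contra hc
      have := (hstep s hs hc).2
      omega
    exact ⟨_, s, by omega, .loopDone hc, hs, hc⟩
  | succ N ih =>
    by_cases hc : e.eval s = 0
    · exact ⟨_, s, by nlinarith, .loopDone hc, hs, hc⟩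
    · obtain ⟨hI, hΦ⟩ := hstep s hs hc
      obtain ⟨t₁, ht₁, hr₁⟩ := run_sem p hp s
      obtain ⟨t₂, s₂, ht₂, hr₂, hq⟩ := ih hI (by omega)
      exact ⟨_, s₂, by nlinarith, .loopStep hc hr₁ hr₂, hq⟩

end RAM

namespace GraphSearch

variable {V : Type*}

/-! ### Forcing sequences and clearing strategies yield matchings -/

/-- The vertices of `S` are matched with vertices outside of `S`. -/
structure IsMatched (G : SimpleGraph V) (S : Set V) (c : V → V) : Prop where
  adj : ∀ u ∈ S, G.Adj (c u) u
  notMem : ∀ u ∈ S, c u ∉ S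
  inj : Set.InjOn c S

/-- Here `c u` is the vertex that forced `u`. The clause that all its neighbors lie in `X` is
carried along because it prevents a second force by the same vertex, which is what injectivity
needs. -/
theorem ForcedFrom.exists_isMatched {G : SimpleGraph V} {B X : Set V} (h : ForcedFrom G B X) :
    B ⊆ X ∧ ∃ c : V → V, (∀ u ∈ X \ B, G.Adj (c u) u ∧ c u ∈ B ∧ ∀ w, G.Adj (c u) w → w ∈ X) ∧
      Set.InjOn c (X \ B) := by
  classical
  induction h with
  | start => exact ⟨le_rfl, id, by simp, by simp⟩
  | @force X c u hX hc hcu hu huniq ih =>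
    obtain ⟨hB, f, hf, hinj⟩ := ih
    have key : ∀ v ∈ X \ B, f v ≠ c := by
      rintro v hv rfl
      exact hu ((hf v hv).2.2 u hcu)
    refine ⟨hB.trans (Set.subset_insert _ _), Function.update f u c, ?_, ?_⟩
    · rintro v ⟨hv, hvB⟩
      by_cases hvu : v = u
      · subst hvu
        simp only [Function.update_self]
        refine ⟨hcu, hc, fun w hw => ?_⟩
        by_cases hwX : w ∈ X
        · exact Or.inr hwX
        · exact Or.inl (huniq w hw hwX)
      · simp only [Function.update_of_ne hvu]
        have hvX : v ∈ X := hv.resolve_left hvu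
        obtain ⟨h1, h2, h3⟩ := hf v ⟨hvX, hvB⟩
        exact ⟨h1, h2, fun w hw => Or.inr (h3 w hw)⟩
    · rintro v ⟨hv, hvB⟩ w ⟨hw, hwB⟩ hvw
      by_cases hvu : v = u <;> by_cases hwu : w = u
      · rw [hvu, hwu]
      · subst hvu
        simp only [Function.update_self, Function.update_of_ne hwu] at hvw
        exact (key w ⟨hw.resolve_left hwu, hwB⟩ hvw.symm).elim
      · subst hwu
        simp only [Function.update_self, Function.update_of_ne hvu] at hvw
        exact (key v ⟨hv.resolve_left hvu, hvB⟩ hvw).elim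
      · simp only [Function.update_of_ne hwu, Function.update_of_ne hvu] at hvw
        exact hinj ⟨hv.resolve_left hvu, hvB⟩ ⟨hw.resolve_left hwu, hwB⟩ hvw

theorem ForcedFrom.exists_compl_isMatched {G : SimpleGraph V} {B : Set V}
    (h : ForcedFrom G B Set.univ) : ∃ c, IsMatched G Bᶜ c := by
  obtain ⟨_, c, hc, hinj⟩ := h.exists_isMatched
  rw [← Set.compl_eq_univ_sdiff] at hc hinj
  exact ⟨c, fun u hu => (hc u hu).1, fun u hu => not_not.mpr (hc u hu).2.1, hinj⟩

/-- What holds in each configuration of a search: `P` is the set of vertices on which searchers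
were placed, `S` the set of vertices to which searchers slid, `c` their origins. -/
structure Reachable (G : SimpleGraph V) (σ : SearchState V) (P S : Set V) (c : V → V) : Prop where
  visited : σ.visited = P ∪ S
  disj : Disjoint P S
  fresh : σ.fresh ⊆ P
  fresh_occ : σ.fresh ⊆ σ.occupied
  occ : σ.occupied ⊆ σ.visited
  origin : ∀ u ∈ S, G.Adj (c u) u ∧ c u ∈ P ∧ c u ∉ σ.fresh
  inj : Set.InjOn c S
  left : ∀ v ∈ σ.visited, v ∉ σ.occupied → ∀ w, G.Adj v w → s(v, w) ∈ σ.cleared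
  guarded : ∀ v ∈ σ.occupied, ∀ w ∈ σ.occupied, G.Adj v w → s(v, w) ∈ σ.cleared

theorem mem_guardedEdges {G : SimpleGraph V} {occ : Set V} {v w : V} :
    s(v, w) ∈ guardedEdges G occ ↔ G.Adj v w ∧ v ∈ occ ∧ w ∈ occ := by
  simp [guardedEdges]

theorem Reachable.place {G : SimpleGraph V} {σ : SearchState V} {P S : Set V} {c : V → V}
    (h : Reachable G σ P S c) {v : V} (hv : v ∉ σ.visited) :
    Reachable G (next G σ (.place v)) (insert v P) S c := by
  have hvPS := hv
  rw [h.visited, Set.mem_union, not_or] at hvPS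
  constructor
  · simp only [next, h.visited, Set.insert_union]
  · rw [Set.disjoint_insert_left]
    exact ⟨hvPS.2, h.disj⟩
  · exact Set.insert_subset_insert h.fresh
  · exact Set.insert_subset_insert h.fresh_occ
  · exact Set.insert_subset_insert h.occ
  · intro u hu
    obtain ⟨h1, h2, h3⟩ := h.origin u hu
    refine ⟨h1, Or.inr h2, ?_⟩
    rintro (h4 | h4)
    · exact hvPS.1 (h4 ▸ h2)
    · exact h3 h4
  · exact h.inj
  · rintro u hu huo w huw
    simp only [next, Set.mem_insert_iff, not_or] at hu huo ⊢
    exact Or.inl (h.left u (hu.resolve_left huo.1) huo.2 w huw)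
  · intro u hu w hw huw
    exact Or.inr (mem_guardedEdges.mpr ⟨huw, hu, hw⟩)

/-- A contaminated edge at an occupied vertex leads to a vertex never visited: an occupied end would
guard the edge, and a vacated end has all its edges cleared, since its searcher left along the last
contaminated one. So every slide reaches a new vertex, and its origin ceases to be fresh and cannot
serve again. -/
theorem Reachable.slide {G : SimpleGraph V} {σ : SearchState V} {P S : Set V} {c : V → V}
    (h : Reachable G σ P S c) {u v : V} (ha : Allowed G σ (.slide u v)) :
    v ∉ σ.visited ∧
    ∃ c', Reachable G (next G σ (.slide u v)) P (insert v S) c' := by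
  classical
  obtain ⟨hu, huv, hcl, huniq⟩ := ha
  have hvis : v ∉ σ.visited := by
    intro hv
    by_cases hvo : v ∈ σ.occupied
    · exact hcl (h.guarded u (h.fresh_occ hu) v hvo huv)
    · exact hcl (Sym2.eq_swap ▸ h.left v hv hvo u huv.symm)
  have hvPS := hvis
  rw [h.visited, Set.mem_union, not_or] at hvPS
  have hS : ∀ w ∈ S, w ≠ v := fun w hw hwv => hvPS.2 (hwv ▸ hw)
  refine ⟨hvis, Function.update c v u, ?_⟩
  constructor
  · simp only [next, h.visited]
    ext x; simp only [Set.mem_insert_iff, Set.mem_union]; tauto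
  · rw [Set.disjoint_insert_right]
    exact ⟨hvPS.1, h.disj⟩
  · exact fun x hx => h.fresh hx.1
  · exact fun x hx => Or.inr ⟨h.fresh_occ hx.1, hx.2⟩
  · exact Set.insert_subset_insert fun x hx => h.occ hx.1
  · rintro w (rfl | hw)
    · simp only [Function.update_self]
      exact ⟨huv, h.fresh hu, fun h' => h'.2 rfl⟩
    · simp only [Function.update_of_ne (hS w hw)]
      obtain ⟨h1, h2, h3⟩ := h.origin w hw
      exact ⟨h1, h2, fun h4 => h3 h4.1⟩
  · rintro w hw x hx hwx
    by_cases hwv : w = v <;> by_cases hxv : x = v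
    · rw [hwv, hxv]
    · subst hwv
      simp only [Function.update_self, Function.update_of_ne hxv] at hwx
      exact ((h.origin x (hx.resolve_left hxv)).2.2 (hwx ▸ hu)).elim
    · subst hxv
      simp only [Function.update_self, Function.update_of_ne hwv] at hwx
      exact ((h.origin w (hw.resolve_left hwv)).2.2 (hwx ▸ hu)).elim
    · simp only [Function.update_of_ne hwv, Function.update_of_ne hxv] at hwx
      exact h.inj (hw.resolve_left hwv) (hx.resolve_left hxv) hwx
  · intro x hx hxo w hxw
    simp only [next, Set.mem_insert_iff, Set.mem_sdiff, Set.mem_singleton_iff, not_or, not_and,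
      not_not, Set.mem_union] at hx hxo ⊢
    by_cases hxu : x = u
    · subst hxu
      by_cases hw : s(x, w) ∈ σ.cleared
      · exact Or.inr (Or.inl hw)
      · rw [huniq w hxw hw]
        exact Or.inl rfl
    · exact Or.inr (Or.inl (h.left x (hx.resolve_left hxo.1) (fun h' => hxu (hxo.2 h')) w hxw))
  · intro x hx w hw hxw
    exact Or.inr (Or.inr (mem_guardedEdges.mpr ⟨hxw, hx, hw⟩))

theorem Reachable.exists_final {G : SimpleGraph V} (T : Strategy V) :
    ∀ {σ : SearchState V} {P S : Set V} {c : V → V}, Reachable G σ P S c → LegalFrom G σ T →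
      P.Finite → ∃ P' S' c', Reachable G (T.foldl (next G) σ) P' S' c' ∧ P'.Finite ∧
        P'.ncard = P.ncard + searcherCount T := by
  induction T with
  | nil => exact fun {σ P S c} h _ hf => ⟨P, S, c, h, hf, by simp [searcherCount]⟩
  | cons a T ih =>
    intro σ P S c h hl hf
    obtain ⟨ha, hl⟩ := hl
    cases a with
    | place v =>
      obtain ⟨P', S', c', h1, h2, h3⟩ := ih (h.place ha) hl (hf.insert v)
      refine ⟨P', S', c', h1, h2, ?_⟩
      have hv : v ∉ P := fun hv => ha (by rw [h.visited]; exact Or.inl hv)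
      rw [h3, Set.ncard_insert_of_notMem hv hf, searcherCount]
      omega
    | slide u v =>
      obtain ⟨_, c₁, h₁⟩ := h.slide ha
      exact ih h₁ hl hf

theorem reachable_init (G : SimpleGraph V) : Reachable G SearchState.init ∅ ∅ id := by
  constructor <;> simp [SearchState.init]

theorem Clears.exists_isMatched {G : SimpleGraph V} [Finite V] {T : Strategy V}
    (h : Clears G T) : ∃ (P : Set V) (c : V → V), IsMatched G Pᶜ c ∧ P.ncard = searcherCount T := by
  obtain ⟨hl, _, hvis⟩ := h
  obtain ⟨P, S, c, h1, _, h3⟩ := (reachable_init G).exists_final T hl Set.finite_empty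
  have hS : S = Pᶜ := by
    have h4 : P ∪ S = Set.univ := h1.visited.symm.trans hvis
    exact (IsCompl.compl_eq ⟨h1.disj, codisjoint_iff.mpr h4⟩).symm
  subst hS
  refine ⟨P, c, ⟨fun u hu => (h1.origin u hu).1, fun u hu => ?_, h1.inj⟩, by simpa using h3⟩
  exact not_not.mpr (h1.origin u hu).2.1

/-! ### Strategies from ordered matchings -/

/-- The placements, and slides in a valid order. -/
structure IsPlan (G : SimpleGraph V) (places : List V) (slides : List (V × V)) : Prop where
  nodup : places.Nodup
  cover : ∀ v, v ∈ places ∨ v ∈ slides.map Prod.snd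
  fst_mem : ∀ p ∈ slides, p.1 ∈ places
  snd_notMem : ∀ p ∈ slides, p.2 ∉ places
  fst_nodup : (slides.map Prod.fst).Nodup
  snd_nodup : (slides.map Prod.snd).Nodup
  adj : ∀ p ∈ slides, G.Adj p.1 p.2
  order : slides.Pairwise fun p q => ¬ G.Adj p.1 q.2

/-- The next slide of a plan has only one target that is not yet covered. -/
theorem IsPlan.eq_of_adj {G : SimpleGraph V} {places : List V} {l₁ l₂ : List (V × V)} {c u w : V}
    (h : IsPlan G places (l₁ ++ (c, u) :: l₂)) (hw : G.Adj c w) (hp : w ∉ places)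
    (hl : w ∉ l₁.map Prod.snd) : w = u := by
  have := (h.cover w).resolve_left hp
  simp only [List.map_append, List.mem_append, List.map_cons, List.mem_cons] at this
  rcases this with h1 | h1 | h1
  · exact (hl h1).elim
  · exact h1
  · obtain ⟨q, hq, rfl⟩ := List.mem_map.mp h1
    have := (List.pairwise_cons.mp (List.pairwise_append.mp h.order).2.1).1 q hq
    exact (this hw).elim

theorem IsPlan.notMem_of_cons {G : SimpleGraph V} {places : List V} {l₁ l₂ : List (V × V)}
    {c u : V} (h : IsPlan G places (l₁ ++ (c, u) :: l₂)) :
    u ∉ places ∧ u ∉ l₁.map Prod.snd ∧ c ∈ places ∧ c ∉ l₁.map Prod.fst ∧ G.Adj c u := by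
  have hm : (c, u) ∈ l₁ ++ (c, u) :: l₂ := by simp
  refine ⟨h.snd_notMem _ hm, ?_, h.fst_mem _ hm, ?_, h.adj _ hm⟩
  · have := h.snd_nodup
    rw [List.map_append, List.nodup_append] at this
    exact fun h' => this.2.2 _ h' _ (by simp) rfl
  · have := h.fst_nodup
    rw [List.map_append, List.nodup_append] at this
    exact fun h' => this.2.2 _ h' _ (by simp) rfl

theorem IsPlan.forcedFrom_prefix {G : SimpleGraph V} {places : List V} {l₁ l₂ : List (V × V)}
    (h : IsPlan G places (l₁ ++ l₂)) :
    ForcedFrom G {v | v ∈ places} {v | v ∈ places ∨ v ∈ l₁.map Prod.snd} := by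
  induction l₁ using List.reverseRecOn generalizing l₂ with
  | nil => simpa using ForcedFrom.start
  | append_singleton l a ih =>
    obtain ⟨c, u⟩ := a
    rw [List.append_assoc, List.singleton_append] at h
    obtain ⟨h1, h2, h3, _, h5⟩ := h.notMem_of_cons
    have := (ih h).force (c := c) (u := u) h3 h5 (by rintro (h' | h'); exacts [h1 h', h2 h'])
      (fun w hw hwX => by
        simp only [Set.mem_ofPred_eq, not_or] at hwX
        exact h.eq_of_adj hw hwX.1 hwX.2)
    convert this using 1
    ext v
    simp only [List.map_append, List.mem_append, List.map_cons, List.map_nil, List.mem_singleton,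
      Set.mem_ofPred_eq, Set.mem_insert_iff]
    tauto

theorem IsPlan.forcedFrom {G : SimpleGraph V} {places : List V} {slides : List (V × V)}
    (h : IsPlan G places slides) : ForcedFrom G {v | v ∈ places} Set.univ := by
  have := IsPlan.forcedFrom_prefix (l₁ := slides) (l₂ := []) (by simpa using h)
  convert this using 1
  ext v
  simpa using h.cover v

theorem legalFrom_append {G : SimpleGraph V} {S T : Strategy V} {σ : SearchState V} :
    LegalFrom G σ (S ++ T) ↔ LegalFrom G σ S ∧ LegalFrom G (S.foldl (next G) σ) T := by
  induction S generalizing σ with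
  | nil => simp [LegalFrom]
  | cons a S ih => simp [LegalFrom, ih, and_assoc]

/-- The configurations met while the placements are made. -/
structure IsPlaced (G : SimpleGraph V) (places : List V) (σ : SearchState V) : Prop where
  visited : σ.visited = {v | v ∈ places}
  occupied : σ.occupied = {v | v ∈ places}
  fresh : σ.fresh = {v | v ∈ places}
  cleared : ∀ v w, s(v, w) ∈ σ.cleared ↔ G.Adj v w ∧ v ∈ places ∧ w ∈ places

theorem isPlaced_foldl (G : SimpleGraph V) (places : List V) (hn : places.Nodup) :
    LegalFrom G SearchState.init (places.map .place) ∧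
      IsPlaced G places ((places.map .place).foldl (next G) SearchState.init) := by
  induction places using List.reverseRecOn with
  | nil => constructor <;> simp [LegalFrom, SearchState.init] ; constructor <;> simp
  | append_singleton l a ih =>
    rw [List.nodup_append] at hn
    obtain ⟨h1, h2⟩ := ih hn.1
    rw [List.map_append, legalFrom_append, List.foldl_append]
    refine ⟨⟨h1, ?_, trivial⟩, ?_⟩
    · change a ∉ _
      rw [h2.visited]
      exact fun h => hn.2.2 a h a (by simp) rfl
    · simp only [List.map_cons, List.map_nil, List.foldl_cons, List.foldl_nil, next]
      constructor
      · simp only [h2.visited]; ext; simp; tauto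
      · simp only [h2.occupied]; ext; simp; tauto
      · simp only [h2.fresh]; ext; simp; tauto
      · intro v w
        simp only [Set.mem_union, mem_guardedEdges, h2.cleared, h2.occupied, Set.mem_insert_iff,
          Set.mem_ofPred_eq, List.mem_append, List.mem_singleton]
        tauto

/-- The configurations met while the slides of a plan are made. -/
structure IsSlid (G : SimpleGraph V) (places : List V) (l : List (V × V)) (σ : SearchState V) :
    Prop where
  visited : ∀ v, v ∈ σ.visited ↔ v ∈ places ∨ v ∈ l.map Prod.snd
  occupied : ∀ v, v ∈ σ.occupied ↔
    (v ∈ places ∧ v ∉ l.map Prod.fst) ∨ v ∈ l.map Prod.snd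
  fresh : ∀ v, v ∈ σ.fresh ↔ v ∈ places ∧ v ∉ l.map Prod.fst
  cleared : ∀ v w, G.Adj v w → (s(v, w) ∈ σ.cleared ↔ v ∈ σ.visited ∧ w ∈ σ.visited)
  left : ∀ p ∈ l, ∀ w, G.Adj p.1 w → w ∈ σ.visited

/-- Along a plan an edge is cleared exactly when both its ends have been visited. Thus the only
contaminated edge at the next source leads to its only unvisited neighbor, as in zero forcing. -/
theorem IsPlan.isSlid_prefix {G : SimpleGraph V} {places : List V} {l₁ l₂ : List (V × V)}
    (h : IsPlan G places (l₁ ++ l₂)) :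
    LegalFrom G SearchState.init (normalized places l₁) ∧
      IsSlid G places l₁ (finalState G (normalized places l₁)) := by
  induction l₁ using List.reverseRecOn generalizing l₂ with
  | nil =>
    obtain ⟨h1, h2⟩ := isPlaced_foldl G places h.nodup
    simp only [normalized, List.map_nil, List.append_nil, finalState]
    refine ⟨h1, ?_⟩
    constructor
    · simp [h2.visited]
    · simp [h2.occupied]
    · simp [h2.fresh]
    · simp +contextual [h2.visited, h2.cleared]
    · simp
  | append_singleton l a ih =>
    obtain ⟨c, u⟩ := a
    rw [List.append_assoc, List.singleton_append] at h
    obtain ⟨hu1, hu2, hc1, hc2, hadj⟩ := h.notMem_of_cons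
    obtain ⟨h1, h2⟩ := ih h
    have huniq : ∀ w, G.Adj c w → w ∉ (finalState G (normalized places l)).visited → w = u := by
      intro w hw hv
      rw [h2.visited, not_or] at hv
      exact h.eq_of_adj hw hv.1 hv.2
    have hun : u ∉ (finalState G (normalized places l)).visited := by
      rw [h2.visited]; tauto
    have hcv : c ∈ (finalState G (normalized places l)).visited := by
      rw [h2.visited]; tauto
    have hnorm : normalized places (l ++ [(c, u)]) =
        normalized places l ++ [SearchAction.slide c u] := by
      simp [normalized]
    rw [hnorm, legalFrom_append, finalState, List.foldl_append]
    change (_ ∧ _) ∧ IsSlid _ _ _ (List.foldl _ (finalState G (normalized places l)) _)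
    change (_ ∧ LegalFrom _ (finalState G (normalized places l)) _) ∧ _
    set σ := finalState G (normalized places l)
    refine ⟨⟨h1, ⟨?_, hadj, ?_, ?_⟩, trivial⟩, ?_⟩
    · rw [h2.fresh]; tauto
    · rw [h2.cleared _ _ hadj]; tauto
    · intro w hw hcl
      rw [h2.cleared _ _ hw] at hcl
      exact huniq w hw (by tauto)
    · simp only [List.foldl_cons, List.foldl_nil, next]
      have hocc : ∀ v ∈ σ.visited, v ∉ σ.occupied → ∃ p ∈ l, p.1 = v := by
        intro v hv hvo
        rw [h2.visited] at hv
        rw [h2.occupied] at hvo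
        rw [← List.mem_map]
        tauto
      have hcu : c ≠ u := hadj.ne
      constructor
      · intro v
        simp only [Set.mem_insert_iff, h2.visited, List.map_append, List.mem_append, List.map_cons,
          List.map_nil, List.mem_singleton]
        tauto
      · intro v
        have hcl : c ∉ l.map Prod.snd := by
          intro hcl
          obtain ⟨q, hq, hqc⟩ := List.mem_map.mp hcl
          exact h.snd_notMem q (by simp [hq]) (hqc ▸ hc1)
        simp only [Set.mem_insert_iff, Set.mem_sdiff, Set.mem_singleton_iff, h2.occupied,
          List.map_append, List.mem_append, List.map_cons, List.map_nil, List.mem_singleton]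
        by_cases hvc : v = c
        · subst hvc; tauto
        · tauto
      · intro v
        simp only [Set.mem_sdiff, Set.mem_singleton_iff, h2.fresh,
          List.map_append, List.mem_append, List.map_cons, List.map_nil, List.mem_singleton]
        tauto
      -- Edges from the new vertex `u` to visited vertices must become cleared. The edge to `c` is
      -- slid along. Any other visited neighbor is still occupied, since a vertex vacated earlier
      -- has only visited neighbors and `u` was unvisited.
      · have key : ∀ w, G.Adj u w → w ∈ σ.visited →
            s(u, w) = s(c, u) ∨ w ∈ insert u (σ.occupied \ {c}) := by
          intro w huw hw
          by_cases hwc : w = c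
          · subst hwc
            exact Or.inl Sym2.eq_swap
          · right
            by_cases hwo : w ∈ σ.occupied
            · exact Or.inr ⟨hwo, hwc⟩
            · obtain ⟨p, hp, rfl⟩ := hocc w hw hwo
              exact (hun (h2.left p hp u huw.symm)).elim
        intro v w hvw
        simp only [Set.mem_insert_iff, Set.mem_union, h2.cleared v w hvw, mem_guardedEdges]
        constructor
        · rintro (h' | h' | h')
          · rcases Sym2.eq_iff.mp h' with ⟨rfl, rfl⟩ | ⟨rfl, rfl⟩ <;> tauto
          · tauto
          · have hov : ∀ x ∈ σ.occupied, x ∈ σ.visited := by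
              intro x; rw [h2.occupied, h2.visited]; tauto
            have := hov v
            have := hov w
            simp only [Set.mem_sdiff] at h'
            tauto
        · rintro ⟨hv, hw⟩
          by_cases hvu : v = u
          · subst hvu
            have := key w hvw (hw.resolve_left hvw.ne.symm)
            simp only [Set.mem_insert_iff] at this
            tauto
          · by_cases hwu : w = u
            · subst hwu
              have := key v hvw.symm (hv.resolve_left hvu)
              rw [Sym2.eq_swap] at this
              simp only [Set.mem_insert_iff] at this
              tauto
            · tauto
      · intro p hp w hw
        simp only [List.mem_append, List.mem_singleton] at hp
        rcases hp with hp | rfl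
        · exact Or.inr (h2.left p hp w hw)
        · by_cases hwv : w ∈ σ.visited
          · exact Or.inr hwv
          · exact Or.inl (huniq w hw hwv)

theorem searcherCount_normalized (places : List V) (slides : List (V × V)) :
    searcherCount (normalized places slides) = places.length := by
  have h : ∀ l : List (V × V),
      searcherCount (l.map fun p => SearchAction.slide p.1 p.2) = 0 := by
    intro l; induction l with
    | nil => rfl
    | cons a l ih => simpa [searcherCount] using ih
  induction places with
  | nil => simpa [normalized] using h slides
  | cons a l ih => simpa [normalized, searcherCount] using ih

theorem IsPlan.clears {G : SimpleGraph V} {places : List V} {slides : List (V × V)}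
    (h : IsPlan G places slides) : Clears G (normalized places slides) := by
  obtain ⟨h1, h2⟩ := IsPlan.isSlid_prefix (l₁ := slides) (l₂ := []) (by simpa using h)
  have hv : (finalState G (normalized places slides)).visited = Set.univ := by
    ext v
    simpa [h2.visited] using h.cover v
  refine ⟨h1, ?_, hv⟩
  intro e
  induction e using Sym2.ind with
  | _ v w =>
    intro he
    rw [h2.cleared v w he, hv]
    simp

/-- A plan whose number of placements is a lower bound derived from matchings is optimal. -/
theorem IsPlan.optimal {G : SimpleGraph V} [Finite V] {places : List V} {slides : List (V × V)}
    (h : IsPlan G places slides)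
    (hmin : ∀ (P : Set V) (c : V → V), IsMatched G Pᶜ c → places.length ≤ P.ncard) :
    IsOptimal G (normalized places slides) ∧ places.length = czf G := by
  classical
  refine ⟨⟨h.clears, fun T hT => ?_⟩, ?_⟩
  · obtain ⟨P, c, hc, hP⟩ := hT.exists_isMatched
    rw [searcherCount_normalized, ← hP]
    exact hmin P c hc
  · have hmem : places.length ∈
        {k | ∃ B : Finset V, B.card = k ∧ ForcedFrom G (B : Set V) Set.univ} := by
      refine ⟨places.toFinset, List.toFinset_card_of_nodup h.nodup, ?_⟩
      simpa using h.forcedFrom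
    apply le_antisymm
    · obtain ⟨B, hB, hf⟩ := Nat.sInf_mem ⟨_, hmem⟩
      obtain ⟨c, hc⟩ := hf.exists_compl_isMatched
      have := hmin _ c hc
      rw [Set.ncard_coe_finset, hB] at this
      exact this
    · exact Nat.sInf_le hmem

end GraphSearch

namespace Cactus

/-! ### Matchings in numbered cacti

The vertices are numbered `1, …, n` in the order of a depth-first search; `0` means "none". -/

/-- The array contents describing a depth-first search of a cactus: `par v` is the parent of `v`,
`tp v` the upper end of the back edge from `v`, `bt v` the lower end of the back edge of the cycle
that contains `v` and `par v`, and `cc v` the child of `v` in this cycle. -/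
structure Layout (n : ℕ) (par tp bt cc : ℕ → ℕ) : Prop where
  par_pos : ∀ v, 2 ≤ v → v ≤ n → par v ≠ 0
  par_range : ∀ v, par v ≠ 0 → 2 ≤ v ∧ v ≤ n
  par_lt : ∀ v, v ≠ 0 → par v < v
  tp_lt : ∀ v, tp v ≠ 0 → tp v < par v
  bt_self : ∀ v, tp v ≠ 0 → bt v = v ∧ cc v = 0
  bt_cases : ∀ v, bt v ≠ 0 → (bt v = v ∧ tp v ≠ 0) ∨
    (cc v ≠ 0 ∧ par (cc v) = v ∧ bt (cc v) = bt v ∧ tp v = 0)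
  bt_up : ∀ v, bt v ≠ 0 → par v = tp (bt v) ∨ (cc (par v) = v ∧ bt (par v) = bt v)
  bt_range : ∀ v, bt v ≠ 0 → v ≤ bt v ∧ v ≠ 0 ∧ tp (bt v) ≠ 0 ∧ tp (bt v) < v
  cc_zero : ∀ v, bt v = 0 → cc v = 0
  closing : ∀ b, tp b ≠ 0 → ∃ w, bt w = b ∧ par w = tp b

/-- The result of the bottom-up pass: `frm v` is the vertex below `v` matched to `v`, `F v` tells
whether `v` belongs to the unmatched path that begins at the bottom of its cycle, and `R v` is the
parity of the length of this path. -/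
structure BottomUp (par tp bt cc frm F R : ℕ → ℕ) : Prop where
  frm_zero : frm 0 = 0
  -- Index `0` acts as the empty run below a bottom. A bottom has `cc v = 0`, so it obeys the same
  -- recursion as the vertices above it and begins a run iff it is not matched from below.
  F_zero : F 0 = 1
  R_zero : R 0 = 0
  F_le : ∀ v, F v ≤ 1
  R_le : ∀ v, R v ≤ 1
  F_bridge : ∀ v, v ≠ 0 → bt v = 0 → F v = 0
  F_iff : ∀ v, bt v ≠ 0 → (F v = 1 ↔ frm v = 0 ∧ F (cc v) = 1)
  R_eq : ∀ v, bt v ≠ 0 → R v = if F v = 1 then 1 - R (cc v) else R (cc v)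
  push : ∀ v, par v ≠ 0 → frm v = 0 → F v = 0 → frm (par v) ≠ 0
  request : ∀ v, bt v ≠ 0 → par v = tp (bt v) → R v = 1 → frm (par v) ≠ 0
  frm_cases : ∀ v, frm v ≠ 0 → (par (frm v) = v ∧ frm (frm v) = 0 ∧ F (frm v) = 0) ∨
    (tp (frm v) = v ∧ ∃ w, bt w = frm v ∧ par w = v ∧ R w = 1)

/-- The vertices that are slid to. -/
def Target (frm dn : ℕ → ℕ) (v : ℕ) : Prop := frm v ≠ 0 ∨ dn v ≠ 0

/-- The result of the top-down pass, which matches the vertices of the paths: `mt v` tells whether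
`v` is matched with its parent, `frm` is extended, and `dn v` tells whether the parent of `v`
slides to `v`. -/
structure TopDown (par tp cc F frm₀ frm mt dn : ℕ → ℕ) : Prop where
  mt_le : ∀ v, mt v ≤ 1
  mt_iff : ∀ w, mt w = 1 ↔ w ≠ 0 ∧ F (par w) = 1 ∧ mt (par w) = 0 ∧ cc (par w) = w
  -- Unless `cc v` is the bottom of its cycle, `tp (cc v)` is `0`, which is never a target. So only
  -- the lowest pair of a run can be directed downwards.
  select : ∀ v, v ≠ 0 → F v = 1 → mt v = 0 → cc v ≠ 0 →
    (dn (cc v) ≠ 0 ∧ frm v = 0 ∧ Target frm dn (tp (cc v))) ∨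
    (dn (cc v) = 0 ∧ frm v = cc v ∧ ¬ Target frm dn (tp (cc v)))
  other : ∀ v, ¬ (v ≠ 0 ∧ F v = 1 ∧ mt v = 0 ∧ cc v ≠ 0) → frm v = frm₀ v
  down : ∀ w, dn w ≠ 0 → mt w = 1

/-- A searcher slides from `c` to `u`. -/
def Slides (par frm dn : ℕ → ℕ) (c u : ℕ) : Prop :=
  (frm u = c ∧ c ≠ 0) ∨ (dn u ≠ 0 ∧ c = par u)

section

variable {n : ℕ} {par tp bt cc frm₀ F R frm mt dn : ℕ → ℕ}

theorem Layout.cc_par (h : Layout n par tp bt cc) {v : ℕ} (hv : cc v ≠ 0) :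
    par (cc v) = v ∧ bt (cc v) = bt v ∧ bt v ≠ 0 := by
  have h1 : bt v ≠ 0 := fun h' => hv (h.cc_zero v h')
  rcases h.bt_cases v h1 with h2 | h2
  · exact (hv (h.bt_self v h2.2).2).elim
  · exact ⟨h2.2.1, h2.2.2.1, h1⟩

theorem Layout.bt_zero (h : Layout n par tp bt cc) : bt 0 = 0 := by
  by_contra h'
  exact (h.bt_range 0 h').2.1 rfl

theorem BottomUp.of_F (hA : BottomUp par tp bt cc frm₀ F R) {v : ℕ}
    (hv : v ≠ 0) (hF : F v = 1) : bt v ≠ 0 ∧ frm₀ v = 0 ∧ F (cc v) = 1 := by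
  have h1 : bt v ≠ 0 := by
    intro h'
    have := hA.F_bridge v hv h'
    omega
  exact ⟨h1, (hA.F_iff v h1).mp hF⟩

/-- The path of a cycle is oriented so that the parity at its upper end determines whether its
bottom is matched within it. -/
theorem parity_aux (h : Layout n par tp bt cc) (hA : BottomUp par tp bt cc frm₀ F R)
    (hB : TopDown par tp cc F frm₀ frm mt dn) (k : ℕ) :
    ∀ v, bt v ≠ 0 → bt v - v ≤ k → (F v = 1 → F (bt v) = 1 ∧ (R v = 1 ↔ mt (bt v) = mt v)) ∧
      (F v = 0 → (R v = 1 ↔ F (bt v) = 1 ∧ mt (bt v) = 0)) := by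
  induction k using Nat.strong_induction_on with
  | _ k ih =>
    intro v hv hk
    have hR := hA.R_eq v hv
    have hFi := hA.F_iff v hv
    rcases h.bt_cases v hv with ⟨h1, h2⟩ | ⟨h1, h2, h3, h4⟩
    · have h5 := (h.bt_self v h2).2
      rw [h5, hA.R_zero] at hR
      rw [h1]
      have hm := hB.mt_le v
      constructor
      · intro hF
        simp [hF, hR]
      · intro hF
        simp [hF, hR]
    · have hlt : v < cc v := by have := h.par_lt _ h1; omega
      have hle := (h.bt_range (cc v) (by rw [h3]; exact hv)).1
      rw [h3] at hle
      obtain ⟨i1, i2⟩ := ih (bt v - cc v) (by omega) (cc v) (by rw [h3]; exact hv)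
        (by rw [h3])
      rw [h3] at i1 i2
      have hRle := hA.R_le (cc v)
      have hFle := hA.F_le (cc v)
      have hm1 := hB.mt_le v
      have hm2 := hB.mt_le (cc v)
      have hm3 := hB.mt_le (bt v)
      have hmi := hB.mt_iff (cc v)
      rw [h2] at hmi
      constructor
      · intro hF
        have hFc := (hFi.mp hF).2
        obtain ⟨j1, j2⟩ := i1 hFc
        refine ⟨j1, ?_⟩
        rw [if_pos hF] at hR
        -- One step up within the run flips both the parity and the matching flag, so their relation
        -- to `mt (bt v)` persists.
        have : mt (cc v) = 1 ↔ mt v = 0 := by rw [hmi]; tauto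
        rw [hR]
        grind
      · intro hF
        rw [if_neg (by omega)] at hR
        rw [hR]
        by_cases hFc : F (cc v) = 1
        · obtain ⟨j1, j2⟩ := i1 hFc
          -- The run ends at `cc v`, so this vertex is not matched with its parent.
          have : mt (cc v) = 0 := by
            by_contra hc
            have := hmi.mp (by omega)
            omega
          rw [j2, this]
          tauto
        · exact i2 (by omega)

/-- The child of the top in a cycle is never paired with its parent, which does not belong to the
same run. So the parity seen from the top tells whether pairing from the upper end leaves the bottom
over. An empty run counts as even. -/
theorem parity (h : Layout n par tp bt cc) (hA : BottomUp par tp bt cc frm₀ F R)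
    (hB : TopDown par tp cc F frm₀ frm mt dn) {w : ℕ} (hw : bt w ≠ 0)
    (hcl : par w = tp (bt w)) : R w = 1 ↔ F (bt w) = 1 ∧ mt (bt w) = 0 := by
  obtain ⟨h1, h2⟩ := parity_aux h hA hB _ w hw le_rfl
  have := hA.F_le w
  by_cases hF : F w = 1
  · obtain ⟨h3, h4⟩ := h1 hF
    have hm : mt w = 0 := by
      have hm := hB.mt_le w
      by_contra hc
      obtain ⟨m1, m2, m3, m4⟩ := (hB.mt_iff w).mp (by omega)
      have h5 := h.cc_par (v := par w) (by rw [m4]; exact m1)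
      rw [m4] at h5
      have h6 := (h.bt_range _ h5.2.2).2.2.2
      rw [← h5.2.1, ← hcl] at h6
      exact lt_irrefl _ h6
    rw [h4, hm]
    tauto
  · exact h2 (by omega)

theorem frm_range (h : Layout n par tp bt cc) (hA : BottomUp par tp bt cc frm₀ F R) {v : ℕ}
    (hv : frm₀ v ≠ 0) : v ≠ 0 ∧ v < frm₀ v ∧ frm₀ v ≤ n := by
  have h0 : v ≠ 0 := by rintro rfl; exact hv hA.frm_zero
  rcases hA.frm_cases v hv with ⟨h1, _⟩ | ⟨h1, _⟩
  · have := h.par_lt _ hv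
    have := h.par_range (frm₀ v) (by omega)
    omega
  · have := h.tp_lt (frm₀ v) (by omega)
    have := h.par_lt _ hv
    have := h.par_range (frm₀ v) (by omega)
    omega

theorem cc_range (h : Layout n par tp bt cc) {v : ℕ} (hv : cc v ≠ 0) :
    v ≠ 0 ∧ v < cc v ∧ cc v ≤ n := by
  obtain ⟨h1, _, h3⟩ := h.cc_par hv
  have h0 := (h.bt_range v h3).2.1
  have := h.par_lt _ hv
  have := h.par_range (cc v) (by omega)
  omega

theorem TopDown.of_dn (h : Layout n par tp bt cc) (hA : BottomUp par tp bt cc frm₀ F R)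
    (hB : TopDown par tp cc F frm₀ frm mt dn) {v : ℕ} (hv : dn v ≠ 0) :
    F v = 1 ∧ mt v = 1 ∧ v ≠ 0 ∧ F (par v) = 1 ∧ mt (par v) = 0 ∧ cc (par v) = v ∧ par v ≠ 0 := by
  have h1 := hB.down v hv
  obtain ⟨h2, h3, h4, h5⟩ := (hB.mt_iff v).mp h1
  have h6 : par v ≠ 0 := by
    intro h6
    rw [h6, h.cc_zero 0 h.bt_zero] at h5
    exact h2 h5.symm
  have := (hA.of_F h6 h3).2.2
  rw [h5] at this
  exact ⟨this, h1, h2, h3, h4, h5, h6⟩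

theorem TopDown.frm_zero_of_mt (hA : BottomUp par tp bt cc frm₀ F R)
    (hB : TopDown par tp cc F frm₀ frm mt dn) {v : ℕ} (h1 : F v = 1) (h2 : mt v = 1)
    (h3 : v ≠ 0) : frm v = 0 := by
  rw [hB.other v (by omega)]
  exact (hA.of_F h3 h1).2.1

theorem TopDown.down_cases (h : Layout n par tp bt cc) (hA : BottomUp par tp bt cc frm₀ F R)
    (hB : TopDown par tp cc F frm₀ frm mt dn) {u : ℕ} (hd : dn u ≠ 0) :
    frm (par u) = 0 ∧ dn (par u) = 0 ∧ F (par u) = 1 ∧ mt (par u) = 0 ∧ cc (par u) = u ∧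
      par u ≠ 0 ∧ frm u = 0 ∧ Target frm dn (tp u) := by
  obtain ⟨h1, h2, h3, h4, h5, h6, h7⟩ := hB.of_dn h hA hd
  have hd' : dn (par u) = 0 := by
    by_contra hd'
    have := (hB.of_dn h hA hd').2.1
    omega
  rcases hB.select (par u) h7 h4 h5 (by omega) with ⟨_, h9, h10⟩ | ⟨h8, _⟩
  · rw [h6] at h10
    exact ⟨h9, hd', h4, h5, h6, h7, hB.frm_zero_of_mt hA h1 h2 h3, h10⟩
  · rw [h6] at h8
    exact (hd h8).elim

/-- The four kinds of slides. -/
theorem Slides.cases (h : Layout n par tp bt cc) (hA : BottomUp par tp bt cc frm₀ F R)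
    (hB : TopDown par tp cc F frm₀ frm mt dn) {c u : ℕ} (hs : Slides par frm dn c u) :
    (frm u = c ∧ par c = u ∧ frm c = 0 ∧ dn c = 0 ∧ F c = 0 ∧ c ≠ 0) ∨
    (frm u = c ∧ tp c = u ∧ frm c = 0 ∧ dn c = 0 ∧ F c = 1 ∧ mt c = 0 ∧ cc c = 0 ∧ c ≠ 0 ∧
      bt c = c) ∨
    (frm u = c ∧ c = cc u ∧ par c = u ∧ frm c = 0 ∧ dn c = 0 ∧ F c = 1 ∧ mt c = 1 ∧ c ≠ 0 ∧
      ¬ Target frm dn (tp c)) ∨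
    (dn u ≠ 0 ∧ c = par u ∧ frm c = 0 ∧ dn c = 0 ∧ F c = 1 ∧ mt c = 0 ∧ cc c = u ∧ c ≠ 0 ∧
      frm u = 0 ∧ Target frm dn (tp u)) := by
  -- The kinds are: a greedy slide to the parent; the bottom of an odd run along its back edge to
  -- the top; the lower vertex of a pair upwards; the upper vertex of a pair downwards.
  rcases hs with ⟨rfl, hc⟩ | ⟨hd, rfl⟩
  · by_cases hu : u ≠ 0 ∧ F u = 1 ∧ mt u = 0 ∧ cc u ≠ 0
    · obtain ⟨h1, h2, h3, h4⟩ := hu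
      rcases hB.select u h1 h2 h3 h4 with h5 | ⟨h5, h6, h7⟩
      · exact (hc h5.2.1).elim
      · right; right; left
        rw [h6]
        have hp := (h.cc_par h4).1
        have hF := (hA.of_F h1 h2).2.2
        have hm : mt (cc u) = 1 := (hB.mt_iff _).mpr ⟨h4, by rw [hp]; exact ⟨h2, h3, rfl⟩⟩
        exact ⟨rfl, rfl, hp, hB.frm_zero_of_mt hA hF hm h4, h5, hF, hm, h4, h7⟩
    · have hf := hB.other u hu
      rw [hf] at hc ⊢
      rcases hA.frm_cases u hc with ⟨h1, h2, h3⟩ | ⟨h1, w, h2, h3, h4⟩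
      · left
        have hd : dn (frm₀ u) = 0 := by
          by_contra hd
          have := (hB.of_dn h hA hd).1
          omega
        refine ⟨rfl, h1, ?_, hd, h3, hc⟩
        rw [hB.other _ (by omega), h2]
      · right; left
        have hu0 := (frm_range h hA hc).1
        have htp : tp (frm₀ u) ≠ 0 := by omega
        -- The top was requested by an odd run, so the bottom is left over by the pairing and takes
        -- part in no other slide.
        obtain ⟨h5, h6⟩ := (parity h hA hB (w := w) (by omega) (by rw [h2]; omega)).mp h4
        rw [h2] at h5 h6
        obtain ⟨h7, h8⟩ := h.bt_self _ htp
        have hd : dn (frm₀ u) = 0 := by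
          by_contra hd
          have := (hB.of_dn h hA hd).2.1
          omega
        refine ⟨rfl, h1, ?_, hd, h5, h6, h8, hc, h7⟩
        rw [hB.other _ (by omega)]
        exact (hA.of_F hc h5).2.1
  · obtain ⟨h1, h2, h3, h4, h5, h6, h7, h8⟩ := hB.down_cases h hA hd
    exact Or.inr (Or.inr (Or.inr ⟨hd, rfl, h1, h2, h3, h4, h5, h6, h7, h8⟩))

theorem Slides.source (h : Layout n par tp bt cc) (hA : BottomUp par tp bt cc frm₀ F R)
    (hB : TopDown par tp cc F frm₀ frm mt dn) {c u : ℕ} (hs : Slides par frm dn c u) :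
    ¬ Target frm dn c ∧ 1 ≤ c ∧ c ≤ n ∧ 1 ≤ u ∧ u ≤ n := by
  have h0 := hA.frm_zero
  have hf0 : frm 0 = 0 := by rw [hB.other 0 (by simp), h0]
  have hd0 : dn 0 = 0 := by
    by_contra hd
    exact ((hB.mt_iff 0).mp (hB.down 0 hd)).1 rfl
  have hu : u ≠ 0 := by
    rintro rfl
    rcases hs with ⟨rfl, h1⟩ | ⟨h1, _⟩
    · exact h1 hf0
    · exact h1 hd0
  have hs' := hs.cases h hA hB
  refine ⟨by unfold Target; omega, ?_⟩
  rcases hs' with hs' | hs' | hs' | hs'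
  · have := h.par_range c (by omega)
    have := h.par_lt c (by omega)
    omega
  · have := h.tp_lt c (by omega)
    have := h.par_lt c (by omega)
    have := h.par_range c (by omega)
    omega
  · have := h.par_range c (by omega)
    have := h.par_lt c (by omega)
    omega
  · have := h.par_range u (by omega)
    have := h.par_lt u (by omega)
    omega

/-- The values of `F`, `mt` and `cc` at the source determine the kind of the slide. The target is
then the parent, the top, the parent or the cycle child, respectively. -/
theorem Slides.target_eq (h : Layout n par tp bt cc) (hA : BottomUp par tp bt cc frm₀ F R)
    (hB : TopDown par tp cc F frm₀ frm mt dn) {c u u' : ℕ} (hs : Slides par frm dn c u)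
    (hs' : Slides par frm dn c u') : u = u' := by
  have h1 := (hs.source h hA hB).2
  have h1' := (hs'.source h hA hB).2
  have h2 := hs.cases h hA hB
  have h2' := hs'.cases h hA hB
  omega

/-- The edges of the numbered graph. -/
def Edge (par tp : ℕ → ℕ) (i j : ℕ) : Prop :=
  (j < i ∧ (j = par i ∨ j = tp i)) ∨ (i < j ∧ (i = par j ∨ i = tp j))

theorem Slides.edge (h : Layout n par tp bt cc) (hA : BottomUp par tp bt cc frm₀ F R)
    (hB : TopDown par tp cc F frm₀ frm mt dn) {c u : ℕ} (hs : Slides par frm dn c u) :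
    Edge par tp c u := by
  have h1 := (hs.source h hA hB).2
  have h2 := h.par_lt c (by omega)
  have h3 := h.par_lt u (by omega)
  have h4 := h.tp_lt c
  unfold Edge
  rcases hs.cases h hA hB with hs' | hs' | hs' | hs' <;> omega

/-- A slide upwards needs only slides upwards to later vertices. -/
theorem Slides.order_up (h : Layout n par tp bt cc) (hA : BottomUp par tp bt cc frm₀ F R)
    (hB : TopDown par tp cc F frm₀ frm mt dn) {c u w : ℕ} (hs : Slides par frm dn c u)
    (hu : frm u ≠ 0) (hw : Target frm dn w) (hw0 : w ≠ 0) (hcw : Edge par tp c w) (hwu : w ≠ u) :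
    frm w ≠ 0 ∧ u < w := by
  obtain ⟨hc, hr⟩ := hs.source h hA hB
  have hcs := hs.cases h hA hB
  have hltc := h.par_lt c (by omega)
  have htpc := h.tp_lt c
  have hup : frm w ≠ 0 ∨ dn w ≠ 0 ∧ par w ≠ 0 ∧ Target frm dn (tp w) ∧ c ≠ par w := by
    rcases hw with hw | hw
    · exact Or.inl hw
    · right
      have hsw : Slides par frm dn (par w) w := Or.inr ⟨hw, rfl⟩
      have := hsw.source h hA hB
      refine ⟨hw, by omega, (hB.down_cases h hA hw).2.2.2.2.2.2.2, fun hcp => ?_⟩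
      rw [← hcp] at hsw
      exact hwu (hsw.target_eq h hA hB hs)
  rcases hcw with ⟨hlt, hwp | hwt⟩ | ⟨hlt, hwp | hwt⟩
  -- As `c` does not slide to its parent `w`, it is a bottom sliding to its top `u`. Then `w` lies
  -- on the same cycle below `u` and is not its bottom, so `w` is not a target from above.
  · have hcs2 : tp c = u ∧ bt c = c ∧ w ≠ tp c := by omega
    have h1 := h.bt_up c (by omega)
    rw [hcs2.2.1, ← hwp] at h1
    have h2 := h1.resolve_left hcs2.2.2
    have h3 : tp w = 0 := by
      by_contra h3
      have := (h.bt_self w h3).1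
      omega
    have hT0 : ¬ Target frm dn 0 := by
      rintro (h4 | h4)
      · rw [hB.other 0 (by simp), hA.frm_zero] at h4
        exact h4 rfl
      · exact ((hB.mt_iff 0).mp (hB.down 0 h4)).1 rfl
    rcases hup with hup | hup
    · exact ⟨hup, by omega⟩
    · rw [h3] at hup
      exact (hT0 hup.2.2.1).elim
  -- Now `c` is a bottom and its top `w` is a target other than `u`. A greedy slide from `c` is
  -- impossible, since an unmatched bottom begins a run, and the lower vertex of a pair slides up
  -- only if its top is no target.
  · exfalso
    have htp : tp c ≠ 0 := by omega
    obtain ⟨h1, h2⟩ := h.bt_self c htp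
    have h3 := hA.F_iff c (by omega)
    rw [h2, hA.F_zero] at h3
    rcases hcs with h4 | h4 | h4 | h4
    · have := hB.other c (by omega)
      have := hA.F_le c
      omega
    · omega
    · rw [hwt] at hw
      exact h4.2.2.2.2.2.2.2.2 hw
    · omega
  · exact ⟨by omega, by omega⟩
  -- Here `w` is a bottom with top `c`. A slide down to `w` would require `c` to be a target, but
  -- `c` is a source.
  · rcases hup with hup | hup
    · exact ⟨hup, by omega⟩
    · rw [← hwt] at hup
      exact (hc hup.2.2.1).elim

/-- A slide downwards needs no slide downwards to a later vertex. -/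
theorem Slides.order_down (h : Layout n par tp bt cc) (hA : BottomUp par tp bt cc frm₀ F R)
    (hB : TopDown par tp cc F frm₀ frm mt dn) {u w : ℕ}
    (hu : dn u ≠ 0) (hw : dn w ≠ 0) (hcw : Edge par tp (par u) w) (hwu : w ≠ u) :
    w < u := by
  have hs : Slides par frm dn (par u) u := Or.inr ⟨hu, rfl⟩
  have hsw : Slides par frm dn (par w) w := Or.inr ⟨hw, rfl⟩
  obtain ⟨hc, hr⟩ := hs.source h hA hB
  have := hsw.source h hA hB
  have := h.par_lt u (by omega)
  have := h.par_lt w (by omega)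
  rcases hcw with h1 | ⟨h1, h2 | h2⟩
  · omega
  · rw [h2] at hs
    exact (hwu (hsw.target_eq h hA hB hs)).elim
  · have h3 := (hB.down_cases h hA hw).2.2.2.2.2.2.2
    rw [← h2] at h3
    exact (hc h3).elim

end

end Cactus

/-! ### Maximality of the matching by an odd set cover -/

namespace Cactus

section

variable {n : ℕ} {par tp bt cc frm₀ F R frm mt dn : ℕ → ℕ}

/-- The vertices of the odd set cover. -/
def Cover (bt frm₀ F mt : ℕ → ℕ) (v : ℕ) : Prop :=
  frm₀ v ≠ 0 ∨ (F v = 1 ∧ mt (bt v) = 0 ∧ mt v = 1)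

/-- The vertices of the paths of even length. -/
def Even (bt F mt : ℕ → ℕ) (v : ℕ) : Prop := F v = 1 ∧ mt (bt v) = 1

/-- Every edge touches the cover, or lies in a path of even length together with the top of the
cycle. -/
theorem edge_cover (h : Layout n par tp bt cc) (hA : BottomUp par tp bt cc frm₀ F R)
    (hB : TopDown par tp cc F frm₀ frm mt dn) {i j : ℕ} (hj : j ≠ 0) (hij : j < i)
    (he : j = par i ∨ j = tp i) :
    Cover bt frm₀ F mt i ∨ Cover bt frm₀ F mt j ∨
      (Even bt F mt i ∧ (Even bt F mt j ∧ bt j = bt i ∨ j = tp (bt i))) := by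
  by_cases hfi : frm₀ i ≠ 0
  · exact Or.inl (Or.inl hfi)
  by_cases hfj : frm₀ j ≠ 0
  · exact Or.inr (Or.inl (Or.inl hfj))
  have hFle := hA.F_le i
  have hm := hB.mt_le (bt i)
  rcases he with rfl | rfl
  -- A vertex outside the runs that is not matched from below would have caused its parent to be
  -- matched.
  · by_cases hF : F i = 0
    · exact (hfj (hA.push i hj (by omega) hF)).elim
    · have hF : F i = 1 := by omega
      have hb := (hA.of_F (by omega) hF).1
      rcases h.bt_up i hb with h1 | ⟨h1, h2⟩
      · by_cases hm1 : mt (bt i) = 1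
        · exact Or.inr (Or.inr ⟨⟨hF, hm1⟩, Or.inr h1⟩)
        -- An odd run that extends to the child of the top requests the top, so the top is matched
        -- from below after all.
        · have h3 := ((parity_aux h hA hB _ i hb le_rfl).1 hF).1
          have h4 := (parity h hA hB hb h1).mpr ⟨h3, by omega⟩
          exact (hfj (hA.request i hb h1 h4)).elim
      -- Both ends are consecutive vertices of one run. If it is odd, exactly one of them has `mt`
      -- equal to `1` and lies in the cover.
      · have h3 := (hA.F_iff (par i) (by omega)).mpr ⟨by omega, by rw [h1]; exact hF⟩
        by_cases hm1 : mt (bt i) = 1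
        · exact Or.inr (Or.inr ⟨⟨hF, hm1⟩, Or.inl ⟨⟨h3, by rw [h2]; exact hm1⟩, h2⟩⟩)
        · have h4 := hB.mt_iff i
          have h5 := hB.mt_le (par i)
          unfold Cover
          rw [h2]
          omega
  · obtain ⟨h1, h2⟩ := h.bt_self i hj
    -- For a back edge, the bottom `i` begins a run. An even run contains the edge in its odd set,
    -- and an odd one has requested the top.
    have hF : F i = 1 := (hA.F_iff i (by omega)).mpr ⟨by omega, by rw [h2, hA.F_zero]⟩
    rw [h1] at hm ⊢
    by_cases hm1 : mt i = 1
    · exact Or.inr (Or.inr ⟨⟨hF, by rw [h1]; exact hm1⟩, Or.inr rfl⟩)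
    · obtain ⟨w, hw1, hw2⟩ := h.closing i hj
      have h4 := (parity h hA hB (w := w) (by omega) (by rw [hw1]; exact hw2)).mpr
        (by rw [hw1]; exact ⟨hF, by omega⟩)
      have := hA.request w (by omega) (by rw [hw1]; exact hw2) h4
      rw [hw2] at this
      exact (hfj this).elim

open Classical in
/-- Within a path of even length at least half of the vertices are matched with their parents. -/
theorem card_even_le (h : Layout n par tp bt cc) (hA : BottomUp par tp bt cc frm₀ F R)
    (hB : TopDown par tp cc F frm₀ frm mt dn) (b : ℕ) :
    ((Finset.Icc 1 n).filter fun v => Even bt F mt v ∧ bt v = b).card ≤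
      2 * ((Finset.Icc 1 n).filter fun v => (Even bt F mt v ∧ mt v = 1) ∧ bt v = b).card := by
  have hsplit := Finset.card_filter_add_card_filter_not
    (s := (Finset.Icc 1 n).filter fun v => Even bt F mt v ∧ bt v = b) (fun v => mt v = 1)
  have h1 : (((Finset.Icc 1 n).filter fun v => Even bt F mt v ∧ bt v = b).filter
      fun v => mt v = 1) = (Finset.Icc 1 n).filter fun v => (Even bt F mt v ∧ mt v = 1) ∧ bt v = b := by
    ext v; simp only [Finset.mem_filter]; tauto
  have h2 : (((Finset.Icc 1 n).filter fun v => Even bt F mt v ∧ bt v = b).filter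
      fun v => ¬ mt v = 1).card ≤
      ((Finset.Icc 1 n).filter fun v => (Even bt F mt v ∧ mt v = 1) ∧ bt v = b).card := by
    -- The bottom of an even run is matched with its parent. So a vertex with `mt` equal to `0` is
    -- not the bottom and is paired with its cycle child.
    have key : ∀ v, v ≠ 0 → Even bt F mt v → ¬ mt v = 1 →
        cc v ≠ 0 ∧ par (cc v) = v ∧ bt (cc v) = bt v ∧ F (cc v) = 1 ∧ mt (cc v) = 1 := by
      intro v hv he hm
      obtain ⟨h3, h4, h5⟩ := hA.of_F hv he.1
      have hc : cc v ≠ 0 := by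
        intro hc
        rcases h.bt_cases v h3 with h6 | h6
        · rw [Even, h6.1] at he
          exact hm he.2
        · exact h6.1 hc
      obtain ⟨h6, h7, _⟩ := h.cc_par hc
      have hml := hB.mt_le v
      exact ⟨hc, h6, h7, h5, (hB.mt_iff _).mpr ⟨hc, by rw [h6]; exact ⟨he.1, by omega, rfl⟩⟩⟩
    apply Finset.card_le_card_of_injOn cc
    · intro v hv
      simp only [Finset.coe_filter, Finset.mem_filter, Finset.mem_Icc, Set.mem_ofPred_eq] at hv ⊢
      obtain ⟨h3, h4, h5, h6, h7⟩ := key v (by omega) hv.1.2.1 hv.2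
      have h8 := cc_range h h3
      refine ⟨by omega, ⟨⟨h6, ?_⟩, h7⟩, by rw [h5]; exact hv.1.2.2⟩
      rw [h5]
      exact hv.1.2.1.2
    · intro v hv w hw hvw
      simp only [Finset.coe_filter, Finset.mem_filter, Finset.mem_Icc, Set.mem_ofPred_eq] at hv hw
      have h3 := (key v (by omega) hv.1.2.1 hv.2).2.1
      have h4 := (key w (by omega) hw.1.2.1 hw.2).2.1
      rw [← h3, ← h4, hvw]
  rw [h1] at hsplit
  omega

-- Each computed edge is charged once: edges of the first pass to the vertex matched from below,
-- pairs to their lower vertex. The charged vertex `v` is sent to the target of its edge, which is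
-- `v` itself or, for a pair directed upwards, `par v`.
open Classical in
theorem card_cover_le (h : Layout n par tp bt cc) (hA : BottomUp par tp bt cc frm₀ F R)
    (hB : TopDown par tp cc F frm₀ frm mt dn) :
    ((Finset.Icc 1 n).filter (Cover bt frm₀ F mt)).card +
      ((Finset.Icc 1 n).filter fun v => Even bt F mt v ∧ mt v = 1).card ≤
      ((Finset.Icc 1 n).filter (Target frm dn)).card := by
  have hunion : ((Finset.Icc 1 n).filter (Cover bt frm₀ F mt)).card +
      ((Finset.Icc 1 n).filter fun v => Even bt F mt v ∧ mt v = 1).card ≤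
      ((Finset.Icc 1 n).filter fun v => frm₀ v ≠ 0 ∨ (F v = 1 ∧ mt v = 1)).card := by
    rw [← Finset.card_union_of_disjoint]
    · apply Finset.card_le_card
      intro v
      simp only [Finset.mem_union, Finset.mem_filter]
      unfold Cover Even
      tauto
    · rw [Finset.disjoint_left]
      intro v hv hv'
      rw [Finset.mem_filter, Finset.mem_Icc] at hv hv'
      unfold Cover at hv
      unfold Even at hv'
      have := (hA.of_F (by omega) hv'.2.1.1).2.1
      omega
  refine hunion.trans ?_
  apply Finset.card_le_card_of_injOn fun v => if frm₀ v ≠ 0 ∨ dn v ≠ 0 then v else par v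
  all_goals
    have key : ∀ v, F v = 1 → mt v = 1 → dn v = 0 →
        par v ≠ 0 ∧ frm (par v) ≠ 0 ∧ F (par v) = 1 ∧ mt (par v) = 0 ∧ cc (par v) = v := by
      intro v h1 h2 h3
      obtain ⟨h4, h5, h6, h7⟩ := (hB.mt_iff v).mp h2
      have hp : par v ≠ 0 := by
        intro hp
        rw [hp, h.cc_zero 0 h.bt_zero] at h7
        exact h4 h7.symm
      rcases hB.select (par v) hp h5 h6 (by omega) with h8 | h8
      · rw [h7] at h8; omega
      · exact ⟨hp, by omega, h5, h6, h7⟩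
    have hF0 : ∀ v, v ≠ 0 → frm₀ v ≠ 0 → F v ≠ 1 := fun v hv h1 h2 => h1 (hA.of_F hv h2).2.1
  · intro v hv
    simp only [Finset.coe_filter, Finset.mem_Icc, Set.mem_ofPred_eq] at hv ⊢
    split_ifs with hc
    · refine ⟨hv.1, ?_⟩
      rcases hc with hc | hc
      · left
        rw [hB.other v (fun h' => hF0 v (by omega) hc h'.2.1)]
        exact hc
      · exact Or.inr hc
    · obtain ⟨h1, h2, _⟩ := key v (by omega) (by omega) (by omega)
      have := h.par_lt v (by omega)
      exact ⟨by omega, Or.inl h2⟩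
  · intro v hv w hw hvw
    simp only [Finset.coe_filter, Finset.mem_Icc, Set.mem_ofPred_eq] at hv hw hvw
    have hv0 := hF0 v (by omega)
    have hw0 := hF0 w (by omega)
    have hdv : dn v ≠ 0 → mt v = 1 := hB.down v
    have hdw : dn w ≠ 0 → mt w = 1 := hB.down w
    split_ifs at hvw with h1 h2 h2
    · exact hvw
    · obtain ⟨k1, k2, k3, k4, k5⟩ := key w (by omega) (by omega) (by omega)
      rw [← hvw] at k3 k4
      omega
    · obtain ⟨k1, k2, k3, k4, k5⟩ := key v (by omega) (by omega) (by omega)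
      rw [hvw] at k3 k4
      omega
    · obtain ⟨k1, k2, k3, k4, k5⟩ := key w (by omega) (by omega) (by omega)
      obtain ⟨l1, l2, l3, l4, l5⟩ := key v (by omega) (by omega) (by omega)
      rw [← k5, ← l5, hvw]

open Classical in
/-- No matching is larger than the one that was computed. -/
theorem card_matching_le (h : Layout n par tp bt cc) (hA : BottomUp par tp bt cc frm₀ F R)
    (hB : TopDown par tp cc F frm₀ frm mt dn) {S : Finset ℕ} {c : ℕ → ℕ}
    (hS : ∀ u ∈ S, u ∈ Finset.Icc 1 n ∧ c u ∈ Finset.Icc 1 n ∧ c u ∉ S ∧ Edge par tp (c u) u)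
    (hinj : Set.InjOn c S) : S.card ≤ ((Finset.Icc 1 n).filter (Target frm dn)).card := by
  refine le_trans ?_ (card_cover_le h hA hB)
  set p : ℕ → Prop := fun u => Cover bt frm₀ F mt u ∨ Cover bt frm₀ F mt (c u) with hp
  rw [← Finset.card_filter_add_card_filter_not (s := S) p]
  apply add_le_add
  · apply Finset.card_le_card_of_injOn fun u => if Cover bt frm₀ F mt u then u else c u
    · intro u hu
      simp only [Finset.coe_filter, Set.mem_ofPred_eq] at hu ⊢
      have := hS u hu.1
      split_ifs with hc
      · exact ⟨this.1, hc⟩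
      · exact ⟨this.2.1, hu.2.resolve_left hc⟩
    · intro u hu w hw huw
      simp only [Finset.coe_filter, Set.mem_ofPred_eq] at hu hw huw
      split_ifs at huw
      · exact huw
      · exact ((hS w hw.1).2.2.1 (huw ▸ hu.1)).elim
      · exact ((hS u hu.1).2.2.1 (huw ▸ hw.1)).elim
      · exact hinj hu.1 hw.1 huw
  -- An edge avoiding the cover lies in the odd set of one cycle, and the bottom of that cycle is
  -- read off from the later end of the edge.
  · set lab : ℕ → ℕ := fun u => bt (max u (c u)) with hlab
    have key : ∀ u ∈ S, ¬ p u → Even bt F mt (max u (c u)) ∧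
        ∀ x, x = u ∨ x = c u → (x ∈ Finset.Icc 1 n ∧ Even bt F mt x ∧ bt x = lab u) ∨
          x = tp (lab u) := by
      intro u hu hpu
      obtain ⟨h1, h2, _, h4⟩ := hS u hu
      rw [hp, not_or] at hpu
      have h1' := h1
      have h2' := h2
      rw [Finset.mem_Icc] at h1' h2'
      rcases h4 with ⟨h4, h5⟩ | ⟨h4, h5⟩
      · have hmax : max u (c u) = c u := by omega
        simp only [hlab, hmax]
        rcases edge_cover h hA hB (by omega) h4 h5 with h6 | h6 | ⟨h6, h7⟩
        · exact (hpu.2 h6).elim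
        · exact (hpu.1 h6).elim
        · refine ⟨h6, ?_⟩
          rintro x (rfl | rfl) <;> tauto
      · have hmax : max u (c u) = u := by omega
        simp only [hlab, hmax]
        rcases edge_cover h hA hB (by omega) h4 h5 with h6 | h6 | ⟨h6, h7⟩
        · exact (hpu.1 h6).elim
        · exact (hpu.2 h6).elim
        · refine ⟨h6, ?_⟩
          rintro x (rfl | rfl) <;> tauto
    have hbn : ∀ v, bt v ∈ Finset.Icc 0 n := by
      intro v
      rw [Finset.mem_Icc]
      by_cases hb : bt v = 0
      · omega
      · have h1 := (h.bt_range v hb).2.2.1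
        have := h.tp_lt _ h1
        have := h.par_range (bt v) (by omega)
        omega
    rw [Finset.card_eq_sum_card_fiberwise (f := lab) (t := Finset.Icc 0 n) (fun u _ => hbn _),
      Finset.card_eq_sum_card_fiberwise (f := bt) (t := Finset.Icc 0 n)
        (s := (Finset.Icc 1 n).filter fun v => Even bt F mt v ∧ mt v = 1) (fun u _ => hbn _)]
    apply Finset.sum_le_sum
    intro b _
    set Sb := (S.filter fun u => ¬ p u).filter fun u => lab u = b with hSb
    -- The matching edges inside one odd set have twice as many distinct ends. These lie in the run
    -- or at the top, so at most 2k + 1 are available, which bounds the number of edges by k.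
    have hsub : Sb ∪ Sb.image c ⊆
        insert (tp b) ((Finset.Icc 1 n).filter fun v => Even bt F mt v ∧ bt v = b) := by
      intro x hx
      rw [Finset.mem_union, Finset.mem_image] at hx
      obtain ⟨u, hu, hxu⟩ : ∃ u ∈ Sb, x = u ∨ x = c u := by
        rcases hx with hx | ⟨u, hu, hx⟩
        · exact ⟨x, hx, Or.inl rfl⟩
        · exact ⟨u, hu, Or.inr hx.symm⟩
      simp only [hSb, Finset.mem_filter] at hu
      have := (key u hu.1.1 hu.1.2).2 x hxu
      rw [hu.2] at this
      rw [Finset.mem_insert, Finset.mem_filter]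
      tauto
    have hcard := (Finset.card_le_card hsub).trans (Finset.card_insert_le _ _)
    rw [Finset.card_union_of_disjoint, Finset.card_image_of_injOn] at hcard
    · have := card_even_le h hA hB b
      rw [Finset.filter_filter]
      omega
    · intro u hu w hw huw
      simp only [hSb, Finset.coe_filter, Finset.mem_filter, Set.mem_ofPred_eq] at hu hw
      exact hinj hu.1.1 hw.1.1 huw
    · rw [Finset.disjoint_left]
      intro x hx hx'
      rw [Finset.mem_image] at hx'
      obtain ⟨u, hu, rfl⟩ := hx'
      simp only [hSb, Finset.mem_filter] at hu hx
      exact (hS u hu.1.1).2.2.1 hx.1.1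

end

/-! ### The strategy -/

/-- `f` numbers the vertices of `G` such that the edges are those given by `par` and `tp`. -/
structure Numbering {n : ℕ} (G : SimpleGraph (Fin n)) (f : ℕ → Fin n) (par tp : ℕ → ℕ) : Prop where
  inj : ∀ i j, 1 ≤ i → i ≤ n → 1 ≤ j → j ≤ n → f i = f j → i = j
  surj : ∀ v, ∃ i, 1 ≤ i ∧ i ≤ n ∧ f i = v
  adj : ∀ i j, 1 ≤ j → j < i → i ≤ n → (G.Adj (f i) (f j) ↔ j = par i ∨ j = tp i)

theorem Numbering.adj_iff {n : ℕ} {G : SimpleGraph (Fin n)} {f : ℕ → Fin n} {par tp : ℕ → ℕ}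
    (hf : Numbering G f par tp) {i j : ℕ} (hi : 1 ≤ i) (hi' : i ≤ n) (hj : 1 ≤ j) (hj' : j ≤ n) :
    G.Adj (f i) (f j) ↔ Edge par tp i j := by
  rcases lt_trichotomy i j with hlt | rfl | hlt
  · rw [G.adj_comm, hf.adj j i hi hlt hj']
    unfold Edge; omega
  · simp [Edge]
  · rw [hf.adj i j hj hlt hi']
    unfold Edge; omega

/-- The vertices that are never slid to. -/
def placeList (n : ℕ) (frm dn : ℕ → ℕ) : List ℕ :=
  (List.range' 1 n).filter fun i => frm i = 0 ∧ dn i = 0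

/-- The slides upwards, and then those downwards. -/
def slideList (n : ℕ) (par frm dn : ℕ → ℕ) : List (ℕ × ℕ) :=
  ((List.range' 1 n).reverse.filter fun i => frm i ≠ 0).map (fun i => (frm i, i)) ++
    ((List.range' 1 n).filter fun i => dn i ≠ 0).map fun i => (par i, i)

section

variable {n : ℕ} {par tp bt cc frm₀ F R frm mt dn : ℕ → ℕ}

theorem mem_placeList {v : ℕ} :
    v ∈ placeList n frm dn ↔ (1 ≤ v ∧ v ≤ n) ∧ ¬ Target frm dn v := by
  simp only [placeList, List.mem_filter, List.mem_range'_1, decide_eq_true_eq, Target]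
  omega

theorem mem_slideList {p : ℕ × ℕ} :
    p ∈ slideList n par frm dn ↔ (1 ≤ p.2 ∧ p.2 ≤ n) ∧ Slides par frm dn p.1 p.2 := by
  obtain ⟨c, u⟩ := p
  simp only [slideList, List.mem_append, List.mem_map, List.mem_filter, List.mem_reverse,
    List.mem_range'_1, decide_eq_true_eq, Prod.mk.injEq, Slides]
  constructor
  · rintro (⟨i, h1, h2, rfl⟩ | ⟨i, h1, h2, rfl⟩) <;> omega
  · rintro ⟨h1, ⟨h2, h3⟩ | ⟨h2, h3⟩⟩
    · exact Or.inl ⟨u, by omega⟩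
    · exact Or.inr ⟨u, by omega⟩

theorem slideList_snd_nodup (h : Layout n par tp bt cc) (hA : BottomUp par tp bt cc frm₀ F R)
    (hB : TopDown par tp cc F frm₀ frm mt dn) :
    (slideList n par frm dn).Pairwise fun p q => p.2 ≠ q.2 := by
  rw [slideList, List.pairwise_append]
  refine ⟨?_, ?_, ?_⟩
  · rw [List.pairwise_map]
    exact (List.nodup_reverse.mpr (List.nodup_range' (step := 1))).filter _
  · rw [List.pairwise_map]
    exact (List.nodup_range' (step := 1)).filter _
  · simp only [List.mem_map, List.mem_filter, decide_eq_true_eq]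
    rintro _ ⟨i, ⟨_, hi⟩, rfl⟩ _ ⟨j, ⟨_, hj⟩, rfl⟩ hij
    have hij : i = j := hij
    subst hij
    have := (hB.down_cases h hA hj).2.2.2.2.2.2.1
    omega

/-- By `Slides.order_up` any other target adjacent to an upward source is itself an upward target
with a larger number, hence earlier in the list. By `Slides.order_down` another downward target
adjacent to a downward source has a smaller number, and is again earlier. -/
theorem slideList_order (h : Layout n par tp bt cc) (hA : BottomUp par tp bt cc frm₀ F R)
    (hB : TopDown par tp cc F frm₀ frm mt dn) :
    (slideList n par frm dn).Pairwise fun p q => ¬ Edge par tp p.1 q.2 := by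
  rw [slideList, List.pairwise_append]
  refine ⟨?_, ?_, ?_⟩
  · rw [List.pairwise_map]
    refine List.Pairwise.imp_of_mem ?_ ((List.pairwise_reverse.mpr
      (List.pairwise_lt_range' (s := 1) (n := n) (step := 1))).filter _)
    simp only [List.mem_filter, List.mem_reverse, List.mem_range'_1, decide_eq_true_eq]
    intro u w hu hw hwu he
    have := Slides.order_up h hA hB (u := u) (Or.inl ⟨rfl, hu.2⟩) hu.2 (Or.inl hw.2) (by omega) he
      (by omega)
    omega
  · rw [List.pairwise_map]
    refine List.Pairwise.imp_of_mem ?_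
      ((List.pairwise_lt_range' (s := 1) (n := n) (step := 1)).filter _)
    simp only [List.mem_filter, List.mem_range'_1, decide_eq_true_eq]
    intro u w hu hw hwu he
    have := Slides.order_down h hA hB hu.2 hw.2 he (by omega)
    omega
  · simp only [List.mem_map, List.mem_filter, decide_eq_true_eq, List.mem_reverse,
      List.mem_range'_1]
    rintro _ ⟨u, hu, rfl⟩ _ ⟨w, hw, rfl⟩ he
    simp only at he
    have h1 := (hB.down_cases h hA hw.2).2.2.2.2.2.2.1
    have := Slides.order_up h hA hB (u := u) (Or.inl ⟨rfl, hu.2⟩) hu.2 (Or.inr hw.2) (by omega) he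
      (by rintro rfl; omega)
    omega

theorem isPlan {G : SimpleGraph (Fin n)} {f : ℕ → Fin n} (hf : Numbering G f par tp)
    (h : Layout n par tp bt cc) (hA : BottomUp par tp bt cc frm₀ F R)
    (hB : TopDown par tp cc F frm₀ frm mt dn) :
    GraphSearch.IsPlan G ((placeList n frm dn).map f)
      ((slideList n par frm dn).map (Prod.map f f)) := by
  have hmem : ∀ p ∈ slideList n par frm dn, (1 ≤ p.2 ∧ p.2 ≤ n) ∧ (1 ≤ p.1 ∧ p.1 ≤ n) ∧
      Slides par frm dn p.1 p.2 := by
    intro p hp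
    obtain ⟨h1, h2⟩ := mem_slideList.mp hp
    have := h2.source h hA hB
    exact ⟨h1, by omega, h2⟩
  have hsnd := slideList_snd_nodup h hA hB
  constructor
  · refine List.Nodup.map_on ?_ ((List.nodup_range' (step := 1)).filter _)
    intro i hi j hj hij
    have hi := (mem_placeList.mp hi).1
    have hj := (mem_placeList.mp hj).1
    exact hf.inj i j hi.1 hi.2 hj.1 hj.2 hij
  · intro v
    obtain ⟨i, h1, h2, rfl⟩ := hf.surj v
    by_cases hi : Target frm dn i
    · right
      obtain ⟨c, hc⟩ : ∃ c, Slides par frm dn c i := by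
        rcases hi with hi | hi
        · exact ⟨_, Or.inl ⟨rfl, hi⟩⟩
        · exact ⟨_, Or.inr ⟨hi, rfl⟩⟩
      rw [List.map_map]
      exact List.mem_map.mpr ⟨(c, i), mem_slideList.mpr ⟨⟨h1, h2⟩, hc⟩, rfl⟩
    · exact Or.inl (List.mem_map_of_mem (mem_placeList.mpr ⟨⟨h1, h2⟩, hi⟩))
  · intro p hp
    obtain ⟨q, hq, rfl⟩ := List.mem_map.mp hp
    obtain ⟨h1, h2, h3⟩ := hmem q hq
    exact List.mem_map_of_mem (mem_placeList.mpr ⟨h2, (h3.source h hA hB).1⟩)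
  · intro p hp hp'
    obtain ⟨q, hq, rfl⟩ := List.mem_map.mp hp
    obtain ⟨i, hi, hiq⟩ := List.mem_map.mp hp'
    obtain ⟨h1, h2, h3⟩ := hmem q hq
    obtain ⟨h4, h5⟩ := mem_placeList.mp hi
    have := hf.inj i q.2 h4.1 h4.2 h1.1 h1.2 hiq
    subst this
    rcases h3 with h3 | h3
    · exact h5 (Or.inl (by omega))
    · exact h5 (Or.inr h3.1)
  · rw [List.map_map, List.Nodup, List.pairwise_map]
    refine hsnd.imp_of_mem ?_
    intro p q hp hq hpq hpq'
    obtain ⟨h1, h2, h3⟩ := hmem p hp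
    obtain ⟨k1, k2, k3⟩ := hmem q hq
    have := hf.inj _ _ h2.1 h2.2 k2.1 k2.2 hpq'
    rw [this] at h3
    exact hpq (h3.target_eq h hA hB k3)
  · rw [List.map_map, List.Nodup, List.pairwise_map]
    refine hsnd.imp_of_mem ?_
    intro p q hp hq hpq hpq'
    obtain ⟨h1, h2, h3⟩ := hmem p hp
    obtain ⟨k1, k2, k3⟩ := hmem q hq
    exact hpq (hf.inj _ _ h1.1 h1.2 k1.1 k1.2 hpq')
  · intro p hp
    obtain ⟨q, hq, rfl⟩ := List.mem_map.mp hp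
    obtain ⟨h1, h2, h3⟩ := hmem q hq
    exact (hf.adj_iff h2.1 h2.2 h1.1 h1.2).mpr (h3.edge h hA hB)
  · rw [List.pairwise_map]
    refine (slideList_order h hA hB).imp_of_mem ?_
    intro p q hp hq hpq hadj
    obtain ⟨h1, h2, h3⟩ := hmem p hp
    obtain ⟨k1, k2, k3⟩ := hmem q hq
    exact hpq ((hf.adj_iff h2.1 h2.2 k1.1 k1.2).mp hadj)

open Classical in
theorem length_placeList :
    (placeList n frm dn).length + ((Finset.Icc 1 n).filter (Target frm dn)).card = n := by
  have h1 : (placeList n frm dn).length =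
      ((Finset.Icc 1 n).filter fun v => ¬ Target frm dn v).card := by
    rw [placeList, ← List.toFinset_card_of_nodup ((List.nodup_range' (step := 1)).filter _)]
    congr 1
    ext v
    rw [List.mem_toFinset, Finset.mem_filter, Finset.mem_Icc]
    exact mem_placeList
  rw [h1, add_comm, Finset.card_filter_add_card_filter_not, Nat.card_Icc]
  omega

theorem plan_optimal {G : SimpleGraph (Fin n)} {f : ℕ → Fin n} (hf : Numbering G f par tp)
    (h : Layout n par tp bt cc) (hA : BottomUp par tp bt cc frm₀ F R)
    (hB : TopDown par tp cc F frm₀ frm mt dn) :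
    GraphSearch.IsOptimal G (GraphSearch.normalized ((placeList n frm dn).map f)
      ((slideList n par frm dn).map (Prod.map f f))) ∧
    ((placeList n frm dn).map f).length = GraphSearch.czf G := by
  classical
  refine (isPlan hf h hA hB).optimal fun P c hc => ?_
  rw [List.length_map]
  choose g hg1 hg2 hg3 using hf.surj
  have hgf : ∀ i, 1 ≤ i → i ≤ n → g (f i) = i := fun i h1 h2 =>
    hf.inj _ _ (hg1 _) (hg2 _) h1 h2 (hg3 _)
  have hginj : Function.Injective g := fun v w hvw => by rw [← hg3 v, ← hg3 w, hvw]
  have key := card_matching_le h hA hB (S := (Pᶜ).toFinset.image g) (c := fun i => g (c (f i)))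
    (by
      intro u hu
      obtain ⟨v, hv, rfl⟩ := Finset.mem_image.mp hu
      rw [Set.mem_toFinset] at hv
      simp only [hg3, Finset.mem_Icc]
      refine ⟨⟨hg1 _, hg2 _⟩, ⟨hg1 _, hg2 _⟩, ?_, ?_⟩
      · intro hm
        obtain ⟨w, hw, hwv⟩ := Finset.mem_image.mp hm
        rw [hginj hwv, Set.mem_toFinset] at hw
        exact hc.notMem v hv hw
      · rw [← hf.adj_iff (hg1 _) (hg2 _) (hg1 _) (hg2 _), hg3, hg3]
        exact hc.adj v hv)
    (by
      intro u hu w hw huw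
      obtain ⟨v, hv, rfl⟩ := Finset.mem_image.mp hu
      obtain ⟨x, hx, rfl⟩ := Finset.mem_image.mp hw
      rw [Set.mem_toFinset] at hv hx
      simp only [hg3] at huw
      rw [hc.inj hv hx (hginj huw)])
  rw [Finset.card_image_of_injective _ hginj] at key
  have h1 := length_placeList (n := n) (frm := frm) (dn := dn)
  have h2 : P.ncard + (Pᶜ).toFinset.card = n := by
    have := Set.ncard_add_ncard_compl P
    rw [Nat.card_fin] at this
    rw [← Set.ncard_eq_toFinset_card']
    exact this
  omega

end

end Cactus

namespace Cactus

/-! ### Depth-first search trees of cacti -/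

/-- `j` is reached from `i` by following parents. -/
inductive Anc (par : ℕ → ℕ) (j : ℕ) : ℕ → Prop
  | refl : Anc par j j
  | step {i : ℕ} (h : Anc par j (par i)) : Anc par j i

/-- The tree edge from `v` to its parent lies on the tree path from `b` to its ancestor `x`. -/
inductive Cov (par : ℕ → ℕ) (x b : ℕ) : ℕ → Prop
  | base : Cov par x b b
  | step {v : ℕ} (h : Cov par x b v) (hv : par v ≠ x) : Cov par x b (par v)

/-- A depth-first search tree, the vertices being numbered by `f` in the order of discovery;
`tp i` is some other earlier neighbor of `i`, if there is one. -/
structure SearchTree {n : ℕ} (G : SimpleGraph (Fin n)) (f : ℕ → Fin n) (par tp : ℕ → ℕ) : Prop where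
  inj : ∀ i j, 1 ≤ i → i ≤ n → 1 ≤ j → j ≤ n → f i = f j → i = j
  surj : ∀ v, ∃ i, 1 ≤ i ∧ i ≤ n ∧ f i = v
  par_pos : ∀ v, 2 ≤ v → v ≤ n → par v ≠ 0
  par_range : ∀ v, par v ≠ 0 → 2 ≤ v ∧ v ≤ n
  par_lt : ∀ v, v ≠ 0 → par v < v
  par_adj : ∀ v, par v ≠ 0 → G.Adj (f v) (f (par v))
  tp_back : ∀ v, tp v ≠ 0 → v ≤ n ∧ tp v < v ∧ tp v ≠ par v ∧ G.Adj (f v) (f (tp v))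
  -- Only some back edge at `i` is recorded. That it is the one to `j` follows later from the cactus
  -- property.
  back : ∀ i j, 1 ≤ j → j < i → i ≤ n → G.Adj (f i) (f j) → j = par i ∨ tp i ≠ 0
  anc : ∀ i j, 1 ≤ j → j < i → i ≤ n → G.Adj (f i) (f j) → Anc par j i

section

variable {n : ℕ} {G : SimpleGraph (Fin n)} {f : ℕ → Fin n} {par tp : ℕ → ℕ}

theorem SearchTree.par_zero (h : SearchTree G f par tp) : par 0 = 0 := by
  by_contra h'
  have := h.par_range 0 h'
  omega

theorem SearchTree.par_le (h : SearchTree G f par tp) (v : ℕ) : par v ≤ v := by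
  by_cases hv : v = 0
  · rw [hv, h.par_zero]
  · exact (h.par_lt v hv).le

theorem SearchTree.anc_le (h : SearchTree G f par tp) {j i : ℕ} (ha : Anc par j i) : j ≤ i := by
  induction ha with
  | refl => rfl
  | step _ ih => exact ih.trans (h.par_le _)

theorem SearchTree.cov_le (h : SearchTree G f par tp) {x b v : ℕ} (hc : Cov par x b v) :
    v ≤ b := by
  induction hc with
  | base => rfl
  | step _ _ ih => exact (h.par_le _).trans ih

theorem SearchTree.cov_anc {x b v : ℕ} (ha : Anc par x b) (hb : x ≠ b) (hc : Cov par x b v) :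
    Anc par x (par v) := by
  induction hc with
  | base =>
    cases ha with
    | refl => exact (hb rfl).elim
    | step ha => exact ha
  | step _ hv ih =>
    generalize hp : par _ = y at ih hv
    cases ih with
    | refl => exact (hv rfl).elim
    | step ih => exact ih

/-- Climbing from `b`, all vertices met so far have numbers at least that of the current end, so
appending its parent, which is smaller, never repeats a vertex. -/
theorem SearchTree.exists_path (h : SearchTree G f par tp) {x b v : ℕ} (hx : 1 ≤ x)
    (hb : b ≤ n) (ha : Anc par x b) (hxb : x ≠ b) (hc : Cov par x b v) :
    ∃ p : G.Walk (f b) (f (par v)), p.IsPath ∧ f v ∈ p.support ∧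
      (∀ z ∈ p.support, ∃ y, par v ≤ y ∧ y ≤ n ∧ z = f y) ∧
      ∀ e ∈ p.edges, ∃ y, par y ≠ 0 ∧ e = s(f y, f (par y)) := by
  have hpar : ∀ v, Cov par x b v → par v ≠ 0 := by
    intro v hv
    have := h.anc_le (SearchTree.cov_anc ha hxb hv)
    omega
  induction hc with
  | base =>
    have h1 := hpar b .base
    have h2 := h.par_le b
    refine ⟨(h.par_adj b h1).toWalk, ?_, ?_, ?_, ?_⟩
    · exact SimpleGraph.Walk.IsPath.of_adj (h.par_adj b h1)
    · simp
    · simp only [SimpleGraph.Walk.support_cons, SimpleGraph.Walk.support_nil, List.mem_cons,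
        List.not_mem_nil, or_false]
      rintro z (rfl | rfl)
      · exact ⟨b, h2, hb, rfl⟩
      · exact ⟨par b, le_rfl, by omega, rfl⟩
    · simp only [SimpleGraph.Walk.edges_cons, SimpleGraph.Walk.edges_nil, List.mem_singleton]
      rintro e rfl
      exact ⟨b, h1, rfl⟩
  | @step v hv hvx ih =>
    obtain ⟨p, hp, _, hsup, hed⟩ := ih
    have h1 := hpar _ (hv.step hvx)
    have h2 := h.par_lt (par v) (hpar v hv)
    have h3 := h.par_range _ h1
    refine ⟨p.concat (h.par_adj _ h1), ?_, ?_, ?_, ?_⟩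
    · apply hp.concat
      intro hm
      obtain ⟨y, hy1, hy2, hy3⟩ := hsup _ hm
      have := h.inj _ _ (by omega) (by omega) (by omega) hy2 hy3
      omega
    · rw [SimpleGraph.Walk.support_concat]
      simp
    · intro z hz
      rw [SimpleGraph.Walk.support_concat] at hz
      simp only [List.mem_append, List.mem_singleton] at hz
      rcases hz with hz | rfl
      · obtain ⟨y, hy1, hy2, hy3⟩ := hsup z hz
        exact ⟨y, by omega, hy2, hy3⟩
      · exact ⟨par (par v), le_rfl, by omega, rfl⟩
    · intro e he
      rw [SimpleGraph.Walk.edges_concat] at he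
      simp only [List.concat_eq_append, List.mem_append, List.mem_singleton] at he
      rcases he with he | rfl
      · exact hed e he
      · exact ⟨par v, h1, rfl⟩

/-- An extension of a tree path from `b` up to `x`. -/
theorem SearchTree.exists_extension (h : SearchTree G f par tp) {x b : ℕ} (hx : 1 ≤ x)
    (ha : Anc par x b) (hxb : x ≠ b) (v : ℕ) :
    Cov par x b v → ∀ p : G.Walk (f b) (f (par v)), p.IsPath →
      (∀ z ∈ p.support, ∃ y, par v ≤ y ∧ y ≤ n ∧ z = f y) →
      (∀ e ∈ p.edges, ∃ y, par y ≠ 0 ∧ e = s(f y, f (par y))) →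
      ∃ q : G.Walk (f b) (f x), q.IsPath ∧ p.support ⊆ q.support ∧
        ∀ e ∈ q.edges, ∃ y, par y ≠ 0 ∧ e = s(f y, f (par y)) := by
  induction v using Nat.strong_induction_on with
  | _ v ih =>
    intro hc p hp hsup hed
    by_cases hvx : par v = x
    · subst hvx
      exact ⟨p, hp, List.Subset.refl _, hed⟩
    · have h0 := h.anc_le (SearchTree.cov_anc ha hxb hc)
      have hc' := hc.step hvx
      have h1 : par (par v) ≠ 0 := by
        have := h.anc_le (SearchTree.cov_anc ha hxb hc')
        omega
      have h2 := h.par_lt (par v) (by omega)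
      have h3 := h.par_range _ h1
      have h4 := h.par_range v (by omega)
      obtain ⟨q, hq1, hq2, hq3⟩ := ih (par v) (h.par_lt v (by omega)) hc'
        (p.concat (h.par_adj _ h1)) (by
          apply hp.concat
          intro hm
          obtain ⟨y, hy1, hy2, hy3⟩ := hsup _ hm
          have := h.inj _ _ (by omega) (by omega) (by omega) hy2 hy3
          omega) (by
          intro z hz
          rw [SimpleGraph.Walk.support_concat] at hz
          simp only [List.mem_append, List.mem_singleton] at hz
          rcases hz with hz | rfl
          · obtain ⟨y, hy1, hy2, hy3⟩ := hsup z hz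
            exact ⟨y, by omega, hy2, hy3⟩
          · exact ⟨par (par v), le_rfl, by omega, rfl⟩) (by
          intro e he
          rw [SimpleGraph.Walk.edges_concat] at he
          simp only [List.concat_eq_append, List.mem_append, List.mem_singleton] at he
          rcases he with he | rfl
          · exact hed e he
          · exact ⟨par v, h1, rfl⟩)
      refine ⟨q, hq1, fun z hz => hq2 ?_, hq3⟩
      rw [SimpleGraph.Walk.support_concat]
      simp [hz]

/-- `b` and `x` are joined by a back edge. -/
def IsBack (G : SimpleGraph (Fin n)) (f : ℕ → Fin n) (par : ℕ → ℕ) (b x : ℕ) : Prop :=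
  1 ≤ x ∧ x < b ∧ b ≤ n ∧ x ≠ par b ∧ G.Adj (f b) (f x)

theorem SearchTree.back_ne_tree (h : SearchTree G f par tp) {b x y : ℕ} (hb : IsBack G f par b x)
    (hy : par y ≠ 0) : s(f b, f x) ≠ s(f y, f (par y)) := by
  obtain ⟨h1, h2, h3, h4, _⟩ := hb
  have h5 := h.par_range y hy
  have h6 := h.par_lt y (by omega)
  rw [Ne, Sym2.eq_iff]
  rintro (⟨h7, h8⟩ | ⟨h7, h8⟩)
  · have := h.inj _ _ (by omega) (by omega) (by omega) (by omega) h7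
    subst this
    exact h4 (h.inj _ _ (by omega) (by omega) (by omega) (by omega) h8)
  · have := h.inj _ _ (by omega) (by omega) (by omega) (by omega) h7
    have := h.inj _ _ (by omega) (by omega) (by omega) (by omega) h8
    omega

/-- This is the fundamental cycle of a back edge. Its having a single non-tree edge allows the back
edge to be recovered from the cycle. -/
theorem SearchTree.exists_cycle (h : SearchTree G f par tp) {b x v : ℕ} (hb : IsBack G f par b x)
    (hc : Cov par x b v) :
    ∃ p : G.Walk (f x) (f x), p.IsCycle ∧ f v ∈ p.support ∧ f (par v) ∈ p.support ∧
      s(f b, f x) ∈ p.edges ∧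
      ∀ e ∈ p.edges, e = s(f b, f x) ∨ ∃ y, par y ≠ 0 ∧ e = s(f y, f (par y)) := by
  have hb' := hb
  obtain ⟨h1, h2, h3, h4, h5⟩ := hb
  have ha := h.anc b x h1 h2 h3 h5
  obtain ⟨p, hp, hv, hsup, hed⟩ := h.exists_path h1 h3 ha h2.ne hc
  obtain ⟨q, hq, hpq, hed'⟩ := h.exists_extension h1 ha h2.ne v hc p hp hsup hed
  refine ⟨.cons h5.symm q, ?_, ?_, ?_, ?_, ?_⟩
  · refine SimpleGraph.Path.cons_isCycle ⟨q, hq⟩ h5.symm fun he => ?_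
    obtain ⟨y, hy, hye⟩ := hed' _ he
    rw [Sym2.eq_swap] at hye
    exact h.back_ne_tree hb' hy hye
  · exact List.mem_cons_of_mem _ (hpq hv)
  · exact List.mem_cons_of_mem _ (hpq p.end_mem_support)
  · rw [SimpleGraph.Walk.edges_cons, Sym2.eq_swap]
    exact List.mem_cons_self
  · intro e he
    rw [SimpleGraph.Walk.edges_cons, List.mem_cons] at he
    rcases he with rfl | he
    · exact Or.inl Sym2.eq_swap
    · exact Or.inr (hed' e he)

/-- In a cactus, each tree edge lies in at most one cycle closed by a back edge. -/
theorem SearchTree.cov_unique (h : SearchTree G f par tp) (hG : GraphSearch.IsCactus G)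
    {b x b' x' v : ℕ} (hb : IsBack G f par b x) (hb' : IsBack G f par b' x')
    (hc : Cov par x b v) (hc' : Cov par x' b' v) : b = b' ∧ x = x' := by
  obtain ⟨p, hp, hv, hpv, he, hed⟩ := h.exists_cycle hb hc
  obtain ⟨q, hq, hv', hpv', he', hed'⟩ := h.exists_cycle hb' hc'
  -- Equal cycles have the same non-tree edge. Distinct cycles would share both ends of the tree
  -- edge from `v` to its parent, which a cactus forbids.
  by_cases hpq : p.toSubgraph = q.toSubgraph
  · have : s(f b, f x) ∈ q.edges := by
      rw [← SimpleGraph.Walk.mem_edges_toSubgraph] at he ⊢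
      rwa [← hpq]
    rcases hed' _ this with h1 | ⟨y, hy, h1⟩
    · obtain ⟨k1, k2, k3, k4, _⟩ := hb
      obtain ⟨l1, l2, l3, l4, _⟩ := hb'
      rcases Sym2.eq_iff.mp h1 with ⟨h2, h3⟩ | ⟨h2, h3⟩
      · exact ⟨h.inj _ _ (by omega) (by omega) (by omega) (by omega) h2,
          h.inj _ _ (by omega) (by omega) (by omega) (by omega) h3⟩
      · have := h.inj _ _ (by omega) (by omega) (by omega) (by omega) h2
        have := h.inj _ _ (by omega) (by omega) (by omega) (by omega) h3
        omega
    · exact (h.back_ne_tree hb hy h1).elim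
  · have h1 := hG.2 _ _ p q hp hq hpq ⟨hv, hv'⟩ ⟨hpv, hpv'⟩
    obtain ⟨k1, k2, k3, k4, k5⟩ := hb
    have h2 := h.anc_le (SearchTree.cov_anc (h.anc _ _ k1 k2 k3 k5) k2.ne hc)
    have h3 := h.par_range v (by omega)
    have h4 := h.par_lt v (by omega)
    have := h.inj _ _ (by omega) (by omega) (by omega) (by omega) h1
    omega

theorem SearchTree.isBack_tp (h : SearchTree G f par tp) {b : ℕ} (hb : tp b ≠ 0) :
    IsBack G f par b (tp b) := by
  obtain ⟨h1, h2, h3, h4⟩ := h.tp_back b hb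
  exact ⟨by omega, h2, h1, h3, h4⟩

/-- Two back edges from `i` would both cover the tree edge from `i` to its parent, so there is at
most one and `tp i` records it. -/
theorem SearchTree.numbering (h : SearchTree G f par tp) (hG : GraphSearch.IsCactus G) :
    Numbering G f par tp := by
  refine ⟨h.inj, h.surj, fun i j hj hij hi => ⟨fun hadj => ?_, ?_⟩⟩
  · by_cases hp : j = par i
    · exact Or.inl hp
    · right
      have h1 := (h.back i j hj hij hi hadj).resolve_left hp
      exact (h.cov_unique hG ⟨hj, hij, hi, hp, hadj⟩ (h.isBack_tp h1) .base .base).2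
  · rintro (rfl | rfl)
    · exact h.par_adj i (by omega)
    · exact (h.tp_back i (by omega)).2.2.2

theorem SearchTree.cov_tp_lt (h : SearchTree G f par tp) {b v : ℕ} (hb : tp b ≠ 0)
    (hc : Cov par (tp b) b v) : tp b ≤ par v ∧ 2 ≤ v ∧ v ≤ b ∧ b ≤ n ∧ par v < v := by
  obtain ⟨h1, h2, h3, h4, h5⟩ := h.isBack_tp hb
  have h6 := h.anc_le (SearchTree.cov_anc (h.anc _ _ h1 h2 h3 h5) h2.ne hc)
  have h7 := h.par_range v (by omega)
  have h8 := h.par_lt v (by omega)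
  exact ⟨h6, h7.1, h.cov_le hc, h3, h8⟩

/-- The covered vertices form a chain under `par`. In the induction, `w` is replaced by the vertex
of which it was obtained as the parent, which is closer to `b`. -/
theorem SearchTree.cov_chain (h : SearchTree G f par tp) {b : ℕ} (hb : tp b ≠ 0) (k : ℕ) :
    ∀ w w', Cov par (tp b) b w → Cov par (tp b) b w' → w < w' → 2 * b - (w + w') ≤ k →
      w ≤ par w' := by
  induction k using Nat.strong_induction_on with
  | _ k ih =>
    intro w w' hw hw' hlt hk
    have hle' := h.cov_le hw'
    have hle := h.cov_le hw
    cases hw with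
    | base => omega
    | @step w₁ hw₁ hv =>
      have h1 := h.cov_tp_lt hb hw₁
      rcases lt_trichotomy w' w₁ with h2 | rfl | h2
      · have := ih (2 * b - (w' + w₁)) (by omega) w' w₁ hw' hw₁ h2 le_rfl
        omega
      · rfl
      · have := ih (2 * b - (w₁ + w')) (by omega) w₁ w' hw₁ hw' h2 le_rfl
        omega

theorem SearchTree.cov_inj (h : SearchTree G f par tp) {b w w' : ℕ} (hb : tp b ≠ 0)
    (hw : Cov par (tp b) b w) (hw' : Cov par (tp b) b w') (hp : par w = par w') : w = w' := by
  have h1 := h.cov_tp_lt hb hw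
  have h2 := h.cov_tp_lt hb hw'
  rcases lt_trichotomy w w' with h3 | h3 | h3
  · have := h.cov_chain hb _ w w' hw hw' h3 le_rfl
    omega
  · exact h3
  · have := h.cov_chain hb _ w' w hw' hw h3 le_rfl
    omega

/-! ### Finding the cycles -/

/-- The invariant of the loop that finds the cycles; the vertices after `i` have been processed.
If `half` holds, `i` is being processed, and its own back edge has been taken into account. -/
structure CycleInv (par tp : ℕ → ℕ) (i : ℕ) (half : Prop) (bt cc : ℕ → ℕ) : Prop where
  cov : ∀ v, bt v ≠ 0 → Cov par (tp (bt v)) (bt v) v ∧ tp (bt v) ≠ 0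
  self : ∀ v, (i < v ∨ half ∧ v = i) → tp v ≠ 0 → bt v = v
  cc_ne : ∀ v, cc v ≠ 0 → i < cc v ∧ par (cc v) = v ∧ bt (cc v) = bt v ∧ bt v ≠ 0
  bt_ne : ∀ v, bt v ≠ 0 → (bt v = v ∧ (i < v ∨ half ∧ v = i)) ∨ cc v ≠ 0
  up : ∀ v, i < v → bt v ≠ 0 → par v = tp (bt v) ∨ (cc (par v) = v ∧ bt (par v) = bt v)

theorem CycleInv.zero {i : ℕ} (hi : ∀ v, i < v → tp v = 0) :
    CycleInv par tp i False (fun _ => 0) (fun _ => 0) := by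
  constructor <;> simp +contextual [hi]

theorem CycleInv.init (h : SearchTree G f par tp) (hG : GraphSearch.IsCactus G) {i : ℕ}
    {bt cc : ℕ → ℕ} (hI : CycleInv par tp i False bt cc) :
    CycleInv par tp i True (if tp i = 0 then bt else Function.update bt i i) cc := by
  -- If `bt i` had already been set, this was done from a child on the same cycle. By uniqueness
  -- that cycle is the one with bottom `i`, which has no vertex below `i`.
  have key : tp i ≠ 0 → bt i = 0 := by
    intro ht
    by_contra hb
    obtain ⟨h1, h2⟩ := hI.cov i hb
    have h3 := (h.cov_unique hG (h.isBack_tp h2) (h.isBack_tp ht) h1 .base).1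
    rcases hI.bt_ne i hb with h4 | h4
    · simp at h4
    · obtain ⟨k1, k2, k3, k4⟩ := hI.cc_ne i h4
      have h5 := hI.cov (cc i) (by rw [k3]; exact hb)
      rw [k3, h3] at h5
      have := h.cov_le h5.1
      omega
  by_cases ht : tp i = 0
  · simp only [ht, if_true]
    constructor
    · exact hI.cov
    · rintro v (hv | ⟨_, rfl⟩) hv'
      · exact hI.self v (Or.inl hv) hv'
      · exact (hv' ht).elim
    · exact hI.cc_ne
    · intro v hv
      have := hI.bt_ne v hv
      tauto
    · exact hI.up
  · have hb := key ht
    simp only [ht, if_false]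
    have hcne : ∀ v, cc v ≠ 0 → v ≠ i ∧ cc v ≠ i := by
      intro v hv
      obtain ⟨k1, k2, k3, k4⟩ := hI.cc_ne v hv
      exact ⟨by rintro rfl; exact k4 hb, by omega⟩
    constructor
    · intro v hv
      by_cases hvi : v = i
      · subst hvi
        simp only [Function.update_self]
        exact ⟨.base, ht⟩
      · simp only [Function.update_of_ne hvi] at hv ⊢
        exact hI.cov v hv
    · intro v hv hv'
      by_cases hvi : v = i
      · rw [hvi, Function.update_self]
      · rw [Function.update_of_ne hvi]
        exact hI.self v (by tauto) hv'
    · intro v hv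
      obtain ⟨k1, k2⟩ := hcne v hv
      rw [Function.update_of_ne k1, Function.update_of_ne k2]
      exact hI.cc_ne v hv
    · intro v hv
      by_cases hvi : v = i
      · simp [hvi]
      · rw [Function.update_of_ne hvi] at hv ⊢
        have := hI.bt_ne v hv
        tauto
    · intro v hv hbv
      rw [Function.update_of_ne (by omega)] at hbv ⊢
      rcases hI.up v hv hbv with h1 | ⟨h1, h2⟩
      · exact Or.inl h1
      · have hpi : par v ≠ i := by
          intro hp
          rw [hp, hb] at h2
          exact hbv h2.symm
        rw [Function.update_of_ne hpi]
        exact Or.inr ⟨h1, h2⟩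

theorem CycleInv.step (h : SearchTree G f par tp) (hG : GraphSearch.IsCactus G) {i : ℕ}
    (hi : i ≠ 0) {bt cc : ℕ → ℕ} (hI : CycleInv par tp i True bt cc) :
    CycleInv par tp (i - 1) False
      (if bt i ≠ 0 ∧ tp (bt i) ≠ par i then Function.update bt (par i) (bt i) else bt)
      (if bt i ≠ 0 ∧ tp (bt i) ≠ par i then Function.update cc (par i) i else cc) := by
  have hlt := h.par_lt i hi
  split_ifs with hc
  · obtain ⟨hb, ht⟩ := hc
    obtain ⟨c1, c2⟩ := hI.cov i hb
    have c3 := c1.step (fun h' => ht h'.symm)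
    -- A label already present at the parent would be that of the same cycle, by uniqueness. It
    -- would come from a later child covered by the same back edge, but the covered children have
    -- distinct parents.
    have hb0 : bt (par i) = 0 := by
      by_contra hb'
      obtain ⟨d1, d2⟩ := hI.cov _ hb'
      rcases hI.bt_ne _ hb' with h1 | h1
      · omega
      · obtain ⟨k1, k2, k3, k4⟩ := hI.cc_ne _ h1
        have h2 := (h.cov_unique hG (h.isBack_tp d2) (h.isBack_tp c2) d1 c3).1
        have h3 := (hI.cov (cc (par i)) (by rw [k3]; exact k4)).1
        rw [k3, h2] at h3
        have := h.cov_inj c2 h3 c1 k2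
        omega
    have hc0 : cc (par i) = 0 := by
      by_contra hc'
      exact (hI.cc_ne _ hc').2.2.2 hb0
    have hne : ∀ v, i ≤ v → Function.update bt (par i) (bt i) v = bt v := fun v hv =>
      Function.update_of_ne (by omega) ..
    have hne' : ∀ v, i ≤ v → Function.update cc (par i) i v = cc v := fun v hv =>
      Function.update_of_ne (by omega) ..
    constructor
    · intro v hv
      by_cases hvi : v = par i
      · subst hvi
        simp only [Function.update_self]
        exact ⟨c3, c2⟩
      · simp only [Function.update_of_ne hvi] at hv ⊢
        exact hI.cov v hv
    · intro v hv hv'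
      have hv : i ≤ v := by simp only [false_and, or_false] at hv; omega
      rw [hne v hv]
      exact hI.self v (by simp only [true_and]; omega) hv'
    · intro v hv
      by_cases hvi : v = par i
      · subst hvi
        simp only [Function.update_self]
        rw [hne i le_rfl]
        exact ⟨by omega, by simp, by simp, hb⟩
      · rw [Function.update_of_ne hvi] at hv ⊢
        obtain ⟨k1, k2, k3, k4⟩ := hI.cc_ne v hv
        rw [hne _ k1.le, Function.update_of_ne hvi]
        exact ⟨by omega, k2, k3, k4⟩
    · intro v hv
      by_cases hvi : v = par i
      · subst hvi
        right
        rw [Function.update_self]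
        exact hi
      · rw [Function.update_of_ne hvi] at hv ⊢
        rw [Function.update_of_ne hvi]
        have := hI.bt_ne v hv
        rcases this with h1 | h1
        · left
          exact ⟨h1.1, Or.inl (by simp only [true_and] at h1; omega)⟩
        · exact Or.inr h1
    · intro v hv hbv
      have hv : i ≤ v := by omega
      rw [hne v hv] at hbv ⊢
      by_cases hvi : v = i
      · subst hvi
        simp
      · rcases hI.up v (by omega) hbv with h1 | ⟨h1, h2⟩
        · exact Or.inl h1
        · have hpi : par v ≠ par i := by
            intro hp
            rw [hp, hb0] at h2
            exact hbv h2.symm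
          rw [Function.update_of_ne hpi, Function.update_of_ne hpi]
          exact Or.inr ⟨h1, h2⟩
  · constructor
    · exact hI.cov
    · intro v hv
      exact hI.self v (by simp only [false_and, or_false] at hv; simp only [true_and]; omega)
    · intro v hv
      obtain ⟨k1, k2⟩ := hI.cc_ne v hv
      exact ⟨by omega, k2⟩
    · intro v hv
      rcases hI.bt_ne v hv with h1 | h1
      · left
        exact ⟨h1.1, Or.inl (by simp only [true_and] at h1; omega)⟩
      · exact Or.inr h1
    · intro v hv hbv
      by_cases hvi : v = i
      · subst hvi
        left
        by_contra hne
        exact hc ⟨hbv, fun h' => hne h'.symm⟩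
      · exact hI.up v (by omega) hbv

theorem CycleInv.layout (h : SearchTree G f par tp)
    {bt cc : ℕ → ℕ} (hI : CycleInv par tp 1 False bt cc) : Layout n par tp bt cc := by
  have hge : ∀ v, bt v ≠ 0 → 2 ≤ v := fun v hv =>
    (h.cov_tp_lt (hI.cov v hv).2 (hI.cov v hv).1).2.1
  have htp : ∀ v, tp v ≠ 0 → 2 ≤ v := fun v hv => (h.cov_tp_lt hv .base).2.1
  have hcc : ∀ v, tp v ≠ 0 → cc v = 0 := by
    intro v hv
    by_contra hc
    obtain ⟨k1, k2, k3, k4⟩ := hI.cc_ne v hc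
    obtain ⟨c1, c2⟩ := hI.cov (cc v) (by rw [k3]; exact k4)
    have h1 := hI.self v (Or.inl (htp v hv)) hv
    rw [k3, h1] at c1
    have := h.cov_le c1
    have := h.par_lt (cc v) hc
    omega
  have hup : ∀ v, bt v ≠ 0 → par v = tp (bt v) ∨ (cc (par v) = v ∧ bt (par v) = bt v) :=
    fun v hv => hI.up v (hge v hv) hv
  refine ⟨h.par_pos, h.par_range, h.par_lt, ?_, ?_, ?_, hup, ?_, ?_, ?_⟩
  · intro v hv
    have h1 := h.tp_back v hv
    have := h.cov_tp_lt hv .base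
    omega
  · intro v hv
    exact ⟨hI.self v (Or.inl (htp v hv)) hv, hcc v hv⟩
  · intro v hv
    by_cases hc : cc v = 0
    · left
      have h1 := ((hI.bt_ne v hv).resolve_right (not_not.mpr hc)).1
      refine ⟨h1, ?_⟩
      have := (hI.cov v hv).2
      rwa [h1] at this
    · right
      obtain ⟨k1, k2, k3, k4⟩ := hI.cc_ne v hc
      refine ⟨hc, k2, k3, ?_⟩
      by_contra ht
      exact hc (hcc v ht)
  · intro v hv
    obtain ⟨c1, c2⟩ := hI.cov v hv
    have := h.cov_tp_lt c2 c1
    exact ⟨by omega, by omega, c2, by omega⟩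
  · intro v hv
    by_contra hc
    exact (hI.cc_ne v hc).2.2.2 hv
  -- Climbing from the bottom stays on its cycle as long as the parent is not the top. Numbers
  -- decrease, so the child of the top is reached.
  · intro b hb
    have key : ∀ v, bt v = b → ∃ w, bt w = b ∧ par w = tp b := by
      intro v
      induction v using Nat.strong_induction_on with
      | _ v ih =>
        intro hv
        have hb0 : b ≠ 0 := by have := htp b hb; omega
        rcases hup v (by rw [hv]; exact hb0) with h1 | ⟨h1, h2⟩
        · exact ⟨v, hv, by rw [h1, hv]⟩
        · have h3 := hge v (by rw [hv]; exact hb0)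
          exact ih (par v) (h.par_lt v (by omega)) (by rw [h2, hv])
    exact key b (hI.self b (Or.inl (htp b hb)) hb)

end

end Cactus

/-! ### Loop invariants of the bottom-up and top-down passes -/

namespace Cactus

section

variable {n : ℕ} {par tp bt cc frm₀ F R frm mt dn : ℕ → ℕ}

theorem Layout.bt_large (h : Layout n par tp bt cc) {v : ℕ} (hv : bt v ≠ 0) : 2 ≤ v ∧ v ≤ n := by
  obtain ⟨h1, h2, h3, h4⟩ := h.bt_range v hv
  have := h.tp_lt _ h3
  have := h.par_range (bt v) (by omega)
  omega

/-- The invariant of the bottom-up pass; the vertices after `i` have been processed. If `half`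
holds, `i` is being processed, and `F i` and `R i` are known. -/
structure BottomUpInv (par tp bt cc : ℕ → ℕ) (i : ℕ) (half : Prop) (frm F R : ℕ → ℕ) : Prop where
  frm_zero : frm 0 = 0
  F_zero : F 0 = 1
  R_zero : R 0 = 0
  F_le : ∀ v, F v ≤ 1
  R_le : ∀ v, R v ≤ 1
  F_new : ∀ v, v ≠ 0 → (v < i ∨ ¬ half ∧ v = i) → F v = 0
  F_bridge : ∀ v, v ≠ 0 → bt v = 0 → F v = 0
  F_iff : ∀ v, (i < v ∨ half ∧ v = i) → bt v ≠ 0 → (F v = 1 ↔ frm v = 0 ∧ F (cc v) = 1)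
  R_eq : ∀ v, (i < v ∨ half ∧ v = i) → bt v ≠ 0 → R v = if F v = 1 then 1 - R (cc v) else R (cc v)
  push : ∀ v, i < v → par v ≠ 0 → frm v = 0 → F v = 0 → frm (par v) ≠ 0
  request : ∀ v, i < v → bt v ≠ 0 → par v = tp (bt v) → R v = 1 → frm (par v) ≠ 0
  frm_cases : ∀ v, frm v ≠ 0 → i < frm v ∧
    ((par (frm v) = v ∧ frm (frm v) = 0 ∧ F (frm v) = 0) ∨
      (tp (frm v) = v ∧ ∃ w, i < w ∧ bt w = frm v ∧ par w = v ∧ R w = 1))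

theorem BottomUpInv.start (h : Layout n par tp bt cc) :
    BottomUpInv par tp bt cc n False (fun _ => 0) (Function.update (fun _ => 0) 0 1)
      (fun _ => 0) := by
  constructor
  · rfl
  · simp
  · rfl
  · intro v; rw [Function.update_apply]; split <;> omega
  · intro v; omega
  · intro v hv _; rw [Function.update_of_ne hv]
  · intro v hv _; rw [Function.update_of_ne hv]
  · intro v hv hb
    have := h.bt_large hb
    simp only [false_and, or_false] at hv
    omega
  · intro v hv hb
    have := h.bt_large hb
    simp only [false_and, or_false] at hv
    omega
  · intro v hv hb
    have := h.par_range v hb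
    omega
  · intro v hv hb
    have := h.bt_large hb
    omega
  · intro v hv
    exact (hv rfl).elim

/-- When `i` is reached, `frm i` is final, because only vertices with larger numbers write to it,
and `cc i` is either `0` or larger and settled. No processed vertex refers to `F i` or `R i`. -/
theorem BottomUpInv.init (h : Layout n par tp bt cc) {i : ℕ} (hi : i ≠ 0)
    (hI : BottomUpInv par tp bt cc i False frm F R) :
    BottomUpInv par tp bt cc i True frm
      (if bt i ≠ 0 ∧ frm i = 0 ∧ F (cc i) ≠ 0 then Function.update F i 1 else F)
      (if bt i ≠ 0 then
        Function.update R i (if frm i = 0 ∧ F (cc i) ≠ 0 then 1 - R (cc i) else R (cc i)) else R) := by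
  have hFi : F i = 0 := hI.F_new i hi (Or.inr ⟨not_false, rfl⟩)
  have hccne : ∀ v, v ≠ 0 → bt v ≠ 0 → i ≤ v → cc v ≠ i := by
    intro v hv hb hiv hc
    have := (cc_range h (v := v) (by omega)).2.1
    omega
  set F' := if bt i ≠ 0 ∧ frm i = 0 ∧ F (cc i) ≠ 0 then Function.update F i 1 else F with hF'
  set R' := if bt i ≠ 0 then
        Function.update R i (if frm i = 0 ∧ F (cc i) ≠ 0 then 1 - R (cc i) else R (cc i)) else R
    with hR'
  have hF : ∀ v, v ≠ i → F' v = F v := by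
    intro v hv
    rw [hF']
    split_ifs
    · exact Function.update_of_ne hv ..
    · rfl
  have hR : ∀ v, v ≠ i → R' v = R v := by
    intro v hv
    rw [hR']
    split_ifs
    · exact Function.update_of_ne hv ..
    · exact Function.update_of_ne hv ..
    · rfl
  have hFi' : F' i = if bt i ≠ 0 ∧ frm i = 0 ∧ F (cc i) ≠ 0 then 1 else 0 := by
    rw [hF']
    split_ifs
    · exact Function.update_self ..
    · exact hFi
  have hRi' : bt i ≠ 0 → R' i = if frm i = 0 ∧ F (cc i) ≠ 0 then 1 - R (cc i) else R (cc i) := by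
    intro hb
    rw [hR', if_pos hb, Function.update_self]
  have hRle : R' i ≤ 1 := by
    by_cases hb : bt i ≠ 0
    · rw [hRi' hb]
      have := hI.R_le (cc i)
      split_ifs <;> omega
    · rw [hR', if_neg hb]
      exact hI.R_le i
  clear_value F' R'
  constructor
  · exact hI.frm_zero
  · rw [hF 0 hi.symm]; exact hI.F_zero
  · rw [hR 0 hi.symm]; exact hI.R_zero
  · intro v
    by_cases hv : v = i
    · rw [hv, hFi']; split_ifs <;> omega
    · rw [hF v hv]; exact hI.F_le v
  · intro v
    by_cases hv : v = i
    · rw [hv]; exact hRle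
    · rw [hR v hv]; exact hI.R_le v
  · intro v hv hvi
    have hvi : v < i := by simp only [not_true, false_and, or_false] at hvi; exact hvi
    rw [hF v (by omega)]
    exact hI.F_new v hv (Or.inl hvi)
  · intro v hv hb
    by_cases hvi : v = i
    · rw [hvi, hFi', if_neg]
      rw [← hvi]
      tauto
    · rw [hF v hvi]; exact hI.F_bridge v hv hb
  · intro v hv hb
    have hle : i ≤ v := by simp only [true_and] at hv; omega
    rw [hF _ (hccne v (by omega) hb hle)]
    by_cases hvi : v = i
    · rw [hvi] at hb ⊢
      rw [hFi']
      have := hI.F_le (cc i)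
      by_cases hc : bt i ≠ 0 ∧ frm i = 0 ∧ F (cc i) ≠ 0
      · rw [if_pos hc]; omega
      · rw [if_neg hc]; omega
    · rw [hF v hvi]
      exact hI.F_iff v (Or.inl (by omega)) hb
  · intro v hv hb
    have hle : i ≤ v := by simp only [true_and] at hv; omega
    rw [hR _ (hccne v (by omega) hb hle)]
    by_cases hvi : v = i
    · rw [hvi] at hb ⊢
      by_cases hc : frm i = 0 ∧ F (cc i) ≠ 0
      · have hF1 : F' i = 1 := by rw [hFi', if_pos ⟨hb, hc⟩]
        rw [hRi' hb, if_pos hc, if_pos hF1]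
      · have hF1 : F' i ≠ 1 := by rw [hFi', if_neg (by tauto)]; omega
        rw [hRi' hb, if_neg hc, if_neg hF1]
    · rw [hF v hvi, hR v hvi]
      exact hI.R_eq v (Or.inl (by omega)) hb
  · intro v hv hp hf hFv
    rw [hF v (by omega)] at hFv
    exact hI.push v hv hp hf hFv
  · intro v hv hb hp hRv
    rw [hR v (by omega)] at hRv
    exact hI.request v hv hb hp hRv
  · intro v hv
    obtain ⟨h1, h2⟩ := hI.frm_cases v hv
    refine ⟨h1, ?_⟩
    rw [hF _ (by omega)]
    rcases h2 with h2 | ⟨h2, w, h3, h4, h5, h6⟩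
    · exact Or.inl h2
    · exact Or.inr ⟨h2, w, h3, h4, h5, by rw [hR w (by omega)]; exact h6⟩

/-- The effect of the attempts to match the parent of `i`. -/
theorem BottomUpInv.step (h : Layout n par tp bt cc) {i : ℕ} (hi : i ≠ 0) (hp : par i ≠ 0)
    (hI : BottomUpInv par tp bt cc i True frm F R) {frm₁ frm₂ : ℕ → ℕ}
    (h₁ : frm₁ = if bt i ≠ 0 ∧ tp (bt i) = par i ∧ R i ≠ 0 ∧ frm (par i) = 0 then
      Function.update frm (par i) (bt i) else frm)
    (h₂ : frm₂ = if frm₁ i = 0 ∧ F i = 0 ∧ frm₁ (par i) = 0 then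
      Function.update frm₁ (par i) i else frm₁) :
    BottomUpInv par tp bt cc (i - 1) False frm₂ F R := by
  have hlt := h.par_lt i hi
  have hRi := hI.R_le i
  have e1 : ∀ v, v ≠ par i → frm₁ v = frm v := by
    intro v hv
    rw [h₁]
    split_ifs
    · exact Function.update_of_ne hv ..
    · rfl
  have e2 : ∀ v, v ≠ par i → frm₂ v = frm v := by
    intro v hv
    rw [h₂, ← e1 v hv]
    split_ifs
    · exact Function.update_of_ne hv ..
    · rfl
  have m1 : frm (par i) ≠ 0 → frm₁ (par i) = frm (par i) := by
    intro hne
    rw [h₁, if_neg (by tauto)]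
  have m2 : frm₁ (par i) ≠ 0 → frm₂ (par i) = frm₁ (par i) := by
    intro hne
    rw [h₂, if_neg (by tauto)]
  -- Entries are filled but never overwritten, so whatever was matched before stays matched.
  have m3 : ∀ v, frm v ≠ 0 → frm₂ v = frm v := by
    intro v hv
    by_cases hvp : v = par i
    · subst hvp
      rw [m2 (by rw [m1 hv]; exact hv), m1 hv]
    · exact e2 v hvp
  have p1 : bt i ≠ 0 → par i = tp (bt i) → R i = 1 → frm₁ (par i) ≠ 0 := by
    intro k1 k2 k3
    by_cases k4 : frm (par i) = 0
    · rw [h₁, if_pos ⟨k1, k2.symm, by omega, k4⟩, Function.update_self]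
      exact k1
    · rw [m1 k4]; exact k4
  have p2 : frm i = 0 → F i = 0 → frm₂ (par i) ≠ 0 := by
    intro k1 k2
    by_cases k4 : frm₁ (par i) = 0
    · rw [h₂, if_pos ⟨by rw [e1 i (by omega)]; exact k1, k2, k4⟩, Function.update_self]
      exact hi
    · rw [m2 k4]; exact k4
  have c1 : frm (par i) = 0 → frm₂ (par i) ≠ 0 →
      (frm₂ (par i) = bt i ∧ bt i ≠ 0 ∧ tp (bt i) = par i ∧ R i ≠ 0) ∨
      (frm₂ (par i) = i ∧ frm i = 0 ∧ F i = 0) := by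
    intro k1 k2
    by_cases k4 : frm₁ (par i) = 0
    · by_cases k5 : frm₁ i = 0 ∧ F i = 0 ∧ frm₁ (par i) = 0
      · right
        rw [h₂, if_pos k5, Function.update_self]
        exact ⟨rfl, by rw [← e1 i (by omega)]; exact k5.1, k5.2.1⟩
      · rw [h₂, if_neg k5] at k2
        exact (k2 k4).elim
    · left
      rw [m2 k4]
      by_cases k5 : bt i ≠ 0 ∧ tp (bt i) = par i ∧ R i ≠ 0 ∧ frm (par i) = 0
      · rw [h₁, if_pos k5, Function.update_self]
        exact ⟨rfl, k5.1, k5.2.1, k5.2.2.1⟩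
      · rw [h₁, if_neg k5] at k4
        exact (k4 k1).elim
  clear h₁ h₂
  constructor
  · rw [e2 0 hp.symm]; exact hI.frm_zero
  · exact hI.F_zero
  · exact hI.R_zero
  · exact hI.F_le
  · exact hI.R_le
  · intro v hv hvi
    simp only [not_false_eq_true, true_and] at hvi
    exact hI.F_new v hv (Or.inl (by omega))
  · exact hI.F_bridge
  · intro v hv hb
    have hle : i ≤ v := by simp only [false_and, or_false] at hv; omega
    rw [e2 v (by omega)]
    exact hI.F_iff v (by simp only [true_and]; omega) hb
  · intro v hv hb
    have hle : i ≤ v := by simp only [false_and, or_false] at hv; omega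
    exact hI.R_eq v (by simp only [true_and]; omega) hb
  · intro v hv hpv hf hF
    rw [e2 v (by omega)] at hf
    by_cases hvi : v = i
    · rw [hvi] at hf hF ⊢
      exact p2 hf hF
    · have := hI.push v (by omega) hpv hf hF
      rwa [m3 _ this]
  · intro v hv hb hpv hR
    by_cases hvi : v = i
    · rw [hvi] at hb hpv hR ⊢
      have := p1 hb hpv hR
      rwa [m2 this]
    · have := hI.request v (by omega) hb hpv hR
      rwa [m3 _ this]
  · intro v hv
    by_cases hfv : frm v = 0
    · have hvp : v = par i := by
        by_contra hvp
        rw [e2 v hvp] at hv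
        exact hv hfv
      rw [hvp] at hv hfv ⊢
      rcases c1 hfv hv with ⟨k1, k2, k3, k4⟩ | ⟨k1, k2, k3⟩
      · rw [k1]
        have := h.bt_range i k2
        exact ⟨by omega, Or.inr ⟨k3, i, by omega, rfl, rfl, by omega⟩⟩
      · rw [k1, e2 i (by omega)]
        exact ⟨by omega, Or.inl ⟨rfl, k2, k3⟩⟩
    · rw [m3 v hfv]
      obtain ⟨k1, k2⟩ := hI.frm_cases v hfv
      rw [e2 _ (by omega)]
      refine ⟨by omega, ?_⟩
      rcases k2 with k2 | ⟨k2, w, k3, k4⟩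
      · exact Or.inl k2
      · exact Or.inr ⟨k2, w, by omega, k4⟩

theorem BottomUpInv.bottomUp (h : Layout n par tp bt cc)
    (hI : BottomUpInv par tp bt cc 1 False frm F R) : BottomUp par tp bt cc frm F R := by
  refine ⟨hI.frm_zero, hI.F_zero, hI.R_zero, hI.F_le, hI.R_le, hI.F_bridge, ?_, ?_, ?_, ?_, ?_⟩
  · exact fun v hb => hI.F_iff v (Or.inl (h.bt_large hb).1) hb
  · exact fun v hb => hI.R_eq v (Or.inl (h.bt_large hb).1) hb
  · exact fun v hp => hI.push v (h.par_range v hp).1 hp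
  · exact fun v hb => hI.request v (h.bt_large hb).1 hb
  · intro v hv
    rcases (hI.frm_cases v hv).2 with k | ⟨k, w, _, k2⟩
    · exact Or.inl k
    · exact Or.inr ⟨k, w, k2⟩

/-- The invariant of the top-down pass; the vertices before `i` have been processed. -/
structure TopDownInv (par tp cc F frm₀ : ℕ → ℕ) (i : ℕ) (frm mt dn : ℕ → ℕ) : Prop where
  mt_le : ∀ v, mt v ≤ 1
  mt_iff : ∀ w, mt w = 1 ↔ w ≠ 0 ∧ F (par w) = 1 ∧ mt (par w) = 0 ∧ cc (par w) = w ∧ par w < i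
  select : ∀ v, v < i → v ≠ 0 → F v = 1 → mt v = 0 → cc v ≠ 0 →
    (dn (cc v) ≠ 0 ∧ frm v = 0 ∧ Target frm dn (tp (cc v))) ∨
    (dn (cc v) = 0 ∧ frm v = cc v ∧ ¬ Target frm dn (tp (cc v)))
  other : ∀ v, ¬ (v < i ∧ v ≠ 0 ∧ F v = 1 ∧ mt v = 0 ∧ cc v ≠ 0) → frm v = frm₀ v
  down : ∀ w, dn w ≠ 0 → mt w = 1

theorem TopDownInv.start (h : Layout n par tp bt cc) :
    TopDownInv par tp cc F frm₀ 1 frm₀ (fun _ => 0) (fun _ => 0) := by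
  constructor
  · intro v; omega
  · intro w
    simp only [zero_ne_one, false_iff]
    rintro ⟨h1, _, _, h4, h5⟩
    have : par w = 0 := by omega
    rw [this, h.cc_zero 0 h.bt_zero] at h4
    exact h1 h4.symm
  · intro v hv hv'
    omega
  · intro v _; rfl
  · intro w hw
    exact (hw rfl).elim

theorem TopDownInv.step (h : Layout n par tp bt cc) (hA : BottomUp par tp bt cc frm₀ F R) {i : ℕ}
    (hi : i ≠ 0) (hI : TopDownInv par tp cc F frm₀ i frm mt dn) {frm' mt' dn' : ℕ → ℕ}
    (hmt : mt' = if F i ≠ 0 ∧ mt i = 0 ∧ cc i ≠ 0 then Function.update mt (cc i) 1 else mt)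
    (hdn : dn' = if (F i ≠ 0 ∧ mt i = 0 ∧ cc i ≠ 0) ∧ frm (tp (cc i)) + dn (tp (cc i)) ≠ 0 then
      Function.update dn (cc i) 1 else dn)
    (hfrm : frm' = if (F i ≠ 0 ∧ mt i = 0 ∧ cc i ≠ 0) ∧ frm (tp (cc i)) + dn (tp (cc i)) = 0 then
      Function.update frm i (cc i) else frm) :
    TopDownInv par tp cc F frm₀ (i + 1) frm' mt' dn' := by
  have hFle := hA.F_le i
  by_cases hc : F i ≠ 0 ∧ mt i = 0 ∧ cc i ≠ 0
  swap
  · rw [if_neg hc] at hmt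
    rw [if_neg (by tauto)] at hdn hfrm
    rw [hmt, hdn, hfrm]
    have hnot : ¬ (F i = 1 ∧ mt i = 0 ∧ cc i ≠ 0) := fun ⟨k1, k2⟩ => hc ⟨by omega, k2⟩
    constructor
    · exact hI.mt_le
    · intro w
      rw [hI.mt_iff w]
      constructor
      · rintro ⟨k1, k2, k3, k4, k5⟩
        exact ⟨k1, k2, k3, k4, by omega⟩
      · rintro ⟨k1, k2, k3, k4, k5⟩
        refine ⟨k1, k2, k3, k4, ?_⟩
        by_contra hlt
        have : par w = i := by omega
        rw [this] at k2 k3 k4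
        exact hnot ⟨k2, k3, by omega⟩
    · intro v hv k1 k2 k3 k4
      by_cases hvi : v = i
      · subst hvi
        exact (hnot ⟨k2, k3, k4⟩).elim
      · exact hI.select v (by omega) k1 k2 k3 k4
    · intro v hv
      refine hI.other v fun k => hv ⟨by omega, k.2⟩
    · exact hI.down
  rw [if_pos hc] at hmt
  obtain ⟨hF, hm, hcc⟩ := hc
  have hF : F i = 1 := by omega
  have hpw := (h.cc_par hcc).1
  have hcr := cc_range h hcc
  set w := cc i with hw
  have hmw : mt w = 0 := by
    have := hI.mt_le w
    have := hI.mt_iff w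
    omega
  have hdw : dn w = 0 := by
    by_contra hd
    have := hI.down w hd
    omega
  have hfi : frm i = 0 := by
    rw [hI.other i (by omega)]
    exact (hA.of_F hi hF).2.1
  have hfe : ∀ v, v ≠ i → frm' v = frm v := by
    intro v hv
    rw [hfrm]
    split_ifs
    · exact Function.update_of_ne hv ..
    · rfl
  have hde : ∀ v, v ≠ w → dn' v = dn v := by
    intro v hv
    rw [hdn]
    split_ifs
    · exact Function.update_of_ne hv ..
    · rfl
  have hme : ∀ v, v ≠ w → mt' v = mt v := by
    intro v hv
    rw [hmt]
    exact Function.update_of_ne hv ..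
  have hmw' : mt' w = 1 := by rw [hmt, Function.update_self]
  -- The top `tp (cc v)` has a smaller number than `v`, or is `0`. Whether it is a target is
  -- therefore already settled and is not changed by the writes at `i` and `cc i`.
  have htgt : ∀ v, v ≤ i → v ≠ 0 → cc v ≠ 0 →
      (Target frm' dn' (tp (cc v)) ↔ Target frm dn (tp (cc v))) := by
    intro v hv hv0 hcv
    have hpv := (h.cc_par hcv).1
    have hlt : tp (cc v) < v := by
      by_cases ht : tp (cc v) = 0
      · omega
      · have := h.tp_lt _ ht
        omega
    unfold Target
    rw [hfe _ (by omega), hde _ (by omega)]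
  have hsel : (dn' w ≠ 0 ∧ frm' i = 0 ∧ Target frm dn (tp w)) ∨
      (dn' w = 0 ∧ frm' i = w ∧ ¬ Target frm dn (tp w)) := by
    by_cases ht : frm (tp w) + dn (tp w) = 0
    · right
      rw [if_neg (by tauto)] at hdn
      rw [if_pos ⟨⟨by omega, hm, hcc⟩, ht⟩] at hfrm
      rw [hdn, hfrm, Function.update_self]
      unfold Target
      omega
    · left
      rw [if_pos ⟨⟨by omega, hm, hcc⟩, ht⟩] at hdn
      rw [if_neg (by tauto)] at hfrm
      rw [hdn, hfrm, Function.update_self]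
      unfold Target
      omega
  clear hdn hfrm hmt
  constructor
  · intro v
    by_cases hv : v = w
    · rw [hv, hmw']
    · rw [hme v hv]; exact hI.mt_le v
  · intro x
    by_cases hx : x = w
    · rw [hx, hmw', hpw, hme i (by omega)]
      simp only [true_iff]
      exact ⟨hcc, hF, hm, hw.symm, by omega⟩
    · rw [hme x hx, hI.mt_iff x]
      constructor
      · rintro ⟨k1, k2, k3, k4, k5⟩
        exact ⟨k1, k2, by rw [hme _ (by omega)]; exact k3, k4, by omega⟩
      · rintro ⟨k1, k2, k3, k4, k5⟩
        rw [hme _ (by omega)] at k3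
        refine ⟨k1, k2, k3, k4, ?_⟩
        by_contra hlt
        have : par x = i := by omega
        rw [this] at k4
        exact hx (by rw [hw, k4])
  · intro v hv k1 k2 k3 k4
    rw [htgt v (by omega) k1 k4]
    by_cases hvi : v = i
    · rw [hvi, ← hw]
      exact hsel
    · have hne : cc v ≠ w := by
        intro hcw
        have := (h.cc_par k4).1
        rw [hcw] at this
        omega
      rw [hde _ hne, hfe v hvi]
      rw [hme v (by omega)] at k3
      exact hI.select v (by omega) k1 k2 k3 k4
  · intro v hv
    have hvi : v ≠ i := by
      rintro rfl
      exact hv ⟨by omega, hi, hF, by rw [hme _ (by omega)]; exact hm, hcc⟩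
    rw [hfe v hvi]
    refine hI.other v fun k => hv ⟨by omega, k.2.1, k.2.2.1, ?_, k.2.2.2.2⟩
    rw [hme v (by omega)]
    exact k.2.2.2.1
  · intro x hx
    by_cases hxw : x = w
    · rw [hxw, hmw']
    · rw [hme x hxw]
      rw [hde x hxw] at hx
      exact hI.down x hx

theorem TopDownInv.topDown (h : Layout n par tp bt cc) (hA : BottomUp par tp bt cc frm₀ F R)
    (hI : TopDownInv par tp cc F frm₀ (n + 1) frm mt dn) :
    TopDown par tp cc F frm₀ frm mt dn := by
  have hn : ∀ v, v ≠ 0 → F v = 1 → v < n + 1 := by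
    intro v hv hF
    have := h.bt_large (hA.of_F hv hF).1
    omega
  constructor
  · exact hI.mt_le
  · intro w
    rw [hI.mt_iff w]
    have : par w < n + 1 := by
      by_cases hp : par w = 0
      · omega
      · have := h.par_range w hp
        have := h.par_lt w (by omega)
        omega
    tauto
  · intro v k1 k2
    exact hI.select v (hn v k1 k2) k1 k2
  · intro v hv
    exact hI.other v fun k => hv k.2
  · exact hI.down

end

end Cactus

namespace Cactus

/-! ### Depth-first search -/

section

variable {n : ℕ} {nbr : ℕ → List ℕ} {x cnt : ℕ} {k ord idx par tp : ℕ → ℕ}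

/-- The lists `nbr v` are the neighbor lists of a simple graph with vertices `0, …, n - 1`. -/
structure IsNeighborList (n : ℕ) (nbr : ℕ → List ℕ) : Prop where
  lt : ∀ v, ∀ w ∈ nbr v, w < n
  symm : ∀ v, ∀ w ∈ nbr v, v ∈ nbr w

/-- The invariant of depth-first search: `x` is the current vertex, `cnt` vertices have been
discovered, `k v` neighbors of `v` have been inspected, `ord i` is the vertex with number `i`, and
`idx v` is the number of the vertex `v`. -/
structure DfsInv (n : ℕ) (nbr : ℕ → List ℕ) (x cnt : ℕ) (k ord idx par tp : ℕ → ℕ) : Prop where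
  cnt_pos : 1 ≤ cnt
  x_le : x ≤ cnt
  ord_lt : ∀ i, ord i < n
  idx_ord : ∀ i, 1 ≤ i → i ≤ cnt → idx (ord i) = i
  idx_le : ∀ v, idx v ≤ cnt
  ord_idx : ∀ v, idx v ≠ 0 → ord (idx v) = v
  par_ne : ∀ i, par i ≠ 0 → 2 ≤ i ∧ i ≤ cnt ∧ par i < i ∧ ord (par i) ∈ nbr (ord i)
  par_pos : ∀ i, 2 ≤ i → i ≤ cnt → par i ≠ 0
  tp_ne : ∀ i, tp i ≠ 0 → i ≤ cnt ∧ tp i < i ∧ tp i ≠ par i ∧ ord (tp i) ∈ nbr (ord i)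
  seen : ∀ v q, q < k v → ∀ hq : q < (nbr v).length, idx (nbr v)[q] ≠ 0 ∧
    (idx (nbr v)[q] < idx v → idx (nbr v)[q] = par (idx v) ∨ tp (idx v) ≠ 0)
  k_new : ∀ v, idx v = 0 → k v = 0
  stack : ∀ i, i ≠ 0 → Anc par i x → k (ord i) ≤ (nbr (ord i)).length
  -- A counter is advanced once more when its vertex is left, so that a retreat, too, lowers the
  -- potential.
  done : ∀ i, 1 ≤ i → i ≤ cnt → ¬ Anc par i x → k (ord i) = (nbr (ord i)).length + 1
  anc : ∀ i j, 1 ≤ j → j < i → i ≤ cnt → ord j ∈ nbr (ord i) → Anc par j i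

theorem Anc.cases' {j i : ℕ} (h : Anc par j i) : j = i ∨ Anc par j (par i) := by
  cases h with
  | refl => exact Or.inl rfl
  | step h => exact Or.inr h

theorem Anc.le {j i : ℕ} (hp : ∀ i, par i ≤ i) (h : Anc par j i) : j ≤ i := by
  induction h with
  | refl => rfl
  | step _ ih => exact ih.trans (hp _)

theorem Anc.congr {par' : ℕ → ℕ} {m : ℕ} (hpar : ∀ i, i ≤ m → par' i = par i)
    (hp : ∀ i, par i ≤ i) {j i : ℕ} (h : Anc par j i) (hi : i ≤ m) : Anc par' j i := by
  induction h with
  | refl => exact .refl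
  | @step i _ ih =>
    refine .step ?_
    rw [hpar i hi]
    exact ih ((hp i).trans hi)

theorem DfsInv.par_le (h : DfsInv n nbr x cnt k ord idx par tp) (i : ℕ) : par i ≤ i := by
  by_cases hi : par i = 0
  · omega
  · exact (h.par_ne i hi).2.2.1.le

theorem DfsInv.ord_inj (h : DfsInv n nbr x cnt k ord idx par tp) {i j : ℕ} (hi : 1 ≤ i)
    (hi' : i ≤ cnt) (hj : 1 ≤ j) (hj' : j ≤ cnt) (hij : ord i = ord j) : i = j := by
  rw [← h.idx_ord i hi hi', ← h.idx_ord j hj hj', hij]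

theorem DfsInv.cnt_le (h : DfsInv n nbr x cnt k ord idx par tp) : cnt ≤ n := by
  have := Finset.card_le_card_of_injOn (s := Finset.Icc 1 cnt) (t := Finset.range n) ord
    (fun i _ => by simpa using h.ord_lt i) (fun i hi j hj hij => by
      simp only [Finset.coe_Icc, Set.mem_Icc] at hi hj
      exact h.ord_inj hi.1 hi.2 hj.1 hj.2 hij)
  simpa using this

/-- The root is vertex `0` with number `1`. The zeroed array `ord` already says so, hence only the
inverse numbering has to be written. -/
theorem DfsInv.start (hn : 0 < n) :
    DfsInv n nbr 1 1 (fun _ => 0) (fun _ => 0) (Function.update (fun _ => 0) 0 1) (fun _ => 0)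
      (fun _ => 0) := by
  constructor
  · exact le_rfl
  · exact le_rfl
  · intro i; exact hn
  · intro i h1 h2
    rw [Function.update_self]; omega
  · intro v; rw [Function.update_apply]; split <;> omega
  · intro v hv
    by_contra hv0
    exact hv (Function.update_of_ne (Ne.symm hv0) ..)
  · intro i hi; exact (hi rfl).elim
  · intro i h1 h2; omega
  · intro i hi; exact (hi rfl).elim
  · intro v q hq; omega
  · intro v _; rfl
  · intro i _ _; exact Nat.zero_le _
  · intro i h1 h2 h3
    have : i = 1 := by omega
    exact (h3 (this ▸ .refl)).elim
  · intro i j h1 h2 h3; omega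

theorem DfsInv.retreat (h : DfsInv n nbr x cnt k ord idx par tp) (hx : x ≠ 0)
    (hk : ¬ k (ord x) < (nbr (ord x)).length) :
    DfsInv n nbr (par x) cnt (Function.update k (ord x) (k (ord x) + 1)) ord idx par tp := by
  have hkx := h.stack x hx .refl
  have hidx := h.idx_ord x (by omega) h.x_le
  have hpx : par x < x := by
    by_cases hp : par x = 0
    · omega
    · exact (h.par_ne x hp).2.2.1
  have hne : ∀ i, 1 ≤ i → i ≤ cnt → i ≠ x →
      Function.update k (ord x) (k (ord x) + 1) (ord i) = k (ord i) := by
    intro i h1 h2 h3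
    refine Function.update_of_ne (fun h4 => h3 ?_) ..
    exact h.ord_inj h1 h2 (by omega) h.x_le h4
  refine { h with x_le := hpx.le.trans h.x_le, seen := ?_, k_new := ?_, stack := ?_, done := ?_ }
  · intro v q hq hq'
    refine h.seen v q ?_ hq'
    rw [Function.update_apply] at hq
    split_ifs at hq with hv
    · subst hv; omega
    · exact hq
  · intro v hv
    rw [Function.update_of_ne]
    · exact h.k_new v hv
    · rintro rfl; omega
  · intro i hi ha
    have := ha.le h.par_le
    have := h.x_le
    rw [hne i (by omega) (by omega) (by omega)]
    exact h.stack i hi (.step ha)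
  · intro i h1 h2 h3
    by_cases hi : i = x
    · rw [hi, Function.update_self]; omega
    · rw [hne i h1 h2 hi]
      exact h.done i h1 h2 fun ha => ha.cases'.elim hi h3

theorem DfsInv.inspect (h : DfsInv n nbr x cnt k ord idx par tp) (hx : x ≠ 0)
    (hk : k (ord x) < (nbr (ord x)).length) (hw : idx (nbr (ord x))[k (ord x)] ≠ 0)
    {tp' : ℕ → ℕ} (htp : tp' = if idx (nbr (ord x))[k (ord x)] < x ∧
        idx (nbr (ord x))[k (ord x)] ≠ par x then
      Function.update tp x (idx (nbr (ord x))[k (ord x)]) else tp) :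
    DfsInv n nbr x cnt (Function.update k (ord x) (k (ord x) + 1)) ord idx par tp' := by
  have hidx := h.idx_ord x (by omega) h.x_le
  have hne : ∀ i, 1 ≤ i → i ≤ cnt → i ≠ x →
      Function.update k (ord x) (k (ord x) + 1) (ord i) = k (ord i) := by
    intro i h1 h2 h3
    refine Function.update_of_ne (fun h4 => h3 ?_) ..
    exact h.ord_inj h1 h2 (by omega) h.x_le h4
  have hmono : ∀ i, tp i ≠ 0 → tp' i ≠ 0 := by
    intro i hi
    rw [htp]
    split_ifs
    · rw [Function.update_apply]
      split_ifs
      · exact hw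
      · exact hi
    · exact hi
  have hmem : (nbr (ord x))[k (ord x)] ∈ nbr (ord x) := List.getElem_mem _
  refine { h with tp_ne := ?_, seen := ?_, k_new := ?_, stack := ?_, done := ?_ }
  · intro i hi
    rw [htp] at hi ⊢
    split_ifs at hi ⊢ with hc
    · by_cases hix : i = x
      · subst hix
        rw [Function.update_self]
        exact ⟨h.x_le, hc.1, hc.2, by rw [h.ord_idx _ hw]; exact hmem⟩
      · rw [Function.update_of_ne hix] at hi ⊢
        exact h.tp_ne i hi
    · exact h.tp_ne i hi
  · intro v q hq hq'
    rw [Function.update_apply] at hq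
    have hold : q < k v → idx (nbr v)[q] ≠ 0 ∧
        (idx (nbr v)[q] < idx v → idx (nbr v)[q] = par (idx v) ∨ tp' (idx v) ≠ 0) := by
      intro hq
      obtain ⟨h1, h2⟩ := h.seen v q hq hq'
      exact ⟨h1, fun h3 => (h2 h3).imp_right (hmono _)⟩
    split_ifs at hq with hv
    · by_cases hqk : q < k v
      · exact hold hqk
      · subst hv
        have : q = k (ord x) := by omega
        subst this
        refine ⟨hw, fun hlt => ?_⟩
        rw [hidx] at hlt ⊢
        by_cases hp : idx (nbr (ord x))[k (ord x)] = par x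
        · exact Or.inl hp
        · right
          rw [htp, if_pos ⟨hlt, hp⟩, Function.update_self]
          exact hw
    · exact hold hq
  · intro v hv
    rw [Function.update_of_ne]
    · exact h.k_new v hv
    · rintro rfl; omega
  · intro i hi ha
    have := ha.le h.par_le
    have := h.x_le
    by_cases hix : i = x
    · rw [hix, Function.update_self]; omega
    · rw [hne i (by omega) (by omega) hix]
      exact h.stack i hi ha
  · intro i h1 h2 h3
    have hix : i ≠ x := by rintro rfl; exact h3 .refl
    rw [hne i h1 h2 hix]
    exact h.done i h1 h2 h3

/-- Back edges lead to ancestors: a discovered vertex off the current tree path has had all its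
neighbors inspected and hence numbered, so it cannot be adjacent to the new vertex `w`. -/
theorem DfsInv.discover (hnbr : IsNeighborList n nbr) (h : DfsInv n nbr x cnt k ord idx par tp)
    (hx : x ≠ 0) (hk : k (ord x) < (nbr (ord x)).length) {w : ℕ}
    (hwe : w = (nbr (ord x))[k (ord x)]) (hw : idx w = 0) :
    DfsInv n nbr (cnt + 1) (cnt + 1) (Function.update k (ord x) (k (ord x) + 1))
      (Function.update ord (cnt + 1) w) (Function.update idx w (cnt + 1))
      (Function.update par (cnt + 1) x) tp := by
  have hxl := h.x_le
  have hidx := h.idx_ord x (by omega) h.x_le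
  have hmem : w ∈ nbr (ord x) := hwe ▸ List.getElem_mem _
  have hne : ∀ i, 1 ≤ i → i ≤ cnt → i ≠ x →
      Function.update k (ord x) (k (ord x) + 1) (ord i) = k (ord i) := by
    intro i h1 h2 h3
    refine Function.update_of_ne (fun h4 => h3 ?_) ..
    exact h.ord_inj h1 h2 (by omega) h.x_le h4
  have hord : ∀ i, i ≤ cnt → Function.update ord (cnt + 1) w i = ord i := fun i hi =>
    Function.update_of_ne (by omega) ..
  have hidx' : ∀ v, idx v ≠ 0 → Function.update idx w (cnt + 1) v = idx v := by
    intro v hv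
    refine Function.update_of_ne ?_ ..
    rintro rfl
    exact hv hw
  have hpar : ∀ i, i ≤ cnt → Function.update par (cnt + 1) x i = par i := fun i hi =>
    Function.update_of_ne (by omega) ..
  have hwx : w ≠ ord x := by
    rintro rfl
    omega
  have hkw : Function.update k (ord x) (k (ord x) + 1) w = 0 := by
    rw [Function.update_of_ne hwx]
    exact h.k_new w hw
  have hle' : ∀ i, Function.update par (cnt + 1) x i ≤ i := by
    intro i
    rw [Function.update_apply]
    split_ifs
    · omega
    · exact h.par_le i
  have hanc : ∀ i j, j ≤ cnt → (Anc (Function.update par (cnt + 1) x) i j ↔ Anc par i j) := by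
    intro i j hj
    exact ⟨fun ha => ha.congr (fun i hi => (hpar i hi).symm) hle' hj,
      fun ha => ha.congr hpar h.par_le hj⟩
  have hanc' : ∀ i, i ≤ cnt → (Anc (Function.update par (cnt + 1) x) i (cnt + 1) ↔
      Anc par i x) := by
    intro i hi
    rw [← hanc i x h.x_le]
    constructor
    · intro ha
      have := ha.cases'.resolve_left (by omega)
      rwa [Function.update_self] at this
    · intro ha
      exact .step (by rwa [Function.update_self])
  constructor
  · omega
  · exact le_rfl
  · intro i
    rw [Function.update_apply]
    split_ifs
    · exact hnbr.lt _ w hmem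
    · exact h.ord_lt i
  · intro i h1 h2
    by_cases hi : i = cnt + 1
    · rw [hi, Function.update_self, Function.update_self]
    · have h3 := h.idx_ord i h1 (by omega)
      rw [hord i (by omega), hidx' _ (by omega), h3]
  · intro v
    rw [Function.update_apply]
    have := h.idx_le v
    split_ifs <;> omega
  · intro v hv
    by_cases hvw : v = w
    · rw [hvw, Function.update_self, Function.update_self]
    · rw [Function.update_of_ne hvw] at hv ⊢
      rw [hord _ (h.idx_le v), h.ord_idx v hv]
  · intro i hi
    by_cases hic : i = cnt + 1
    · rw [hic, Function.update_self, Function.update_self, hord x h.x_le]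
      exact ⟨by omega, le_rfl, by omega, hnbr.symm _ _ hmem⟩
    · rw [Function.update_of_ne hic] at hi ⊢
      obtain ⟨h1, h2, h3, h4⟩ := h.par_ne i hi
      rw [hord i h2, hord _ (by omega)]
      exact ⟨h1, by omega, h3, h4⟩
  · intro i h1 h2
    by_cases hic : i = cnt + 1
    · rw [hic, Function.update_self]; exact hx
    · rw [hpar i (by omega)]
      exact h.par_pos i h1 (by omega)
  · intro i hi
    obtain ⟨h1, h2, h3, h4⟩ := h.tp_ne i hi
    rw [hpar i h1, hord i h1, hord _ (by omega)]
    exact ⟨by omega, h2, h3, h4⟩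
  · intro v q hq hq'
    by_cases hvw : v = w
    · subst hvw
      rw [hkw] at hq
      omega
    · rw [Function.update_of_ne hvw, hpar _ (h.idx_le v)]
      rw [Function.update_apply] at hq
      by_cases hqk : q < k v
      · obtain ⟨h1, h2⟩ := h.seen v q hqk hq'
        rw [hidx' _ h1]
        exact ⟨h1, h2⟩
      · split_ifs at hq with hv
        · subst hv
          have : q = k (ord x) := by omega
          subst this
          rw [← hwe, Function.update_self]
          refine ⟨by omega, fun hlt => ?_⟩
          omega
        · exact (hqk hq).elim
  · intro v hv
    have hvw : v ≠ w := by
      rintro rfl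
      rw [Function.update_self] at hv
      omega
    rw [Function.update_of_ne hvw] at hv
    rw [Function.update_of_ne]
    · exact h.k_new v hv
    · rintro rfl; omega
  · intro i hi ha
    by_cases hic : i = cnt + 1
    · rw [hic, Function.update_self, hkw]
      exact Nat.zero_le _
    · have := ha.le hle'
      have ha' := (hanc' i (by omega)).mp ha
      rw [hord i (by omega)]
      by_cases hix : i = x
      · rw [hix, Function.update_self]; omega
      · rw [hne i (by omega) (by omega) hix]
        exact h.stack i hi ha'
  · intro i h1 h2 h3
    have hic : i ≠ cnt + 1 := by rintro rfl; exact h3 .refl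
    rw [hanc' i (by omega)] at h3
    have hix : i ≠ x := by rintro rfl; exact h3 .refl
    rw [hord i (by omega), hne i h1 (by omega) hix]
    exact h.done i h1 (by omega) h3
  · intro i j h1 h2 h3 h4
    rw [hord j (by omega)] at h4
    by_cases hic : i = cnt + 1
    · rw [hic, Function.update_self] at h4
      rw [hic, hanc' j (by omega)]
      by_contra ha
      have hd := h.done j h1 (by omega) ha
      obtain ⟨q, hq, hqw⟩ := List.getElem_of_mem (hnbr.symm _ _ h4)
      have := (h.seen (ord j) q (by omega) hq).1
      rw [hqw] at this
      exact this hw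
    · rw [hord i (by omega)] at h4
      rw [hanc j i (by omega)]
      exact h.anc i j h1 h2 (by omega) h4

/-- At the end of the search all neighbors of discovered vertices have been inspected. -/
theorem DfsInv.closed (h : DfsInv n nbr 0 cnt k ord idx par tp) {v : ℕ} (hv : idx v ≠ 0) :
    ∀ w ∈ nbr v, idx w ≠ 0 ∧ (idx w < idx v → idx w = par (idx v) ∨ tp (idx v) ≠ 0) := by
  intro w hw
  have hd := h.done (idx v) (by omega) (h.idx_le v) (fun ha => hv (by
    have := ha.le h.par_le
    omega))
  rw [h.ord_idx v hv] at hd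
  obtain ⟨q, hq, rfl⟩ := List.getElem_of_mem hw
  exact h.seen v q (by omega) hq

end

/-- The neighbor lists, with natural numbers as vertices. -/
def neighbors {n : ℕ} (adj : Fin n → List (Fin n)) (v : ℕ) : List ℕ :=
  if h : v < n then (adj ⟨v, h⟩).map Fin.val else []

/-! ### From the finished search to a search tree of the graph -/

section

variable {n : ℕ} {G : SimpleGraph (Fin n)} {adj : Fin n → List (Fin n)}

theorem mem_neighbors (hadj : RAM.IsAdjacencyList G adj) {v w : Fin n} :
    (w : ℕ) ∈ neighbors adj v ↔ G.Adj v w := by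
  rw [neighbors, dif_pos v.2, List.mem_map]
  constructor
  · rintro ⟨a, ha, haw⟩
    rw [← Fin.ext haw]
    exact ((hadj v).2 a).mp ha
  · intro h
    exact ⟨w, ((hadj v).2 w).mpr h, rfl⟩

theorem lt_of_mem_neighbors {v w : ℕ} (h : w ∈ neighbors adj v) :
    v < n ∧ w < n := by
  rw [neighbors] at h
  split_ifs at h with hv
  · obtain ⟨a, _, rfl⟩ := List.mem_map.mp h
    exact ⟨hv, a.2⟩
  · simp at h

theorem isNeighborList (hadj : RAM.IsAdjacencyList G adj) :
    IsNeighborList n (neighbors adj) := by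
  constructor
  · intro v w hw
    obtain ⟨_, h⟩ := lt_of_mem_neighbors hw
    exact h
  · intro v w hw
    obtain ⟨h1, h2⟩ := lt_of_mem_neighbors hw
    rw [mem_neighbors hadj (v := ⟨v, h1⟩) (w := ⟨w, h2⟩)] at hw
    exact (mem_neighbors hadj (v := ⟨w, h2⟩) (w := ⟨v, h1⟩)).mpr hw.symm

/-- The set of numbered vertices contains the root and is closed under adjacency, so in a connected
graph it is everything, and the count is `n`. -/
theorem DfsInv.searchTree (hG : G.Connected) (hadj : RAM.IsAdjacencyList G adj) {cnt : ℕ}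
    {k ord idx par tp : ℕ → ℕ} (h : DfsInv n (neighbors adj) 0 cnt k ord idx par tp) :
    SearchTree G (fun i => ⟨ord i, h.ord_lt i⟩) par tp := by
  have hall : ∀ v : Fin n, idx v ≠ 0 := by
    have h1 : idx (ord 1) ≠ 0 := by
      rw [h.idx_ord 1 le_rfl h.cnt_pos]
      omega
    intro v
    obtain ⟨p⟩ := hG.preconnected ⟨ord 1, h.ord_lt 1⟩ v
    have key : ∀ (a b : Fin n) (p : G.Walk a b), idx a ≠ 0 → idx b ≠ 0 := by
      intro a b p
      induction p with
      | nil => exact id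
      | cons hab _ ih => exact fun ha => ih (h.closed ha _ ((mem_neighbors hadj).mpr hab)).1
    exact key _ _ p h1
  have hcnt : cnt = n := by
    apply le_antisymm h.cnt_le
    have := Finset.card_le_card_of_injOn (s := Finset.univ) (t := Finset.Icc 1 cnt)
      (fun v : Fin n => idx v) (fun v _ => by
        have := hall v
        have := h.idx_le v
        simp only [Finset.coe_Icc, Set.mem_Icc]
        omega) (fun v _ w _ hvw => by
        simp only at hvw
        rw [Fin.ext_iff, ← h.ord_idx v (hall v), ← h.ord_idx w (hall w), hvw])
    simpa using this
  subst hcnt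
  constructor
  · intro i j h1 h2 h3 h4 hij
    exact h.ord_inj h1 h2 h3 h4 (Fin.ext_iff.mp hij)
  · intro v
    have := hall v
    exact ⟨idx v, by omega, h.idx_le v, Fin.ext (h.ord_idx v (hall v))⟩
  · exact h.par_pos
  · intro v hv
    obtain ⟨h1, h2, _⟩ := h.par_ne v hv
    exact ⟨h1, h2⟩
  · intro v hv
    by_cases hp : par v = 0
    · omega
    · exact (h.par_ne v hp).2.2.1
  · intro v hv
    rw [← mem_neighbors hadj]
    exact (h.par_ne v hv).2.2.2
  · intro v hv
    obtain ⟨h1, h2, h3, h4⟩ := h.tp_ne v hv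
    exact ⟨h1, h2, h3, (mem_neighbors hadj).mp h4⟩
  · intro i j h1 h2 h3 h4
    have h5 := h.idx_ord i (by omega) h3
    have h6 := h.idx_ord j h1 (by omega)
    have := (h.closed (v := ord i) (by omega) (ord j) ((mem_neighbors hadj (v := ⟨ord i, _⟩)
      (w := ⟨ord j, _⟩)).mpr h4)).2
    rw [h5, h6] at this
    exact this h2
  · intro i j h1 h2 h3 h4
    exact h.anc i j h1 h2 h3 ((mem_neighbors hadj (v := ⟨ord i, _⟩) (w := ⟨ord j, _⟩)).mpr h4)

end

end Cactus

namespace Cactus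

open RAM

/-! ### The program -/

/-- `p` is executed if `e` is true. -/
abbrev when (e : Expr) (p : Program) : Program := .ite e p .skip

/-- One step of depth-first search. Register `1` holds the current vertex, register `2` the number
of discovered vertices. Array `2` holds the numbers of inspected neighbors, arrays `3` and `4` the
numbering of the vertices and its inverse, array `5` the parents, array `6` the back edges. -/
def dfsBody : Program :=
  .seq (.assign 3 (.cell 3 (.reg 1)))
  (.ite (.lt (.add (.cell 0 (.reg 3)) (.cell 2 (.reg 3))) (.cell 0 (.add (.reg 3) (.lit 1))))
    (.seq (.assign 4 (.cell 1 (.add (.cell 0 (.reg 3)) (.cell 2 (.reg 3)))))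
    (.seq (.write 2 (.reg 3) (.add (.cell 2 (.reg 3)) (.lit 1)))
    (.ite (.eq (.cell 4 (.reg 4)) (.lit 0))
      (.seq (.assign 2 (.add (.reg 2) (.lit 1)))
      (.seq (.write 3 (.reg 2) (.reg 4))
      (.seq (.write 4 (.reg 4) (.reg 2))
      (.seq (.write 5 (.reg 2) (.reg 1))
      (.assign 1 (.reg 2))))))
      (when (.lt (.cell 4 (.reg 4)) (.reg 1))
        (.ite (.eq (.cell 4 (.reg 4)) (.cell 5 (.reg 1))) .skip (.write 6 (.reg 1) (.cell 4 (.reg 4))))))))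
    (.seq (.write 2 (.reg 3) (.add (.cell 2 (.reg 3)) (.lit 1)))
      (.assign 1 (.cell 5 (.reg 1)))))

/-- Depth-first search. -/
def dfs : Program :=
  .seq (.write 4 (.lit 0) (.lit 1)) (.seq (.assign 1 (.lit 1)) (.seq (.assign 2 (.lit 1))
    (.loop (.reg 1) dfsBody)))

/-- A loop over the vertices `n, …, 2`. -/
def loopDown (p : Program) : Program :=
  .seq (.assign 3 (.reg 0)) (.loop (.lt (.lit 1) (.reg 3)) (.seq p (.assign 3 (.sub (.reg 3) (.lit 1)))))

/-- A loop over the vertices `1, …, n`. -/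
def loopUp (p : Program) : Program :=
  .seq (.assign 3 (.lit 1)) (.loop (.lt (.reg 3) (.add (.reg 0) (.lit 1)))
    (.seq p (.assign 3 (.add (.reg 3) (.lit 1)))))

/-- The search for the cycles: array `9` holds their bottoms, array `8` the children. -/
def cycleBody : Program :=
  .seq (when (.cell 6 (.reg 3)) (.write 9 (.reg 3) (.reg 3)))
  (when (.cell 9 (.reg 3)) (.ite (.eq (.cell 6 (.cell 9 (.reg 3))) (.cell 5 (.reg 3))) .skip
    (.seq (.write 8 (.cell 5 (.reg 3)) (.reg 3)) (.write 9 (.cell 5 (.reg 3)) (.cell 9 (.reg 3))))))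

/-- The bottom-up pass: array `7` holds the matching, arrays `10` and `11` describe the paths. -/
def bottomUpBody : Program :=
  .seq (when (.cell 9 (.reg 3))
    (.ite (.eq (.cell 7 (.reg 3)) (.lit 0))
      (.ite (.cell 10 (.cell 8 (.reg 3)))
        (.seq (.write 10 (.reg 3) (.lit 1)) (.write 11 (.reg 3) (.sub (.lit 1) (.cell 11 (.cell 8 (.reg 3))))))
        (.write 11 (.reg 3) (.cell 11 (.cell 8 (.reg 3)))))
      (.write 11 (.reg 3) (.cell 11 (.cell 8 (.reg 3))))))
  (.seq (when (.cell 9 (.reg 3)) (when (.eq (.cell 6 (.cell 9 (.reg 3))) (.cell 5 (.reg 3))) (when (.cell 11 (.reg 3))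
    (when (.eq (.cell 7 (.cell 5 (.reg 3))) (.lit 0)) (.write 7 (.cell 5 (.reg 3)) (.cell 9 (.reg 3)))))))
  (when (.eq (.cell 7 (.reg 3)) (.lit 0)) (when (.eq (.cell 10 (.reg 3)) (.lit 0))
    (when (.eq (.cell 7 (.cell 5 (.reg 3))) (.lit 0)) (.write 7 (.cell 5 (.reg 3)) (.reg 3))))))

/-- The top-down pass: array `12` tells which vertices of the paths are matched with their parents,
array `13` tells which of them are slid to. -/
def topDownBody : Program :=
  when (.cell 10 (.reg 3)) (when (.eq (.cell 12 (.reg 3)) (.lit 0)) (when (.cell 8 (.reg 3))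
    (.seq (.write 12 (.cell 8 (.reg 3)) (.lit 1))
    (.ite (.add (.cell 7 (.cell 6 (.cell 8 (.reg 3)))) (.cell 13 (.cell 6 (.cell 8 (.reg 3)))))
      (.write 13 (.cell 8 (.reg 3)) (.lit 1))
      (.write 7 (.reg 3) (.cell 8 (.reg 3)))))))

/-- The output of the placements. -/
def placeBody : Program :=
  when (.eq (.add (.cell 7 (.reg 3)) (.cell 13 (.reg 3))) (.lit 0))
    (.seq (.write 0 (.reg 1) (.cell 3 (.reg 3))) (.assign 1 (.add (.reg 1) (.lit 1))))

/-- The output of a slide. -/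
def slideOut (e : Expr) : Program :=
  .seq (.write 1 (.reg 2) (.cell 3 e)) (.seq (.write 2 (.reg 2) (.cell 3 (.reg 3))) (.assign 2 (.add (.reg 2) (.lit 1))))

/-- The output of the slides upwards, in decreasing order. -/
def upLoop : Program :=
  .seq (.assign 3 (.reg 0)) (.loop (.reg 3) (.seq (when (.cell 7 (.reg 3)) (slideOut (.cell 7 (.reg 3))))
    (.assign 3 (.sub (.reg 3) (.lit 1)))))

/-- The whole program. -/
def program : Program :=
  .seq dfs (.seq (loopDown cycleBody) (.seq (.seq (.write 10 (.lit 0) (.lit 1)) (loopDown bottomUpBody))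
    (.seq (loopUp topDownBody) (.seq (.seq (.assign 1 (.lit 0)) (loopUp placeBody))
      (.seq (.seq (.assign 2 (.lit 0)) upLoop)
        (.seq (loopUp (when (.cell 13 (.reg 3)) (slideOut (.cell 5 (.reg 3))))) (.assign 0 (.reg 1))))))))

theorem program_tame : program.tame 2 := by decide

/-! ### Depth-first search -/

/-- The input is stored in the arrays `0` and `1`. -/
def HoldsInput (n : ℕ) (nbr : ℕ → List ℕ) (s : Store) : Prop :=
  s.reg 0 = n ∧ (∀ v, v < n → s.mem 0 (v + 1) = s.mem 0 v + (nbr v).length) ∧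
    ∀ v, v < n → ∀ q, ∀ hq : q < (nbr v).length, s.mem 1 (s.mem 0 v + q) = (nbr v)[q]

theorem sum_lt_of_increment {n v : ℕ} {ℓ k : ℕ → ℕ} (hv : v < n) (hk : k v ≤ ℓ v) :
    ∑ u ∈ Finset.range n, (ℓ u + 1 - Function.update k v (k v + 1) u) <
      ∑ u ∈ Finset.range n, (ℓ u + 1 - k u) := by
  apply Finset.sum_lt_sum
  · intro u _
    by_cases hu : u = v
    · rw [hu, Function.update_self]; omega
    · rw [Function.update_of_ne hu]
  · refine ⟨v, Finset.mem_range.mpr hv, ?_⟩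
    rw [Function.update_self]; omega

/-- The invariant of the search, as a property of the store. -/
def DfsStore (n : ℕ) (nbr : ℕ → List ℕ) (s : Store) : Prop :=
  HoldsInput n nbr s ∧ (∀ a, 7 ≤ a → s.mem a = fun _ => 0) ∧
    DfsInv n nbr (s.reg 1) (s.reg 2) (s.mem 2) (s.mem 3) (s.mem 4) (s.mem 5) (s.mem 6)

/-- Discovery, inspection and retreat all advance exactly one counter. This second conclusion makes
the sum of the remaining counts a potential. -/
theorem dfsBody_step {n : ℕ} {nbr : ℕ → List ℕ} (hnbr : IsNeighborList n nbr) (s : Store)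
    (hs : DfsStore n nbr s) (hx : s.reg 1 ≠ 0) :
    DfsStore n nbr (sem dfsBody s) ∧
      (sem dfsBody s).mem 2 = Function.update (s.mem 2) (s.mem 3 (s.reg 1))
        (s.mem 2 (s.mem 3 (s.reg 1)) + 1) := by
  obtain ⟨⟨h0, h1, h2⟩, hz, hI⟩ := hs
  have hv := hI.ord_lt (s.reg 1)
  have hoff := h1 _ hv
  by_cases hk : s.mem 2 (s.mem 3 (s.reg 1)) < (nbr (s.mem 3 (s.reg 1))).length
  · have hw := h2 _ hv _ hk
    have hlt : s.mem 0 (s.mem 3 (s.reg 1)) + s.mem 2 (s.mem 3 (s.reg 1)) <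
        s.mem 0 (s.mem 3 (s.reg 1) + 1) := by omega
    set w := (nbr (s.mem 3 (s.reg 1)))[s.mem 2 (s.mem 3 (s.reg 1))] with hwdef
    by_cases hi : s.mem 4 w = 0
    · have hd := hI.discover hnbr hx hk hwdef hi
      refine ⟨⟨⟨?_, ?_, ?_⟩, fun a ha => ?_, ?_⟩, ?_⟩
      all_goals simp [dfsBody, sem, Expr.eval, hlt, hw, hi]
      · exact h0
      · exact h1
      · exact h2
      · iterate 4 rw [Function.update_of_ne (by omega)]
        exact hz a ha
      · exact hd
    · by_cases hj : s.mem 4 w < s.reg 1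
      · by_cases hp : s.mem 4 w = s.mem 5 (s.reg 1)
        · have hd := hI.inspect hx hk hi (by rw [if_neg (fun h' => h'.2 hp)])
          refine ⟨⟨⟨?_, ?_, ?_⟩, fun a ha => ?_, ?_⟩, ?_⟩
          all_goals simp [dfsBody, sem, Expr.eval, hlt, hw, hp, hp ▸ hi, hp ▸ hj]
          · exact h0
          · exact h1
          · exact h2
          · rw [Function.update_of_ne (by omega)]
            exact hz a ha
          · exact hd
        · have hd := hI.inspect hx hk hi (by rw [if_pos ⟨hj, hp⟩])
          refine ⟨⟨⟨?_, ?_, ?_⟩, fun a ha => ?_, ?_⟩, ?_⟩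
          all_goals simp [dfsBody, sem, Expr.eval, hlt, hw, hi, hj, hp]
          · exact h0
          · exact h1
          · exact h2
          · iterate 2 rw [Function.update_of_ne (by omega)]
            exact hz a ha
          · exact hd
      · have hd := hI.inspect hx hk hi (by rw [if_neg (fun h' => hj h'.1)])
        refine ⟨⟨⟨?_, ?_, ?_⟩, fun a ha => ?_, ?_⟩, ?_⟩
        all_goals simp [dfsBody, sem, Expr.eval, hlt, hw, hi, hj]
        · exact h0
        · exact h1
        · exact h2
        · rw [Function.update_of_ne (by omega)]
          exact hz a ha
        · exact hd
  · have hlt : ¬ s.mem 0 (s.mem 3 (s.reg 1)) + s.mem 2 (s.mem 3 (s.reg 1)) <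
        s.mem 0 (s.mem 3 (s.reg 1) + 1) := by omega
    have hd := hI.retreat hx hk
    refine ⟨⟨⟨?_, ?_, ?_⟩, fun a ha => ?_, ?_⟩, ?_⟩
    all_goals simp [dfsBody, sem, Expr.eval, hlt]
    · exact h0
    · exact h1
    · exact h2
    · rw [Function.update_of_ne (by omega)]
      exact hz a ha
    · exact hd

theorem dfs_total {n : ℕ} {nbr : ℕ → List ℕ} (hn : 0 < n) (hnbr : IsNeighborList n nbr)
    {s : Store} (hs : HoldsInput n nbr s) (hz : ∀ a, 2 ≤ a → s.mem a = fun _ => 0) {N : ℕ}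
    (hN : ∑ v ∈ Finset.range n, ((nbr v).length + 1) ≤ N) :
    Total dfs s (100 * (N + 1)) fun s' => s'.reg 0 = n ∧ (∀ a, 7 ≤ a → s'.mem a = fun _ => 0) ∧
      ∃ cnt, DfsInv n nbr 0 cnt (s'.mem 2) (s'.mem 3) (s'.mem 4) (s'.mem 5) (s'.mem 6) := by
  have hloop : ∀ s', DfsStore n nbr s' → (s'.mem 2 = fun _ => 0) →
      Total (.loop (.reg 1) dfsBody) s' (90 * (N + 1)) fun s' => s'.reg 0 = n ∧
        (∀ a, 7 ≤ a → s'.mem a = fun _ => 0) ∧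
        ∃ cnt, DfsInv n nbr 0 cnt (s'.mem 2) (s'.mem 3) (s'.mem 4) (s'.mem 5) (s'.mem 6) := by
    intro s' hs' hk
    obtain ⟨t, s₂, h1, h2, h3, h4⟩ := total_loop (e := .reg 1) (p := dfsBody) (by decide)
      (DfsStore n nbr) (fun s => ∑ v ∈ Finset.range n, ((nbr v).length + 1 - s.mem 2 v))
      (by
        intro s hs hx
        obtain ⟨h3, h4⟩ := dfsBody_step hnbr s hs hx
        refine ⟨h3, ?_⟩
        simp only [h4]
        exact sum_lt_of_increment (hs.2.2.ord_lt _) (hs.2.2.stack _ hx .refl)) hs'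
      (by simpa [hk] using hN)
    refine ⟨t, s₂, h1.trans (Nat.mul_le_mul_right _ (by decide)), h2, h3.1.1, h3.2.1, s₂.reg 2, ?_⟩
    have := h3.2.2
    rwa [show s₂.reg 1 = 0 from h4] at this
  obtain ⟨t, s', h1, h2, h3⟩ := hloop
    (sem (.seq (.write 4 (.lit 0) (.lit 1)) (.seq (.assign 1 (.lit 1)) (.assign 2 (.lit 1)))) s)
    (by
      refine ⟨⟨?_, ?_, ?_⟩, fun a ha => ?_, ?_⟩
      all_goals simp [sem, Expr.eval]
      · exact hs.1
      · exact hs.2.1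
      · exact hs.2.2
      · rw [Function.update_of_ne (by omega)]
        exact hz a (by omega)
      · simpa [hz] using DfsInv.start hn)
    (by simp [sem, Expr.eval, hz])
  refine ⟨_, s', ?_, .seq (.write _ _ _ _) (.seq (.assign _ _ _) (.seq (.assign _ _ _) h2)), h3⟩
  simp only [Expr.cost]
  omega

/-! ### Loops over the vertices -/

/-- The stores `s` and `s'` differ only in the listed registers and arrays. -/
def SameOff (xs as : List ℕ) (s s' : Store) : Prop :=
  (∀ x, x ∉ xs → s'.reg x = s.reg x) ∧ ∀ a, a ∉ as → s'.mem a = s.mem a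

theorem SameOff.refl (xs as : List ℕ) (s : Store) : SameOff xs as s s :=
  ⟨fun _ _ => rfl, fun _ _ => rfl⟩

/-- The index of `I` is the last vertex not yet processed. Vertex `1` is skipped, since the root has
no parent to be matched with. -/
theorem loopDown_total {p : Program} (hp : p.loopFree) {n : ℕ} (hn : 1 ≤ n)
    (I : ℕ → Store → Prop) (hI : ∀ i s x, I i s → I i ⟨Function.update s.reg 3 x, s.mem⟩)
    (hreg : ∀ i s, I i s → s.reg 0 = n)
    (hstep : ∀ i s, 2 ≤ i → i ≤ n → s.reg 3 = i → I i s →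
      I (i - 1) (sem p s) ∧ (sem p s).reg 3 = i) {s : Store} (hs : I n s) :
    Total (loopDown p) s ((p.cost + 12) * (n + 1)) fun s' => I 1 s' := by
  obtain ⟨t, s', h1, h2, ⟨h3, h4, h5⟩, h6⟩ := total_loop (e := .lt (.lit 1) (.reg 3))
    (p := .seq p (.assign 3 (.sub (.reg 3) (.lit 1)))) (by simpa [Program.loopFree] using hp)
    (fun s => 1 ≤ s.reg 3 ∧ s.reg 3 ≤ n ∧ I (s.reg 3) s) (fun s => s.reg 3 - 1)
    (by
      rintro s ⟨h1, h2, h3⟩ hc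
      have hc : 1 < s.reg 3 := by
        by_contra hc'
        simp [Expr.eval, hc'] at hc
      obtain ⟨h4, h5⟩ := hstep (s.reg 3) s hc h2 rfl h3
      simp only [sem, Expr.eval, Function.update_self, h5]
      exact ⟨⟨by omega, by omega, hI _ _ _ h4⟩, by omega⟩)
    (s := ⟨Function.update s.reg 3 (s.reg 0), s.mem⟩)
    (by
      simp only [Function.update_self, hreg n s hs]
      exact ⟨hn, le_rfl, hI _ _ _ hs⟩)
    (N := n) (by simp only [Function.update_self, hreg n s hs]; omega)
  refine ⟨_, s', ?_, .seq (.assign _ _ _) h2, ?_⟩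
  · simp only [Expr.cost, Program.cost] at h1 ⊢
    nlinarith
  · have : s'.reg 3 = 1 := by
      by_contra hne
      simp [Expr.eval, show 1 < s'.reg 3 by omega] at h6
    rwa [this] at h5

theorem loopUp_total {p : Program} (hp : p.loopFree) {n : ℕ} (hn : 1 ≤ n)
    (I : ℕ → Store → Prop) (hI : ∀ i s x, I i s → I i ⟨Function.update s.reg 3 x, s.mem⟩)
    (hreg : ∀ i s, I i s → s.reg 0 = n)
    (hstep : ∀ i s, 1 ≤ i → i ≤ n → s.reg 3 = i → I i s →
      I (i + 1) (sem p s) ∧ (sem p s).reg 3 = i) {s : Store} (hs : I 1 s) :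
    Total (loopUp p) s ((p.cost + 12) * (n + 1)) fun s' => I (n + 1) s' := by
  obtain ⟨t, s', h1, h2, ⟨h3, h4, h5⟩, h6⟩ := total_loop
    (e := .lt (.reg 3) (.add (.reg 0) (.lit 1)))
    (p := .seq p (.assign 3 (.add (.reg 3) (.lit 1)))) (by simpa [Program.loopFree] using hp)
    (fun s => 1 ≤ s.reg 3 ∧ s.reg 3 ≤ n + 1 ∧ I (s.reg 3) s) (fun s => n + 1 - s.reg 3)
    (by
      rintro s ⟨h1, h2, h3⟩ hc
      have h0 := hreg _ _ h3
      have hc : s.reg 3 < n + 1 := by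
        by_contra hc'
        simp [Expr.eval, h0, show ¬ s.reg 3 < n + 1 from hc'] at hc
      obtain ⟨h4, h5⟩ := hstep (s.reg 3) s h1 (by omega) rfl h3
      simp only [sem, Expr.eval, Function.update_self, h5]
      exact ⟨⟨by omega, by omega, hI _ _ _ h4⟩, by omega⟩)
    (s := ⟨Function.update s.reg 3 1, s.mem⟩)
    (by
      simp only [Function.update_self]
      exact ⟨le_rfl, by omega, hI _ _ _ hs⟩)
    (N := n) (by simp only [Function.update_self]; omega)
  refine ⟨_, s', ?_, .seq (.assign _ _ _) h2, ?_⟩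
  · simp only [Expr.cost, Program.cost] at h1 ⊢
    nlinarith
  · have h0 := hreg _ _ h5
    have : s'.reg 3 = n + 1 := by
      by_contra hne
      simp [Expr.eval, h0, show s'.reg 3 < n + 1 by omega] at h6
    rwa [this] at h5

end Cactus

namespace Cactus

open RAM

/-! ### The passes over the search tree -/

theorem SameOff.update_reg {xs as : List ℕ} {s s' : Store} (h : SameOff xs as s s') {y : ℕ}
    (hy : y ∈ xs) (x : ℕ) : SameOff xs as s ⟨Function.update s'.reg y x, s'.mem⟩ :=
  ⟨fun z hz => (Function.update_of_ne (fun e : z = y => hz (e ▸ hy)) _ _).trans (h.1 z hz), h.2⟩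

theorem sem_when_write (e i v : Expr) (a : ℕ) (s : Store) :
    sem (when e (.write a i v)) s = ⟨s.reg, Function.update s.mem a
      (if e.eval s = 0 then s.mem a else Function.update (s.mem a) (i.eval s) (v.eval s))⟩ := by
  simp only [sem]
  split_ifs
  · rw [Function.update_eq_self]
  · rfl

theorem cycleBody_sem (s : Store) {i : ℕ} (hi : s.reg 3 = i) {b : ℕ → ℕ}
    (hb : b = if s.mem 6 i = 0 then s.mem 9 else Function.update (s.mem 9) i i) :
    SameOff [] [8, 9] s (sem cycleBody s) ∧
      (sem cycleBody s).mem 9 = (if b i ≠ 0 ∧ s.mem 6 (b i) ≠ s.mem 5 i then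
        Function.update b (s.mem 5 i) (b i) else b) ∧
      (sem cycleBody s).mem 8 = (if b i ≠ 0 ∧ s.mem 6 (b i) ≠ s.mem 5 i then
        Function.update (s.mem 8) (s.mem 5 i) i else s.mem 8) := by
  rw [cycleBody, sem, sem_when_write]
  simp only [Expr.eval, hi, ← hb]
  by_cases h1 : b i = 0
  · simp +contextual [sem, Expr.eval, hi, h1, SameOff]
  · by_cases h2 : s.mem 6 (b i) = s.mem 5 i
    · simp +contextual [sem, Expr.eval, hi, h1, h2, SameOff]
    · simp +contextual [sem, Expr.eval, hi, h1, h2, SameOff]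

theorem cycles_total {n : ℕ} (hn : 1 ≤ n) {G : SimpleGraph (Fin n)} (hG : GraphSearch.IsCactus G)
    {f : ℕ → Fin n} {s : Store} (h : SearchTree G f (s.mem 5) (s.mem 6)) (h0 : s.reg 0 = n)
    (h8 : s.mem 8 = fun _ => 0) (h9 : s.mem 9 = fun _ => 0) :
    Total (loopDown cycleBody) s ((cycleBody.cost + 12) * (n + 1)) fun s' =>
      SameOff [3] [8, 9] s s' ∧ Layout n (s.mem 5) (s.mem 6) (s'.mem 9) (s'.mem 8) := by
  obtain ⟨t, s', h1, h2, h3, h4⟩ := loopDown_total (p := cycleBody) (by decide) hn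
    (fun i s' => SameOff [3] [8, 9] s s' ∧
      CycleInv (s.mem 5) (s.mem 6) i False (s'.mem 9) (s'.mem 8))
    (fun i s' x hI => ⟨hI.1.update_reg (by simp) x, hI.2⟩)
    (fun i s' hI => (hI.1.1 0 (by simp)).trans h0)
    (by
      rintro i s' h2 hin hi ⟨hS, hI⟩
      obtain ⟨k1, k2, k3⟩ := cycleBody_sem s' hi rfl
      have h5 : s'.mem 5 = s.mem 5 := hS.2 5 (by simp)
      have h6 : s'.mem 6 = s.mem 6 := hS.2 6 (by simp)
      refine ⟨⟨⟨fun x hx => (k1.1 x (by simp)).trans (hS.1 x hx),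
        fun a ha => (k1.2 a ha).trans (hS.2 a ha)⟩, ?_⟩, (k1.1 3 (by simp)).trans hi⟩
      rw [k2, k3, h5, h6]
      exact (hI.init h hG).step h hG (by omega))
    (s := s) ⟨.refl _ _ _, by
      rw [h8, h9]
      refine .zero fun v hv => ?_
      by_contra ht
      have := (h.tp_back v ht).1
      omega⟩
  exact ⟨t, s', h1, h2, h3, h4.layout h⟩

/-- The intermediate arrays are given by equations in the form expected by `BottomUpInv.init` and
`BottomUpInv.step`. -/
theorem bottomUpBody_sem (s : Store) {i : ℕ} (hi : s.reg 3 = i) {F R frm₁ frm₂ : ℕ → ℕ}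
    (hF : F = if s.mem 9 i ≠ 0 ∧ s.mem 7 i = 0 ∧ s.mem 10 (s.mem 8 i) ≠ 0 then
      Function.update (s.mem 10) i 1 else s.mem 10)
    (hR : R = if s.mem 9 i ≠ 0 then Function.update (s.mem 11) i
      (if s.mem 7 i = 0 ∧ s.mem 10 (s.mem 8 i) ≠ 0 then 1 - s.mem 11 (s.mem 8 i)
        else s.mem 11 (s.mem 8 i)) else s.mem 11)
    (h₁ : frm₁ = if s.mem 9 i ≠ 0 ∧ s.mem 6 (s.mem 9 i) = s.mem 5 i ∧ R i ≠ 0 ∧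
        s.mem 7 (s.mem 5 i) = 0 then
      Function.update (s.mem 7) (s.mem 5 i) (s.mem 9 i) else s.mem 7)
    (h₂ : frm₂ = if frm₁ i = 0 ∧ F i = 0 ∧ frm₁ (s.mem 5 i) = 0 then
      Function.update frm₁ (s.mem 5 i) i else frm₁) :
    SameOff [] [7, 10, 11] s (sem bottomUpBody s) ∧ (sem bottomUpBody s).mem 7 = frm₂ ∧
      (sem bottomUpBody s).mem 10 = F ∧ (sem bottomUpBody s).mem 11 = R := by
  have e1 : sem (when (.cell 9 (.reg 3))
    (.ite (.eq (.cell 7 (.reg 3)) (.lit 0))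
      (.ite (.cell 10 (.cell 8 (.reg 3)))
        (.seq (.write 10 (.reg 3) (.lit 1)) (.write 11 (.reg 3) (.sub (.lit 1) (.cell 11 (.cell 8 (.reg 3))))))
        (.write 11 (.reg 3) (.cell 11 (.cell 8 (.reg 3)))))
      (.write 11 (.reg 3) (.cell 11 (.cell 8 (.reg 3)))))) s =
      ⟨s.reg, Function.update (Function.update s.mem 10 F) 11 R⟩ := by
    rw [hF, hR]
    by_cases c1 : s.mem 9 i = 0
    · simp [sem, Expr.eval, hi, c1]
    · by_cases c2 : s.mem 7 i = 0
      · by_cases c3 : s.mem 10 (s.mem 8 i) = 0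
        · simp [sem, Expr.eval, hi, c1, c2, c3]
        · simp [sem, Expr.eval, hi, c1, c2, c3]
      · simp [sem, Expr.eval, hi, c1, c2]
  have e2 : sem (when (.cell 9 (.reg 3)) (when (.eq (.cell 6 (.cell 9 (.reg 3))) (.cell 5 (.reg 3)))
      (when (.cell 11 (.reg 3)) (when (.eq (.cell 7 (.cell 5 (.reg 3))) (.lit 0))
        (.write 7 (.cell 5 (.reg 3)) (.cell 9 (.reg 3)))))))
      ⟨s.reg, Function.update (Function.update s.mem 10 F) 11 R⟩ =
      ⟨s.reg, Function.update (Function.update (Function.update s.mem 10 F) 11 R) 7 frm₁⟩ := by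
    rw [h₁]
    clear hF hR e1 h₁ h₂
    have e : s.mem 7 = (Function.update (Function.update s.mem 10 F) 11 R) 7 := by simp
    by_cases c1 : s.mem 9 i = 0
    · simp [sem, Expr.eval, hi, c1]
    · by_cases c2 : s.mem 6 (s.mem 9 i) = s.mem 5 i
      · by_cases c3 : R i = 0
        · simp [sem, Expr.eval, hi, c1, c2, c3]
        · by_cases c4 : s.mem 7 (s.mem 5 i) = 0
          · simp [sem, Expr.eval, hi, c1, c2, c3, c4]
          · simp [sem, Expr.eval, hi, c1, c2, c3, c4]
      · simp [sem, Expr.eval, hi, c1, c2]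
  rw [bottomUpBody, sem, e1, sem, e2, h₂]
  clear e1 e2 hF hR h₁ h₂
  by_cases c1 : frm₁ i = 0
  · by_cases c2 : F i = 0
    · by_cases c3 : frm₁ (s.mem 5 i) = 0
      · simp +contextual [sem, Expr.eval, hi, c1, c2, c3, SameOff]
      · simp +contextual [sem, Expr.eval, hi, c1, c2, c3, SameOff]
    · simp +contextual [sem, Expr.eval, hi, c1, c2, SameOff]
  · simp +contextual [sem, Expr.eval, hi, c1, SameOff]

theorem bottomUp_total {n : ℕ} (hn : 1 ≤ n) {s : Store} (h0 : s.reg 0 = n)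
    (h : Layout n (s.mem 5) (s.mem 6) (s.mem 9) (s.mem 8))
    (h7 : s.mem 7 = fun _ => 0) (h10 : s.mem 10 = fun _ => 0) (h11 : s.mem 11 = fun _ => 0) :
    Total (.seq (.write 10 (.lit 0) (.lit 1)) (loopDown bottomUpBody)) s
      ((bottomUpBody.cost + 15) * (n + 1)) fun s' => SameOff [3] [7, 10, 11] s s' ∧
        BottomUp (s.mem 5) (s.mem 6) (s.mem 9) (s.mem 8) (s'.mem 7) (s'.mem 10) (s'.mem 11) := by
  obtain ⟨t, s', h1, h2, h3, h4⟩ := loopDown_total (p := bottomUpBody) (by decide) hn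
    (fun i s' => SameOff [3] [7, 10, 11] s s' ∧
      BottomUpInv (s.mem 5) (s.mem 6) (s.mem 9) (s.mem 8) i False (s'.mem 7) (s'.mem 10)
        (s'.mem 11))
    (fun i s' x hI => ⟨hI.1.update_reg (by simp) x, hI.2⟩)
    (fun i s' hI => (hI.1.1 0 (by simp)).trans h0)
    (by
      rintro i s' h2 hin hi ⟨hS, hI⟩
      obtain ⟨k1, k2, k3, k4⟩ := bottomUpBody_sem s' hi rfl rfl rfl rfl
      have h5 : s'.mem 5 = s.mem 5 := hS.2 5 (by simp)
      have h6 : s'.mem 6 = s.mem 6 := hS.2 6 (by simp)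
      have h8 : s'.mem 8 = s.mem 8 := hS.2 8 (by simp)
      have h9 : s'.mem 9 = s.mem 9 := hS.2 9 (by simp)
      refine ⟨⟨⟨fun x hx => (k1.1 x (by simp)).trans (hS.1 x hx),
        fun a ha => (k1.2 a ha).trans (hS.2 a ha)⟩, ?_⟩, (k1.1 3 (by simp)).trans hi⟩
      rw [k2, k3, k4, h5, h6, h8, h9]
      exact (hI.init h (by omega)).step h (by omega) (h.par_pos i h2 hin) rfl rfl)
    (s := ⟨s.reg, Function.update s.mem 10 (Function.update (s.mem 10) 0 1)⟩)
    (by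
      refine ⟨⟨fun _ _ => rfl, fun a ha => Function.update_of_ne (by rintro rfl; simp at ha) _ _⟩, ?_⟩
      simpa [h7, h10, h11] using BottomUpInv.start h)
  refine ⟨_, s', ?_, .seq (.write _ _ _ _) h2, h3, h4.bottomUp h⟩
  simp only [Expr.cost]
  nlinarith

theorem topDownBody_sem (s : Store) {i : ℕ} (hi : s.reg 3 = i) {c : Prop}
    (hc : c ↔ s.mem 10 i ≠ 0 ∧ s.mem 12 i = 0 ∧ s.mem 8 i ≠ 0) [Decidable c] :
    SameOff [] [7, 12, 13] s (sem topDownBody s) ∧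
      (sem topDownBody s).mem 12 =
        (if c then Function.update (s.mem 12) (s.mem 8 i) 1 else s.mem 12) ∧
      (sem topDownBody s).mem 13 =
        (if c ∧ s.mem 7 (s.mem 6 (s.mem 8 i)) + s.mem 13 (s.mem 6 (s.mem 8 i)) ≠ 0 then
          Function.update (s.mem 13) (s.mem 8 i) 1 else s.mem 13) ∧
      (sem topDownBody s).mem 7 =
        (if c ∧ s.mem 7 (s.mem 6 (s.mem 8 i)) + s.mem 13 (s.mem 6 (s.mem 8 i)) = 0 then
          Function.update (s.mem 7) i (s.mem 8 i) else s.mem 7) := by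
  rw [topDownBody]
  by_cases c1 : s.mem 10 i = 0
  · simp +contextual [sem, Expr.eval, hi, hc, c1, SameOff]
  · by_cases c2 : s.mem 12 i = 0
    · by_cases c3 : s.mem 8 i = 0
      · simp +contextual [sem, Expr.eval, hi, hc, c1, c2, c3, SameOff]
      · by_cases c4 : s.mem 7 (s.mem 6 (s.mem 8 i)) + s.mem 13 (s.mem 6 (s.mem 8 i)) = 0
        · have c5 : s.mem 7 (s.mem 6 (s.mem 8 i)) = 0 := by omega
          have c6 : s.mem 13 (s.mem 6 (s.mem 8 i)) = 0 := by omega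
          simp +contextual [sem, Expr.eval, hi, hc, c1, c2, c3, c5, c6, SameOff]
        · have c5 : ¬ (s.mem 7 (s.mem 6 (s.mem 8 i)) = 0 ∧ s.mem 13 (s.mem 6 (s.mem 8 i)) = 0) := by
            omega
          simp +contextual [sem, Expr.eval, hi, hc, c1, c2, c3, c5, SameOff]
    · simp +contextual [sem, Expr.eval, hi, hc, c1, c2, SameOff]

theorem topDown_total {n : ℕ} (hn : 1 ≤ n) {s : Store} (h0 : s.reg 0 = n)
    (h : Layout n (s.mem 5) (s.mem 6) (s.mem 9) (s.mem 8))
    (hA : BottomUp (s.mem 5) (s.mem 6) (s.mem 9) (s.mem 8) (s.mem 7) (s.mem 10) (s.mem 11))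
    (h12 : s.mem 12 = fun _ => 0) (h13 : s.mem 13 = fun _ => 0) :
    Total (loopUp topDownBody) s ((topDownBody.cost + 12) * (n + 1)) fun s' =>
      SameOff [3] [7, 12, 13] s s' ∧
        TopDown (s.mem 5) (s.mem 6) (s.mem 8) (s.mem 10) (s.mem 7) (s'.mem 7) (s'.mem 12)
          (s'.mem 13) := by
  obtain ⟨t, s', h1, h2, h3, h4⟩ := loopUp_total (p := topDownBody) (by decide) hn
    (fun i s' => SameOff [3] [7, 12, 13] s s' ∧
      TopDownInv (s.mem 5) (s.mem 6) (s.mem 8) (s.mem 10) (s.mem 7) i (s'.mem 7) (s'.mem 12)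
        (s'.mem 13))
    (fun i s' x hI => ⟨hI.1.update_reg (by simp) x, hI.2⟩)
    (fun i s' hI => (hI.1.1 0 (by simp)).trans h0)
    (by
      rintro i s' h2 hin hi ⟨hS, hI⟩
      obtain ⟨k1, k2, k3, k4⟩ := topDownBody_sem s' hi Iff.rfl
      have h6 : s'.mem 6 = s.mem 6 := hS.2 6 (by simp)
      have h8 : s'.mem 8 = s.mem 8 := hS.2 8 (by simp)
      have h10 : s'.mem 10 = s.mem 10 := hS.2 10 (by simp)
      refine ⟨⟨⟨fun x hx => (k1.1 x (by simp)).trans (hS.1 x hx),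
        fun a ha => (k1.2 a ha).trans (hS.2 a ha)⟩, ?_⟩, (k1.1 3 (by simp)).trans hi⟩
      rw [h6, h8, h10] at k3 k4
      rw [h8, h10] at k2
      exact hI.step h hA (by omega) k2 k3 k4)
    (s := s) ⟨.refl _ _ _, by
      rw [h12, h13]
      exact .start h⟩
  exact ⟨t, s', h1, h2, h3, h4.topDown h hA⟩

/-! ### The output -/

theorem filter_range'_succ (P : ℕ → Bool) {i : ℕ} (hi : 1 ≤ i) :
    (List.range' 1 (i + 1 - 1)).filter P =
      (List.range' 1 (i - 1)).filter P ++ if P i then [i] else [] := by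
  obtain ⟨j, rfl⟩ := Nat.exists_eq_add_of_le' hi
  rw [show j + 1 + 1 - 1 = j + 1 by omega, List.range'_concat, List.filter_append]
  simp [List.filter_singleton, add_comm]

theorem filter_reverse_range'_succ (P : ℕ → Bool) {i n : ℕ} (hi : 1 ≤ i) (hin : i ≤ n) :
    (List.range' (i - 1 + 1) (n - (i - 1))).reverse.filter P =
      (List.range' (i + 1) (n - i)).reverse.filter P ++ if P i then [i] else [] := by
  rw [show n - (i - 1) = n - i + 1 by omega, show i - 1 + 1 = i by omega, List.range'_succ,
    List.reverse_cons, List.filter_append]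
  simp [List.filter_singleton]

/-- Register `1` and array `0` hold the list `l`. -/
def HoldsPlaces (l : List ℕ) (s : Store) : Prop :=
  s.reg 1 = l.length ∧ ∀ q (hq : q < l.length), s.mem 0 q = l[q]

/-- Register `2` and the arrays `1` and `2` hold the list `l`. -/
def HoldsSlides (l : List (ℕ × ℕ)) (s : Store) : Prop :=
  s.reg 2 = l.length ∧ ∀ q (hq : q < l.length), s.mem 1 q = l[q].1 ∧ s.mem 2 q = l[q].2

theorem HoldsPlaces.append {l : List ℕ} {s s' : Store} (h : HoldsPlaces l s) {x : ℕ}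
    (h1 : s'.reg 1 = s.reg 1 + 1) (h0 : s'.mem 0 = Function.update (s.mem 0) (s.reg 1) x) :
    HoldsPlaces (l ++ [x]) s' := by
  refine ⟨by rw [h1, h.1, List.length_append, List.length_singleton], fun q hq => ?_⟩
  rw [h0, h.1]
  rw [List.length_append, List.length_singleton] at hq
  by_cases hql : q = l.length
  · subst hql
    simp
  · rw [Function.update_of_ne hql, List.getElem_append_left (by omega)]
    exact h.2 q (by omega)

theorem HoldsSlides.append {l : List (ℕ × ℕ)} {s s' : Store} (h : HoldsSlides l s) {x y : ℕ}
    (h2 : s'.reg 2 = s.reg 2 + 1) (hm₁ : s'.mem 1 = Function.update (s.mem 1) (s.reg 2) x)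
    (hm₂ : s'.mem 2 = Function.update (s.mem 2) (s.reg 2) y) :
    HoldsSlides (l ++ [(x, y)]) s' := by
  refine ⟨by rw [h2, h.1, List.length_append, List.length_singleton], fun q hq => ?_⟩
  rw [hm₁, hm₂, h.1]
  rw [List.length_append, List.length_singleton] at hq
  by_cases hql : q = l.length
  · subst hql
    simp
  · rw [Function.update_of_ne hql, Function.update_of_ne hql,
      List.getElem_append_left (by omega)]
    exact h.2 q (by omega)

theorem places_total {n : ℕ} (hn : 1 ≤ n) {s : Store} (h0 : s.reg 0 = n) :
    Total (.seq (.assign 1 (.lit 0)) (loopUp placeBody)) s ((placeBody.cost + 14) * (n + 1))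
      fun s' => SameOff [1, 3] [0] s s' ∧
        HoldsPlaces ((placeList n (s.mem 7) (s.mem 13)).map (s.mem 3)) s' := by
  obtain ⟨t, s', h1, h2, h3, h4⟩ := loopUp_total (p := placeBody) (by decide) hn
    (fun i s' => SameOff [1, 3] [0] s s' ∧
      HoldsPlaces ((placeList (i - 1) (s.mem 7) (s.mem 13)).map (s.mem 3)) s')
    (fun i s' x hI => ⟨hI.1.update_reg (by simp) x, hI.2⟩)
    (fun i s' hI => (hI.1.1 0 (by simp)).trans h0)
    (by
      rintro i s' h2 hin hi ⟨hS, hI⟩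
      have m3 : s'.mem 3 = s.mem 3 := hS.2 3 (by simp)
      have m7 : s'.mem 7 = s.mem 7 := hS.2 7 (by simp)
      have m13 : s'.mem 13 = s.mem 13 := hS.2 13 (by simp)
      rw [placeList, filter_range'_succ _ h2, List.map_append]
      by_cases c : s.mem 7 i = 0 ∧ s.mem 13 i = 0
      · have e : sem placeBody s' = ⟨Function.update s'.reg 1 (s'.reg 1 + 1),
            Function.update s'.mem 0 (Function.update (s'.mem 0) (s'.reg 1) (s.mem 3 i))⟩ := by
          simp [placeBody, sem, Expr.eval, hi, m3, m7, m13, c]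
        rw [e]
        refine ⟨⟨⟨fun x hx => ?_, fun a ha => ?_⟩, ?_⟩, ?_⟩
        · simp only [List.mem_cons, not_or] at hx
          simpa [hx.1] using hS.1 x (by simp [hx])
        · simp only [List.mem_cons, not_or] at ha
          simpa [ha.1] using hS.2 a (by simp [ha])
        · simpa [c, placeList] using hI.append (s' := ⟨Function.update s'.reg 1 (s'.reg 1 + 1),
            Function.update s'.mem 0 (Function.update (s'.mem 0) (s'.reg 1) (s.mem 3 i))⟩)
            (x := s.mem 3 i) (by simp) (by simp)
        · simpa using hi
      · have e : sem placeBody s' = s' := by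
          simp [placeBody, sem, Expr.eval, hi, m7, m13, c]
        rw [e]
        refine ⟨⟨hS, ?_⟩, hi⟩
        simpa [c, placeList] using hI)
    (s := ⟨Function.update s.reg 1 0, s.mem⟩)
    ⟨(SameOff.refl _ _ s).update_reg (by simp) 0, by simp [HoldsPlaces, placeList]⟩
  refine ⟨_, s', ?_, .seq (.assign _ _ _) h2, h3, h4⟩
  simp only [Expr.cost]
  nlinarith

/-- The output of one slide. -/
theorem slideOut_step {s s' : Store} (hS : SameOff [2, 3] [1, 2] s s') {l : List (ℕ × ℕ)}
    (hl : HoldsSlides l s') {a i : ℕ} (ha : a ∉ [1, 2]) (hi : s'.reg 3 = i) {g : ℕ → ℕ}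
    (e : Expr) (he : e.eval s' = g i) :
    SameOff [2, 3] [1, 2] s (sem (when (.cell a (.reg 3)) (slideOut e)) s') ∧
      HoldsSlides (l ++ (if s.mem a i ≠ 0 then [i] else []).map
        fun i => (s.mem 3 (g i), s.mem 3 i)) (sem (when (.cell a (.reg 3)) (slideOut e)) s') ∧
      (sem (when (.cell a (.reg 3)) (slideOut e)) s').reg 3 = i := by
  have m3 : s'.mem 3 = s.mem 3 := hS.2 3 (by simp)
  have ma : s'.mem a = s.mem a := hS.2 a ha
  by_cases c : s.mem a i = 0
  · have e' : sem (when (.cell a (.reg 3)) (slideOut e)) s' = s' := by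
      simp [sem, Expr.eval, hi, ma, c]
    rw [e']
    exact ⟨hS, by simpa [c] using hl, hi⟩
  · have e' : sem (when (.cell a (.reg 3)) (slideOut e)) s' =
        ⟨Function.update s'.reg 2 (s'.reg 2 + 1), Function.update (Function.update s'.mem 1
          (Function.update (s'.mem 1) (s'.reg 2) (s.mem 3 (g i)))) 2
          (Function.update (s'.mem 2) (s'.reg 2) (s.mem 3 i))⟩ := by
      simp [slideOut, sem, Expr.eval, hi, ma, m3, c, he]
    rw [e', if_pos c]
    refine ⟨⟨fun x hx => ?_, fun a ha => ?_⟩, hl.append (by simp) (by simp) (by simp), by simpa using hi⟩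
    · simp only [List.mem_cons, not_or] at hx
      simpa [hx.1] using hS.1 x (by simp [hx])
    · simp only [List.mem_cons, not_or] at ha
      simpa [ha.1, ha.2.1] using hS.2 a (by simp [ha])

/-- The loop ends at `0` rather than at `1`, because the root may be a target of an upward slide. -/
theorem slidesUp_total {n : ℕ} {s : Store} (h0 : s.reg 0 = n) :
    Total (.seq (.assign 2 (.lit 0)) upLoop) s (60 * (n + 1)) fun s' =>
      SameOff [2, 3] [1, 2] s s' ∧
        HoldsSlides (((List.range' 1 n).reverse.filter fun i => s.mem 7 i ≠ 0).map
          fun i => (s.mem 3 (s.mem 7 i), s.mem 3 i)) s' := by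
  obtain ⟨t, s', h1, h2, ⟨h3, h4, h5⟩, h6⟩ := total_loop (e := .reg 3)
    (p := .seq (when (.cell 7 (.reg 3)) (slideOut (.cell 7 (.reg 3))))
      (.assign 3 (.sub (.reg 3) (.lit 1)))) (by decide)
    (fun s' => s'.reg 3 ≤ n ∧ SameOff [2, 3] [1, 2] s s' ∧
      HoldsSlides (((List.range' (s'.reg 3 + 1) (n - s'.reg 3)).reverse.filter
        fun i => s.mem 7 i ≠ 0).map fun i => (s.mem 3 (s.mem 7 i), s.mem 3 i)) s')
    (fun s' => s'.reg 3)
    (by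
      rintro s' ⟨k1, k2, k3⟩ hc
      have hc : s'.reg 3 ≠ 0 := hc
      obtain ⟨k4, k5, k6⟩ := slideOut_step k2 k3 (a := 7) (by simp) rfl (g := s.mem 7)
        (.cell 7 (.reg 3)) (by simp only [Expr.eval]; rw [k2.2 7 (by simp)])
      set s₁ := sem (when (.cell 7 (.reg 3)) (slideOut (.cell 7 (.reg 3)))) s' with hs₁
      rw [sem, ← hs₁]
      simp only [sem, Expr.eval, Function.update_self, k6]
      refine ⟨⟨by omega, k4.update_reg (by simp) _, ?_⟩, by omega⟩
      rw [filter_reverse_range'_succ _ (by omega) k1, List.map_append]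
      simpa [HoldsSlides] using k5)
    (s := ⟨Function.update (Function.update s.reg 2 0) 3 n, s.mem⟩)
    ⟨by simp, ((SameOff.refl _ _ s).update_reg (by simp) 0).update_reg (by simp) n,
      by simp [HoldsSlides]⟩ (N := n) (by simp)
  have h6 : s'.reg 3 = 0 := h6
  have h2' : Run (.loop (.reg 3) (.seq (when (.cell 7 (.reg 3)) (slideOut (.cell 7 (.reg 3))))
      (.assign 3 (.sub (.reg 3) (.lit 1))))) ⟨Function.update (Function.update s.reg 2
        ((Expr.lit 0).eval s)) 3 ((Expr.reg 0).eval
          ⟨Function.update s.reg 2 ((Expr.lit 0).eval s), s.mem⟩), s.mem⟩ t s' := by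
    simpa [Expr.eval, h0] using h2
  refine ⟨_, s', ?_, .seq (.assign _ _ _) (.seq (.assign _ _ _) h2'), h4, ?_⟩
  · simp only [Expr.cost]
    have : t ≤ 50 * (n + 1) := h1.trans (Nat.mul_le_mul_right _ (by decide))
    omega
  · simpa [h6] using h5

theorem slidesDown_total {n : ℕ} (hn : 1 ≤ n) {s : Store} (h0 : s.reg 0 = n)
    {l : List (ℕ × ℕ)} (hl : HoldsSlides l s) :
    Total (loopUp (when (.cell 13 (.reg 3)) (slideOut (.cell 5 (.reg 3))))) s (60 * (n + 1))
      fun s' => SameOff [2, 3] [1, 2] s s' ∧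
        HoldsSlides (l ++ ((List.range' 1 n).filter fun i => s.mem 13 i ≠ 0).map
          fun i => (s.mem 3 (s.mem 5 i), s.mem 3 i)) s' := by
  obtain ⟨t, s', h1, h2, h3, h4⟩ := loopUp_total
    (p := when (.cell 13 (.reg 3)) (slideOut (.cell 5 (.reg 3)))) (by decide) hn
    (fun i s' => SameOff [2, 3] [1, 2] s s' ∧
      HoldsSlides (l ++ ((List.range' 1 (i - 1)).filter fun i => s.mem 13 i ≠ 0).map
          fun i => (s.mem 3 (s.mem 5 i), s.mem 3 i)) s')
    (fun i s' x hI => ⟨hI.1.update_reg (by simp) x, by simpa [HoldsSlides] using hI.2⟩)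
    (fun i s' hI => (hI.1.1 0 (by simp)).trans h0)
    (by
      rintro i s' h2 hin hi ⟨hS, hI⟩
      obtain ⟨k4, k5, k6⟩ := slideOut_step hS hI (a := 13) (by simp) hi (g := s.mem 5)
        (.cell 5 (.reg 3)) (by simp only [Expr.eval]; rw [hS.2 5 (by simp), hi])
      refine ⟨⟨k4, ?_⟩, k6⟩
      rw [filter_range'_succ _ h2, List.map_append]
      simpa using k5)
    (s := s) ⟨.refl _ _ _, by simpa using hl⟩
  exact ⟨t, s', h1.trans (Nat.mul_le_mul_right _ (by decide)), h2, h3, h4⟩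

end Cactus

namespace Cactus

open RAM

/-! ### The input -/

section

variable {n : ℕ} {adj : Fin n → List (Fin n)}

theorem listStart_succ {v : ℕ} (hv : v < n) :
    listStart adj (v + 1) = listStart adj v + (neighbors adj v).length := by
  rw [listStart, listStart, List.take_add_one, List.flatten_append, List.length_append]
  simp [neighbors, hv]

theorem concatLists_getElem? {v : ℕ} (hv : v < n) {q : ℕ} (hq : q < (neighbors adj v).length) :
    ((concatLists adj)[listStart adj v + q]?.map Fin.val).getD 0 = (neighbors adj v)[q] := by
  have h1 : List.ofFn adj = (List.ofFn adj).take v ++ adj ⟨v, hv⟩ :: (List.ofFn adj).drop (v + 1) := by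
    conv_lhs => rw [← List.take_append_drop v (List.ofFn adj),
      List.drop_eq_getElem_cons (by simpa using hv), List.getElem_ofFn]
  have h2 : (concatLists adj)[listStart adj v + q]? = (adj ⟨v, hv⟩)[q]? := by
    have hq' : q < (adj ⟨v, hv⟩).length := by simpa [neighbors, hv] using hq
    rw [concatLists, h1, List.flatten_append, List.flatten_cons,
      List.getElem?_append_right (by rw [listStart]; omega), listStart, Nat.add_sub_cancel_left,
      List.getElem?_append_left hq']
  rw [h2]
  have hq' : q < (adj ⟨v, hv⟩).length := by simpa [neighbors, hv] using hq
  simp [neighbors, hv, hq']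

theorem holdsInput : HoldsInput n (neighbors adj) (inputStore adj) := by
  refine ⟨by simp [inputStore], fun v hv => ?_, fun v hv q hq => ?_⟩
  · simp [inputStore, hv.le, Nat.succ_le_of_lt hv, listStart_succ hv]
  · have h := concatLists_getElem? hv hq
    simpa [inputStore, hv.le] using h

theorem inputStore_mem {a : ℕ} (ha : 2 ≤ a) : (inputStore adj).mem a = fun _ => 0 := by
  funext i
  simp [inputStore, show a ≠ 0 by omega, show a ≠ 1 by omega]

theorem listStart_eq {v : ℕ} (hv : v ≤ n) :
    listStart adj v = ∑ u ∈ Finset.range v, (neighbors adj u).length := by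
  induction v with
  | zero => simp [listStart]
  | succ v ih => rw [listStart_succ hv, ih (by omega), Finset.sum_range_succ]

theorem sum_length_neighbors {G : SimpleGraph (Fin n)} (hadj : IsAdjacencyList G adj) :
    ∑ v ∈ Finset.range n, (neighbors adj v).length = 2 * G.edgeSet.ncard := by
  classical
  rw [Finset.sum_range, Set.ncard_eq_toFinset_card', ← SimpleGraph.edgeFinset,
    ← SimpleGraph.sum_degrees_eq_twice_card_edges]
  refine Finset.sum_congr rfl fun v _ => ?_
  rw [← SimpleGraph.card_neighborFinset_eq_degree, neighbors, dif_pos v.2, List.length_map,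
    ← List.toFinset_card_of_nodup (hadj v).1]
  congr 1
  ext w
  simp [(hadj v).2 w]

theorem inputStore_bounded {G : SimpleGraph (Fin n)} (hadj : IsAdjacencyList G adj) :
    (inputStore adj).Bounded (n + 2 * G.edgeSet.ncard) := by
  refine ⟨fun x => ?_, fun a i => ?_⟩
  · simp only [inputStore]
    split_ifs <;> omega
  · simp only [inputStore]
    split_ifs with h1 h2 h3
    · rw [listStart_eq h2, ← sum_length_neighbors hadj]
      have : ∑ u ∈ Finset.range i, (neighbors adj u).length ≤
          ∑ u ∈ Finset.range n, (neighbors adj u).length :=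
        Finset.sum_le_sum_of_subset (Finset.range_subset_range.mpr h2)
      omega
    · omega
    · cases (concatLists adj)[i]? with
      | none => simp
      | some v =>
        simp only [Option.map_some, Option.getD_some]
        omega
    · omega

end

/-! ### The whole program -/

/-- The search takes time proportional to the total length of the lists plus `n`, and the later
passes are linear in `n`. The output overwrites arrays `0` to `2` only when the input and the
counters are no longer needed, and register `0` keeps `n` until the last assignment. -/
theorem program_total {n : ℕ} (hn : 1 ≤ n) {G : SimpleGraph (Fin n)}
    (hG : GraphSearch.IsCactus G) {adj : Fin n → List (Fin n)} (hadj : IsAdjacencyList G adj)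
    {N : ℕ} (hN : ∑ v ∈ Finset.range n, ((neighbors adj v).length + 1) ≤ N) (hnN : n ≤ N) :
    Total program (inputStore adj) (1500 * (N + 1)) fun s =>
      ∃ places slides, HoldsOutput s (GraphSearch.czf G) places slides ∧
        GraphSearch.IsOptimal G (GraphSearch.normalized places slides) ∧
        places.length = GraphSearch.czf G := by
  have key : Total program (inputStore adj) (100 * (N + 1) + ((cycleBody.cost + 12) * (n + 1) +
      ((bottomUpBody.cost + 15) * (n + 1) + ((topDownBody.cost + 12) * (n + 1) +
        ((placeBody.cost + 14) * (n + 1) + (60 * (n + 1) + (60 * (n + 1) + 2)))))))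
      fun s => ∃ places slides, HoldsOutput s (GraphSearch.czf G) places slides ∧
        GraphSearch.IsOptimal G (GraphSearch.normalized places slides) ∧
        places.length = GraphSearch.czf G := by
    refine (dfs_total hn (isNeighborList hadj) holdsInput (fun a ha => inputStore_mem ha) hN).seq ?_
    rintro s₁ ⟨r₁, z₁, cnt, hD⟩
    have hT := hD.searchTree hG.1 hadj
    refine (cycles_total hn hG hT r₁ (z₁ 8 (by omega)) (z₁ 9 (by omega))).seq ?_
    rintro s₂ ⟨S₂, hL⟩
    have r₂ : s₂.reg 0 = n := (S₂.1 0 (by simp)).trans r₁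
    rw [← S₂.2 5 (by simp), ← S₂.2 6 (by simp)] at hL
    refine (bottomUp_total hn r₂ hL ((S₂.2 7 (by simp)).trans (z₁ 7 (by omega)))
      ((S₂.2 10 (by simp)).trans (z₁ 10 (by omega)))
      ((S₂.2 11 (by simp)).trans (z₁ 11 (by omega)))).seq ?_
    rintro s₃ ⟨S₃, hA⟩
    have r₃ : s₃.reg 0 = n := (S₃.1 0 (by simp)).trans r₂
    rw [← S₃.2 5 (by simp), ← S₃.2 6 (by simp), ← S₃.2 8 (by simp), ← S₃.2 9 (by simp)] at hA hL
    refine (topDown_total hn r₃ hL hA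
      ((S₃.2 12 (by simp)).trans ((S₂.2 12 (by simp)).trans (z₁ 12 (by omega))))
      ((S₃.2 13 (by simp)).trans ((S₂.2 13 (by simp)).trans (z₁ 13 (by omega))))).seq ?_
    rintro s₄ ⟨S₄, hB⟩
    have r₄ : s₄.reg 0 = n := (S₄.1 0 (by simp)).trans r₃
    refine (places_total hn r₄).seq ?_
    rintro s₅ ⟨S₅, hP⟩
    have r₅ : s₅.reg 0 = n := (S₅.1 0 (by simp)).trans r₄
    refine (slidesUp_total r₅).seq ?_
    rintro s₆ ⟨S₆, hU⟩
    have r₆ : s₆.reg 0 = n := (S₆.1 0 (by simp)).trans r₅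
    refine (slidesDown_total hn r₆ hU).seq ?_
    rintro s₇ ⟨S₇, hW⟩
    have o₃ : s₄.mem 3 = s₁.mem 3 :=
      (S₄.2 3 (by simp)).trans ((S₃.2 3 (by simp)).trans (S₂.2 3 (by simp)))
    have o₅ : s₄.mem 5 = s₃.mem 5 := S₄.2 5 (by simp)
    have p₃ : s₅.mem 3 = s₁.mem 3 := (S₅.2 3 (by simp)).trans o₃
    have p₇ : s₅.mem 7 = s₄.mem 7 := S₅.2 7 (by simp)
    have q₃ : s₆.mem 3 = s₁.mem 3 := (S₆.2 3 (by simp)).trans p₃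
    have q₅ : s₆.mem 5 = s₃.mem 5 := (S₆.2 5 (by simp)).trans ((S₅.2 5 (by simp)).trans o₅)
    have q₁₃ : s₆.mem 13 = s₄.mem 13 := (S₆.2 13 (by simp)).trans (S₅.2 13 (by simp))
    rw [o₃] at hP
    rw [p₃, p₇, q₃, q₅, q₁₃] at hW
    replace hW : HoldsSlides ((slideList n (s₃.mem 5) (s₄.mem 7) (s₄.mem 13)).map
        fun p => (s₁.mem 3 p.1, s₁.mem 3 p.2)) s₇ := by
      simpa only [slideList, List.map_append, List.map_map, Function.comp_def] using hW
    have hT' : SearchTree G (fun i => ⟨s₁.mem 3 i, hD.ord_lt i⟩) (s₃.mem 5) (s₃.mem 6) := by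
      rw [S₃.2 5 (by simp), S₃.2 6 (by simp), S₂.2 5 (by simp), S₂.2 6 (by simp)]
      exact hT
    obtain ⟨hopt, hcard⟩ := plan_optimal (hT'.numbering hG) hL hA hB
    refine ⟨2, _, le_rfl, .assign _ _ _, _, _, ⟨?_, ?_, ?_, ?_, ?_⟩, hopt, hcard⟩
    · rw [← hcard]
      simpa [Expr.eval, S₇.1 1, S₆.1 1] using hP.1
    · simpa [S₇.1 1, S₆.1 1] using hP.1
    · intro i hi
      rw [List.length_map] at hi
      have := hP.2 i (by simpa using hi)
      simpa [S₇.2 0, S₆.2 0] using this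
    · simpa using hW.1
    · intro i hi
      rw [List.length_map] at hi
      have := hW.2 i (by simpa using hi)
      simpa using this
  obtain ⟨t, s', h1, h2, h3⟩ := key
  refine ⟨t, s', h1.trans ?_, h2, h3⟩
  have c1 : cycleBody.cost ≤ 100 := by decide
  have c2 : bottomUpBody.cost ≤ 200 := by decide
  have c3 : topDownBody.cost ≤ 100 := by decide
  have c4 : placeBody.cost ≤ 100 := by decide
  nlinarith

end Cactus

theorem mainTheorem11 :
    ∃ (P : RAM.Program) (C : ℕ),
      ∀ (n : ℕ) (G : SimpleGraph (Fin n)), GraphSearch.IsCactus G →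
        ∀ adj : Fin n → List (Fin n), RAM.IsAdjacencyList G adj →
          ∃ (t : ℕ) (s : RAM.Store) (places : List (Fin n)) (slides : List (Fin n × Fin n)),
            RAM.Exec (C * (n + G.edgeSet.ncard)) P (RAM.inputStore adj) t s ∧
            t ≤ C * (n + G.edgeSet.ncard) ∧
            RAM.HoldsOutput s (GraphSearch.czf G) places slides ∧
            GraphSearch.IsOptimal G (GraphSearch.normalized places slides) ∧
            GraphSearch.searcherCount (GraphSearch.normalized places slides) =
              GraphSearch.czf G := by
  -- With m edges the time is at most 1500(n + 2m + 1), and the word bound needs 2(n + 2m + t + 1).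
  -- Both are at most 10000(n + m), because a connected graph has n ≥ 1.
  refine ⟨Cactus.program, 10000, fun n G hG adj hadj => ?_⟩
  have hn : 1 ≤ n := by
    obtain ⟨v⟩ := hG.1.nonempty
    exact Nat.succ_le_of_lt v.pos
  have hsum : ∑ v ∈ Finset.range n, ((Cactus.neighbors adj v).length + 1) =
      n + 2 * G.edgeSet.ncard := by
    rw [Finset.sum_add_distrib, Cactus.sum_length_neighbors hadj]
    simp [add_comm]
  obtain ⟨t, s, ht, hrun, places, slides, hout, hopt, hcard⟩ :=
    Cactus.program_total hn hG hadj hsum.le (by omega)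
  refine ⟨t, s, places, slides, ?_, by omega, hout, hopt,
    (GraphSearch.searcherCount_normalized _ _).trans hcard⟩
  exact (hrun.exec (w := 2) (by omega) Cactus.program_tame _ (Cactus.inputStore_bounded hadj)
    (by omega)).1
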